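/- Let $\Sigma$ be a compact connected oriented surface with non-empty boundary, $\mathcal M\subset\partial\Sigma$ a finite set of marked points meeting every boundary component, and $\mathcal P$ a finite non-empty set of points in the interior of $\Sigma$, called punctures; assume that $(\Sigma,\mathcal M,\mathcal P)$ is not a once-punctured monogon. Let $\tau$ be an ideal triangulation of $(\Sigma,\mathcal M,\mathcal P)$, i.e. a decomposition of $\Sigma$ into triangles with vertex set $\mathcal M\cup\mathcal P$, where two sides of the same triangle may coincide (the triangle is then called self-folded). Assume that for every puncture $P$ there is a self-folded triangle $T_P$ around $P$ (its two folded sides are one and the same arc, which joins $P$ to another point of $\mathcal M\cup\mathcal P$), and that no triangle shares a side with two self-folded triangles. For each puncture $P$ choose a point $P'$ in the interior of $T_P$, and let $\mathcal P'$ be the set of these points. The orbifold fundamental groupoid $\pi_1^{\rm orb}(\Sigma,E)$, for $E\subset\Sigma\setminus\mathcal P$, has the points of $E$ as objects; its morphisms are the homotopy classes of paths in $\Sigma\setminus\mathcal P$ between points of $E$, modulo the relations which say that going once around a puncture in one direction is the same as going once around it in the other direction (equivalently, the square of every simple loop around a puncture is trivial). Composition is written from right to left. Let $\pi_1^{\rm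 orb}(\Sigma,\mathcal M;\mathcal P')$ be the set of morphisms with source in $\mathcal M$ and target in $\mathcal P'$, and let $\pi_1^{\rm orb}(\Sigma,\mathcal M)^*$ be the set of morphisms of $\pi_1^{\rm orb}(\Sigma,\mathcal M)$ which are not identities. For each puncture $P$ let $e_P:P'\to P'$ be the class of the loop in $T_P$ based at $P'$ which crosses the folded side of $T_P$ once. Then there is a bijection \[ \Phi:\ \pi_1^{\rm orb}(\Sigma,\mathcal M;\mathcal P')\ \longrightarrow\ \{\gamma\in\pi_1^{\rm orb}(\Sigma,\mathcal M)^*\mid\gamma=\gamma^{-1}\}\times\mathbb Z/2\mathbb Z \] which is natural in the following sense: for every $v:M\to P'$ the first component of $\Phi(v)$ is $\gamma=v^{-1}e_Pv$, and if $\Phi(v)=(\gamma,\varepsilon)$ then $\Phi(e_Pv)=(\gamma,\varepsilon+1)$. -/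

import Mathlib

open CategoryTheory
open scoped Manifold Topology unitInterval

noncomputable section

/-- A surface is orientable when it contains no Möbius band, i.e. no injective image of the
square with two opposite sides identified by a flip. -/
def IsOrientableSurface (X : Type*) [TopologicalSpace X] : Prop :=
  ¬ ∃ f : I × I → X, Continuous f ∧ ∀ p q : I × I, f p = f q ↔
    (p = q ∨ (p.1 = 0 ∧ q.1 = 1 ∧ q.2 = σ p.2) ∨ (p.1 = 1 ∧ q.1 = 0 ∧ q.2 = σ p.2))

/-- The structure of a punctured marked surface `(Σ, M, P)` on a topological surface `X` with
boundary: `X` is compact, connected, orientable, with nonempty boundary; `marked` is a finite set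
of boundary points meeting every boundary component; `punctures` is a finite nonempty set of
interior points; and the once-punctured monogon is excluded. -/
structure MarkedSurface (X : Type*) [TopologicalSpace X]
    [ChartedSpace (EuclideanHalfSpace 2) X] where
  marked : Set X
  punctures : Set X
  compact : CompactSpace X
  hausdorff : T2Space X
  connected : ConnectedSpace X
  orientable : IsOrientableSurface X
  boundary_nonempty : ((𝓡∂ 2).boundary X).Nonempty
  marked_finite : marked.Finite
  marked_subset : marked ⊆ (𝓡∂ 2).boundary X
  marked_meets : ∀ x ∈ (𝓡∂ 2).boundary X,
    (marked ∩ connectedComponentIn ((𝓡∂ 2).boundary X) x).Nonempty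
  punctures_finite : punctures.Finite
  punctures_nonempty : punctures.Nonempty
  punctures_subset : punctures ⊆ (𝓡∂ 2).interior X
  not_monogon : ¬ (Nonempty (X ≃ₜ Metric.closedBall (0 : EuclideanSpace ℝ (Fin 2)) 1) ∧
    marked.ncard = 1 ∧ punctures.ncard = 1)

namespace MarkedSurface

variable {X : Type*} [TopologicalSpace X] [ChartedSpace (EuclideanHalfSpace 2) X]

/-- The complement `Σ ∖ P` of the punctures. -/
abbrev Complement (S : MarkedSurface X) : Type _ := {x : X // x ∉ S.punctures}

/-- `ℓ` is a simple loop around the puncture `P`: it is the boundary circle of a closed disc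
embedded in the surface, which is a neighbourhood of its centre `P` and contains no other
puncture. -/
def IsLoopAround (S : MarkedSurface X) (P : X) {z : S.Complement} (l : Path z z) : Prop :=
  ∃ h : ℂ → X, ContinuousOn h (Metric.closedBall 0 1) ∧ Set.InjOn h (Metric.closedBall 0 1) ∧
    h 0 = P ∧ h '' Metric.closedBall 0 1 ∈ 𝓝 P ∧
    (∀ w ∈ Metric.closedBall (0 : ℂ) 1, h w ∈ S.punctures → w = 0) ∧
    ∀ s : I, (l s : X) = h (Complex.exp (2 * Real.pi * (s : ℝ) * Complex.I))

/-- The orbifold relation: going around a puncture once in one direction is the same as going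
around it once in the other direction; that is, the square of a simple loop around a puncture is
trivial. -/
inductive OrbRel (S : MarkedSurface X) : HomRel (FundamentalGroupoid S.Complement)
  | square (P : X) (hP : P ∈ S.punctures) (z : S.Complement) (l : Path z z)
      (hl : S.IsLoopAround P l) :
      OrbRel S (X := ⟨z⟩) (Y := ⟨z⟩) (Path.Homotopic.Quotient.mk (l.trans l))
        (Path.Homotopic.Quotient.mk (Path.refl z))

/-- The orbifold fundamental groupoid on all points which are not punctures: the quotient
of the fundamental groupoid of `Σ ∖ P` by the congruence generated by the orbifold relation. -/
abbrev OrbGroupoid (S : MarkedSurface X) : Type _ := Quotient S.OrbRel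

/-- A point which is not a puncture, as an object of the orbifold fundamental groupoid. -/
def obj (S : MarkedSurface X) (x : S.Complement) : S.OrbGroupoid := ⟨⟨x⟩⟩

/-- The class of a path in the orbifold fundamental groupoid. -/
def cls (S : MarkedSurface X) {x y : S.Complement} (p : Path x y) : S.obj x ⟶ S.obj y :=
  (Quotient.functor S.OrbRel).map (X := ⟨x⟩) (Y := ⟨y⟩) (Path.Homotopic.Quotient.mk p)

theorem marked_notMem (S : MarkedSurface X) {x : X} (hx : x ∈ S.marked) : x ∉ S.punctures :=
  fun h => Set.disjoint_left.mp ((𝓡∂ 2).disjoint_interior_boundary (M := X))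
    (S.punctures_subset h) (S.marked_subset hx)

/-- A marked boundary point as an object of the orbifold fundamental groupoid. -/
def markedObj (S : MarkedSurface X) (m : S.marked) : S.OrbGroupoid :=
  S.obj ⟨m, S.marked_notMem m.2⟩

/-- The set of all morphisms of `π₁ᵒʳᵇ(Σ, M)`. -/
def MarkedArrow (S : MarkedSurface X) : Type _ :=
  Σ m n : S.marked, (S.markedObj m ⟶ S.markedObj n)

/-- The identity of a marked point, as a morphism of `π₁ᵒʳᵇ(Σ, M)`. -/
def MarkedArrow.id (S : MarkedSurface X) (m : S.marked) : S.MarkedArrow :=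
  ⟨m, m, 𝟙 (S.markedObj m)⟩

/-- The inverse of a morphism of `π₁ᵒʳᵇ(Σ, M)`. -/
def MarkedArrow.inverse {S : MarkedSurface X} (γ : S.MarkedArrow) : S.MarkedArrow :=
  ⟨γ.2.1, γ.1, Groupoid.inv γ.2.2⟩

/-- `{γ ∈ π₁ᵒʳᵇ(Σ, M)* | γ = γ⁻¹}`: the morphisms which are not identities and equal
their inverse. -/
def Involutions (S : MarkedSurface X) : Set S.MarkedArrow :=
  {γ | (∀ m, γ ≠ MarkedArrow.id S m) ∧ γ = γ.inverse}

end MarkedSurface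

/-! Ideal triangulations -/

/-- The closed triangle. Its vertices are `stdSimplex.vertex i`, and side `i` is the one
opposite to vertex `i`. -/
abbrev Tri : Type := stdSimplex ℝ (Fin 3)

/-- The open triangle. -/
def Tri.inner : Set Tri := {p | ∀ i, 0 < p i}

/-- The `i`-th side of the triangle, without its endpoints. -/
def Tri.side (i : Fin 3) : Set Tri := {p | p i = 0 ∧ ∀ j, j ≠ i → 0 < p j}

/-- The straight segment from `p` to `q` in the triangle. -/
def Tri.segment (p q : Tri) : Path p q where
  toFun s := ⟨(1 - (s : ℝ)) • p.1 + (s : ℝ) • q.1,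
    convex_stdSimplex ℝ (Fin 3) p.2 q.2 (by linarith [s.2.2]) s.2.1 (by ring)⟩
  continuous_toFun := by fun_prop
  source' := by ext i; simp
  target' := by ext i; simp

/-- An ideal triangulation of `(Σ, M, P)`: a decomposition of the surface into finitely
many closed triangles, given by their characteristic maps, with vertex set `M ∪ P`. The open
triangles and the open sides are embedded; distinct open triangles are disjoint, and they are
disjoint from the sides; two open sides are disjoint or equal; every open side is either a
boundary segment, which is a side once, or an arc inside the surface, which is a side exactly
twice. Two sides of the same triangle may be the same arc. -/
structure IdealTriangulation {X : Type*} [TopologicalSpace X]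
    [ChartedSpace (EuclideanHalfSpace 2) X] (S : MarkedSurface X) where
  num : ℕ
  chart : Fin num → C(Tri, X)
  cover : ∀ x : X, ∃ t p, chart t p = x
  vertex_mem : ∀ t i, chart t (stdSimplex.vertex i) ∈ S.marked ∪ S.punctures
  eq_vertex : ∀ t p, chart t p ∈ S.marked ∪ S.punctures → ∃ i, p = stdSimplex.vertex i
  inner_inj : ∀ t s p q, p ∈ Tri.inner → chart t p = chart s q → t = s ∧ p = q
  side_inj : ∀ t i, Set.InjOn (chart t) (Tri.side i)
  side_match : ∀ t s i j p q, p ∈ Tri.side i → q ∈ Tri.side j → chart t p = chart s q →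
    chart t '' Tri.side i = chart s '' Tri.side j
  side_count : ∀ t i,
    (chart t '' Tri.side i ⊆ (𝓡∂ 2).boundary X ∧
      ∀ s j, chart s '' Tri.side j = chart t '' Tri.side i → s = t ∧ j = i) ∨
    (chart t '' Tri.side i ⊆ (𝓡∂ 2).interior X ∧
      ∃! a : Fin num × Fin 3, a ≠ (t, i) ∧ chart a.1 '' Tri.side a.2 = chart t '' Tri.side i)

namespace IdealTriangulation

variable {X : Type*} [TopologicalSpace X] [ChartedSpace (EuclideanHalfSpace 2) X]
  {S : MarkedSurface X}

/-- A triangle is self-folded if two of its sides are the same arc. -/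
def IsSelfFolded (τ : IdealTriangulation S) (t : Fin τ.num) : Prop :=
  ∃ i j, i ≠ j ∧ τ.chart t '' Tri.side i = τ.chart t '' Tri.side j

/-- The triangle `t` is self-folded around `P`: its sides `i ≠ j` are the same arc, which joins
`P` (the common vertex of the sides `i` and `j`) to a different point. -/
def IsSelfFoldedAround (τ : IdealTriangulation S) (t : Fin τ.num) (i j : Fin 3) (P : X) : Prop :=
  i ≠ j ∧ τ.chart t '' Tri.side i = τ.chart t '' Tri.side j ∧
    (∀ k, k ≠ i → k ≠ j → τ.chart t (stdSimplex.vertex k) = P) ∧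
    τ.chart t (stdSimplex.vertex i) ≠ P

/-- Two triangles share a side. -/
def ShareSide (τ : IdealTriangulation S) (t s : Fin τ.num) : Prop :=
  ∃ i j, τ.chart t '' Tri.side i = τ.chart s '' Tri.side j

/-- Every puncture lies in a self-folded triangle around it, and no triangle shares a side with
two self-folded triangles. -/
structure IsSkewedGentle (τ : IdealTriangulation S) : Prop where
  around : ∀ P ∈ S.punctures, ∃ t i j, τ.IsSelfFoldedAround t i j P
  no_two : ∀ t s s', t ≠ s → t ≠ s' → s ≠ s' → τ.IsSelfFolded s → τ.IsSelfFolded s' →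
    τ.ShareSide t s → ¬ τ.ShareSide t s'

theorem notMem_of_ne_vertex (τ : IdealTriangulation S) {t : Fin τ.num} {p : Tri}
    (h : ∀ i, p ≠ stdSimplex.vertex i) : τ.chart t p ∉ S.punctures := fun hp =>
  let ⟨i, hi⟩ := τ.eq_vertex t p (Or.inr hp)
  h i hi

theorem inner_ne_vertex {p : Tri} (hp : p ∈ Tri.inner) (i : Fin 3) :
    p ≠ stdSimplex.vertex i := by
  rintro rfl
  have h := hp (i + 1)
  fin_cases i <;> simp at h

theorem side_ne_vertex {j : Fin 3} {p : Tri} (hp : p ∈ Tri.side j) (i : Fin 3) :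
    p ≠ stdSimplex.vertex i := by
  rintro rfl
  obtain ⟨h0, h1⟩ := hp
  have h2 := h1 (j + 1)
  have h3 := h1 (j + 2)
  fin_cases i <;> fin_cases j <;> simp at h0 h2 h3

theorem segment_ne_vertex {p q : Tri} (hp : p ∈ Tri.inner) (hq : ∀ i, q ≠ stdSimplex.vertex i)
    (s : I) (i : Fin 3) : Tri.segment p q s ≠ stdSimplex.vertex i := by
  rcases eq_or_ne s 1 with rfl | hs
  · rw [Path.target]; exact hq i
  · refine inner_ne_vertex (fun k => ?_) i
    have h1 : (s : ℝ) < 1 := lt_of_le_of_ne s.2.2 (fun h => hs (Subtype.ext h))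
    have h2 : 0 < (1 - (s : ℝ)) * p k := mul_pos (by linarith) (hp k)
    have h3 : 0 ≤ (s : ℝ) * q k := mul_nonneg s.2.1 (q.2.1 k)
    change 0 < (1 - (s : ℝ)) * p k + (s : ℝ) * q k
    linarith

/-- The image in `Σ ∖ P` of a straight segment in a triangle, from an interior point to a point
which is not a vertex. -/
def segmentPath (τ : IdealTriangulation S) (t : Fin τ.num) (p q : Tri) (hp : p ∈ Tri.inner)
    (hq : ∀ i, q ≠ stdSimplex.vertex i) :
    Path (⟨τ.chart t p, τ.notMem_of_ne_vertex (inner_ne_vertex hp)⟩ : S.Complement)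
      ⟨τ.chart t q, τ.notMem_of_ne_vertex hq⟩ where
  toFun s := ⟨τ.chart t (Tri.segment p q s),
    τ.notMem_of_ne_vertex (segment_ne_vertex hp hq s)⟩
  continuous_toFun := by fun_prop
  source' := by simp
  target' := by simp

/-- For every puncture `P`: the self-folded triangle `T_P` around it with its two folded sides
`fst P` and `snd P`, a point `P'` in the interior of `T_P`, and the two points `inn P` and `out P`
on the folded sides that represent one and the same point of the folded arc. -/
structure NearbyPoints (τ : IdealTriangulation S) where
  tri : S.punctures → Fin τ.num
  fst : S.punctures → Fin 3
  snd : S.punctures → Fin 3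
  folded : ∀ P, τ.IsSelfFoldedAround (tri P) (fst P) (snd P) P
  pt : S.punctures → Tri
  pt_mem : ∀ P, pt P ∈ Tri.inner
  inn : S.punctures → Tri
  out : S.punctures → Tri
  inn_mem : ∀ P, inn P ∈ Tri.side (fst P)
  out_mem : ∀ P, out P ∈ Tri.side (snd P)
  inn_eq_out : ∀ P, τ.chart (tri P) (inn P) = τ.chart (tri P) (out P)

namespace NearbyPoints

variable {τ : IdealTriangulation S}

/-- The point `P'` near the puncture `P`. -/
def point (N : NearbyPoints τ) (P : S.punctures) : S.Complement :=
  ⟨τ.chart (N.tri P) (N.pt P), τ.notMem_of_ne_vertex (inner_ne_vertex (N.pt_mem P))⟩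

/-- The loop at `P'` around `P` inside `T_P` which crosses the folded arc once: it runs straight
from `P'` to the folded arc, crosses it, and returns straight to `P'` from the other side. -/
def loop (N : NearbyPoints τ) (P : S.punctures) : Path (N.point P) (N.point P) :=
  (τ.segmentPath (N.tri P) (N.pt P) (N.inn P) (N.pt_mem P) (side_ne_vertex (N.inn_mem P))).trans
    ((τ.segmentPath (N.tri P) (N.pt P) (N.out P) (N.pt_mem P)
      (side_ne_vertex (N.out_mem P))).symm.cast (Subtype.ext (N.inn_eq_out P)) rfl)

/-- The morphism `e_P : P' ⟶ P'` of the orbifold fundamental groupoid. -/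
def e (N : NearbyPoints τ) (P : S.punctures) : S.obj (N.point P) ⟶ S.obj (N.point P) :=
  S.cls (N.loop P)

/-- `π₁ᵒʳᵇ(Σ, M; P')`: the morphisms with source a marked boundary point and target
one of the points `P'`. -/
def ArrowToPuncture (N : NearbyPoints τ) : Type _ :=
  Σ (m : S.marked) (P : S.punctures), (S.markedObj m ⟶ S.obj (N.point P))

/-- For `v : m ⟶ P'`, the morphism `e_P v : m ⟶ P'`, i.e. first `v` and then `e_P`. -/
def turn (N : NearbyPoints τ) (v : N.ArrowToPuncture) : N.ArrowToPuncture :=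
  ⟨v.1, v.2.1, v.2.2 ≫ N.e v.2.1⟩

/-- For `v : m ⟶ P'`, the morphism `v⁻¹ e_P v : m ⟶ m`, i.e. first `v`, then `e_P`, then back
along `v`. -/
def lasso (N : NearbyPoints τ) (v : N.ArrowToPuncture) : S.MarkedArrow :=
  ⟨v.1, v.1, v.2.2 ≫ N.e v.2.1 ≫ Groupoid.inv v.2.2⟩

end NearbyPoints

end IdealTriangulation

end

/-! Away from the vertices, the arcs of `τ` cut the surface into contractible triangles, so a path
is recorded up to homotopy by the word of the arcs it crosses. Marked points lie on the boundary and
contribute nothing. At a puncture $P$ the only corner is that of the self-folded triangle $T_P$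
(`corner_unique`), so a small loop around $P$ meets only the folded arc, and the orbifold relation
says that crossing this arc has order two. Morphisms are therefore governed by reduced words over an
alphabet with an involution `flip`: an ordinary crossing is exchanged with the opposite crossing,
and a folded crossing is its own inverse.

A morphism equal to its inverse has a reduced word equal to its own formal inverse. If non-empty,
such a word is $u^{-1}cu$ with a middle letter $c$ fixed by `flip` (`exists_middle_of_eq_wordInv`),
and a fixed letter which is really crossed belongs to a puncture. Hence every non-trivial involution
is $v^{-1}e_Pv$, where $v$ follows $u$. Conversely $c$ and $u$ can be read off from the reduced word
(`conj_inj`), so $P$ is unique, and $v$ is unique up to replacing it by $e_Pv$. The fibres of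
$v\mapsto v^{-1}e_Pv$ are thus free orbits of an action of order two, and choosing a point in each
gives the bijection (`exists_equiv_prod_zmod_two`).

The work lies in the normal forms. They are unique by van der Waerden's trick: letters act by
permutations on the set of reduced words (`push`), and a reduced word is recovered from its action
on the empty word. The action becomes a functor by parallel transport from local frames
(`exists_transport`). It extends over the marked points (`exists_transport_complement`) and sends
the square of a loop around a puncture to the identity (`map_loop_mul_self`), so it descends to the
orbifold groupoid. It is faithful there: every morphism between barycentres is realised by its word
(`IsTransport.good`, `IsTransport.rep`), and a word represents at most one morphism from a given
triangle (`Rep.unique`). The relation $e_P^2=1$ needs an embedded disc around $P$, which comes from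
polar coordinates in the corner of $T_P$ (`isLoopAround`). -/

noncomputable section

/-! Reduced words over an alphabet with an involution -/

/-- The formal inverse of a word over an alphabet with involution `ι`. -/
def wordInv {L : Type*} (ι : L → L) (w : List L) : List L := (w.map ι).reverse

/-- A word is reduced when no letter is followed by its formal inverse. -/
def IsReducedWord {L : Type*} (ι : L → L) (w : List L) : Prop := w.IsChain fun a b => b ≠ ι a

/-- The reduced words over an alphabet with involution `ι`. -/
abbrev ReducedWord {L : Type*} (ι : L → L) : Type _ := {w : List L // IsReducedWord ι w}

namespace ReducedWord

variable {L : Type*} {ι : L → L}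

theorem isReducedWord_wordInv (hι : Function.Involutive ι) {w : List L}
    (hw : IsReducedWord ι w) : IsReducedWord ι (wordInv ι w) := by
  unfold IsReducedWord wordInv at *
  rw [List.isChain_reverse, List.isChain_map]
  refine hw.imp fun a b h h' => h ?_
  rw [h', hι]

/-- The empty word. -/
def nil : ReducedWord ι := ⟨[], List.isChain_nil⟩

open Classical in
/-- Multiplication of a reduced word by a letter on the left, followed by reduction. -/
def pushFun (a : L) : ReducedWord ι → ReducedWord ι
  | ⟨[], _⟩ => ⟨[a], List.isChain_singleton a⟩
  | ⟨b :: w, h⟩ => if hb : b = ι a then ⟨w, h.tail⟩ else ⟨a :: b :: w, List.isChain_cons_cons.2 ⟨hb, h⟩⟩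

theorem pushFun_cons_self {a b : L} {w : List L} (hb : b = ι a) (h : IsReducedWord ι (b :: w)) :
    pushFun a ⟨b :: w, h⟩ = ⟨w, h.tail⟩ := by
  simp [pushFun, hb]

theorem pushFun_of_isReduced {a : L} {w : List L} (h : IsReducedWord ι (a :: w)) :
    pushFun a ⟨w, h.tail⟩ = ⟨a :: w, h⟩ := by
  cases w with
  | nil => rfl
  | cons b w => simp [pushFun, (List.isChain_cons_cons.1 h).1]

/-- Only the head of the word matters. If `a` cancels the head, reducedness of the original word
prevents `ι a` from cancelling again; otherwise `a` is the new head and `ι a` removes it. -/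
theorem pushFun_pushFun (hι : Function.Involutive ι) (a : L) (w : ReducedWord ι) :
    pushFun (ι a) (pushFun a w) = w := by
  obtain ⟨_ | ⟨b, w⟩, h⟩ := w
  · exact pushFun_cons_self (hι a).symm _
  · by_cases hb : b = ι a
    · rw [pushFun_cons_self hb]
      subst hb
      exact pushFun_of_isReduced h
    · have h' : IsReducedWord ι (a :: b :: w) := List.isChain_cons_cons.2 ⟨hb, h⟩
      rw [show pushFun a ⟨b :: w, h⟩ = ⟨a :: b :: w, h'⟩ from pushFun_of_isReduced h']
      exact pushFun_cons_self (hι a).symm _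

/-- Multiplication by a letter as a permutation of the reduced words. -/
def push (hι : Function.Involutive ι) (a : L) : Equiv.Perm (ReducedWord ι) where
  toFun := pushFun a
  invFun := pushFun (ι a)
  left_inv := pushFun_pushFun hι a
  right_inv w := by simpa [hι a] using pushFun_pushFun hι (ι a) w

section Perm

variable (hι : Function.Involutive ι)

theorem push_inv (a : L) : (push hι a)⁻¹ = push hι (ι a) := by
  ext1 w; rfl

theorem push_cons_self {a b : L} {w : List L} (hb : b = ι a) (h : IsReducedWord ι (b :: w)) :
    push hι a ⟨b :: w, h⟩ = ⟨w, h.tail⟩ := pushFun_cons_self hb h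

theorem push_of_isReduced {a : L} {w : List L} (h : IsReducedWord ι (a :: w)) :
    push hι a ⟨w, h.tail⟩ = ⟨a :: w, h⟩ := pushFun_of_isReduced h

theorem push_ne_one (a : L) : push hι a ≠ 1 := fun h => by
  have h1 : [a] = [] := congrArg (fun f => (f nil).1) h
  simp at h1

theorem push_mul_self {a : L} (ha : ι a = a) : push hι a * push hι a = 1 := by
  have h := push_inv hι a
  rw [ha] at h
  rw [mul_eq_one_iff_eq_inv, h]

/-- The permutation of the reduced words given by a word. -/
def wordPerm (w : List L) : Equiv.Perm (ReducedWord ι) := (w.map (push hι)).prod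

@[simp] theorem wordPerm_nil : wordPerm hι [] = 1 := rfl

@[simp] theorem wordPerm_cons (a : L) (w : List L) :
    wordPerm hι (a :: w) = push hι a * wordPerm hι w := by simp [wordPerm]

@[simp] theorem wordPerm_append (v w : List L) :
    wordPerm hι (v ++ w) = wordPerm hι v * wordPerm hι w := by simp [wordPerm]

theorem wordPerm_wordInv (w : List L) : wordPerm hι (wordInv ι w) = (wordPerm hι w)⁻¹ := by
  induction w with
  | nil => simp [wordInv]
  | cons a w ih =>
    have h : wordInv ι (a :: w) = wordInv ι w ++ [ι a] := by simp [wordInv]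
    rw [h, wordPerm_append, ih, wordPerm_cons, wordPerm_cons, mul_inv_rev, push_inv]
    simp

/-- Van der Waerden's trick: letters of a reduced word, applied in turn to the empty word, never
cancel. Distinct reduced words therefore act differently, without any confluence argument. -/
theorem wordPerm_apply_nil {w : List L} (h : IsReducedWord ι w) : wordPerm hι w nil = ⟨w, h⟩ := by
  induction w with
  | nil => rfl
  | cons a w ih =>
    rw [wordPerm_cons, Equiv.Perm.mul_apply, ih h.tail, push_of_isReduced hι h]

end Perm

/-- Strip the first and last letters together: reducedness and equality with the formal inverse both
survive. Even length is impossible because the two middle letters would be mutually inverse, so a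
single letter remains, and it is its own inverse. -/
theorem exists_middle_of_eq_wordInv (w : List L) (h : IsReducedWord ι w) (hne : w ≠ [])
    (hw : w = wordInv ι w) : ∃ u c, w = wordInv ι u ++ c :: u ∧ ι c = c := by
  induction w using List.bidirectionalRec with
  | nil => exact absurd rfl hne
  | singleton a =>
    refine ⟨[], a, rfl, ?_⟩
    simpa [wordInv] using hw.symm
  | cons_append a l b ih =>
    have h1 : a :: (l ++ [b]) = ι b :: (wordInv ι l ++ [ι a]) := by
      simpa [wordInv] using hw
    obtain ⟨h2, h3⟩ := List.cons_eq_cons.1 h1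
    obtain ⟨h4, h5⟩ := List.append_inj' h3 rfl
    have h6 : b = ι a := by simpa using h5
    have hl : IsReducedWord ι l := List.IsChain.left_of_append (l₂ := [b]) h.tail
    -- A word `[a, b]` with `b = ι a` is not reduced, which excludes an empty middle.
    have hne' : l ≠ [] := by
      rintro rfl
      exact (List.isChain_cons_cons.1 h).1 h6
    obtain ⟨u, c, hu, hc⟩ := ih hl hne' h4
    refine ⟨u ++ [b], c, ?_, hc⟩
    rw [hu]
    simp [wordInv, ← h2]

/-- As `c` is fixed, the left half ending in `c` is the formal inverse of the right half beginning
with `c`. Two reduced words which overlap in one letter can be glued along it. -/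
theorem isReducedWord_conj (hι : Function.Involutive ι) {c : L} (hc : ι c = c) {u : List L}
    (h : IsReducedWord ι (c :: u)) : IsReducedWord ι (wordInv ι u ++ c :: u) := by
  have h1 := isReducedWord_wordInv hι h
  have h2 : wordInv ι (c :: u) = wordInv ι u ++ [c] := by simp [wordInv, hc]
  rw [h2] at h1
  exact List.isChain_split.2 ⟨h1, h⟩

/-- The total length is `2 * u.length + 1`, so it fixes the position of the middle letter. -/
theorem conj_inj {u u' : List L} {c c' : L}
    (h : wordInv ι u ++ c :: u = wordInv ι u' ++ c' :: u') : c = c' ∧ u = u' := by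
  have hl := congrArg List.length h
  simp [wordInv] at hl
  have h1 := List.append_inj' h (by simp; omega)
  simpa using h1.2

end ReducedWord

end


noncomputable section

/-! Parallel transport from local frames, and local-to-global principles for paths -/

section Transport

variable {B R J : Type*} [TopologicalSpace B]

/-- The fibre bundle with discrete fibre `R` determined by local frames. -/
def frameBundleCore [TopologicalSpace R] [DiscreteTopology R] (U : J → Set B)
    (hU : ∀ i, IsOpen (U i)) (hcov : ∀ x, ∃ i, x ∈ U i) (θ : J → B → Equiv.Perm R)
    (hθ : ∀ i j x, x ∈ U i → x ∈ U j →
      ∀ᶠ y in 𝓝 x, (θ j y)⁻¹ * θ i y = (θ j x)⁻¹ * θ i x) : FiberBundleCore J B R where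
  baseSet := U
  isOpen_baseSet := hU
  indexAt x := (hcov x).choose
  mem_baseSet_at x := (hcov x).choose_spec
  coordChange i j x := ⇑((θ j x)⁻¹ * θ i x)
  coordChange_self i x _ v := by simp
  continuousOn_coordChange i j := by
    -- Near `x` the transition permutation is constant, and a single permutation of a discrete fibre
    -- is continuous.
    rintro ⟨x, v⟩ ⟨⟨hi, hj⟩, -⟩
    refine ContinuousAt.continuousWithinAt ?_
    have h1 : ∀ᶠ q : B × R in 𝓝 (x, v), q.1 ∈ {y | (θ j y)⁻¹ * θ i y = (θ j x)⁻¹ * θ i x} :=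
      continuousAt_fst.eventually (hθ i j x hi hj)
    have h2 : ContinuousAt (fun q : B × R => ((θ j x)⁻¹ * θ i x) q.2) (x, v) :=
      (continuous_of_discreteTopology.comp continuous_snd).continuousAt
    refine h2.congr (h1.mono fun q hq => ?_)
    simp only [Set.mem_ofPred_eq] at hq
    simp [hq]
  coordChange_comp i j k x _ v := by simp

/-- Local frames, which differ by locally constant permutations, define a parallel transport
along homotopy classes of paths. -/
theorem exists_transport (U : J → Set B)
    (hU : ∀ i, IsOpen (U i)) (hcov : ∀ x, ∃ i, x ∈ U i) (θ : J → B → Equiv.Perm R)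
    (hθ : ∀ i j x, x ∈ U i → x ∈ U j →
      ∀ᶠ y in 𝓝 x, (θ j y)⁻¹ * θ i y = (θ j x)⁻¹ * θ i x) :
    ∃ F : FundamentalGroupoid B ⥤ SingleObj (Equiv.Perm R),
      ∀ (i : J) (x y : B) (p : Path x y), (∀ s, p s ∈ U i) →
        F.map (X := ⟨x⟩) (Y := ⟨y⟩) (Path.Homotopic.Quotient.mk p) = θ i y * (θ i x)⁻¹ := by
  let : TopologicalSpace R := ⊥
  have : DiscreteTopology R := ⟨rfl⟩
  let Z := frameBundleCore U hU hcov θ hθ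
  have cov : IsCoveringMap (Bundle.TotalSpace.proj : Z.TotalSpace → B) :=
    FiberBundle.isCoveringMap (F := R) (E := Z.Fiber)
  -- Pointwise, the transition cocycle is the coboundary of `θ`. Reading the fibre through `θ`
  -- removes the dependence on the arbitrary index `indexAt x`; the identification need not be
  -- continuous in `x`.
  let φ : ∀ x : B, (Bundle.TotalSpace.proj : Z.TotalSpace → B) ⁻¹' {x} ≃ R := fun x =>
    { toFun := fun e => θ (Z.indexAt e.1.1) e.1.1 e.1.2
      invFun := fun r => ⟨⟨x, (θ (Z.indexAt x) x)⁻¹ r⟩, rfl⟩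
      left_inv := by
        rintro ⟨⟨x', v⟩, rfl⟩
        refine Subtype.ext ?_
        exact congrArg (fun v : R => (⟨x', v⟩ : Z.TotalSpace))
          ((θ (Z.indexAt x') x').symm_apply_apply v)
      right_inv := fun r => by simp }
  let f : ∀ {x y : B}, Path.Homotopic.Quotient x y → Equiv.Perm R := fun {x y} γ =>
    ((φ x).symm.trans (Equiv.ofBijective (cov.monodromy γ) (cov.monodromy_bijective γ))).trans
      (φ y)
  refine ⟨{ obj := fun _ => SingleObj.star _, map := fun {x y} γ => f γ, map_id := ?_,
            map_comp := ?_ }, ?_⟩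
  · intro x
    refine Equiv.ext fun r => ?_
    change φ x.as (cov.monodromy (Path.Homotopic.Quotient.refl x.as) ((φ x.as).symm r)) = r
    rw [cov.monodromy_refl]; simp
  · intro x y z γ γ'
    refine Equiv.ext fun r => ?_
    change φ z.as (cov.monodromy (Path.Homotopic.Quotient.trans γ γ') ((φ x.as).symm r)) =
      φ z.as (cov.monodromy γ' ((φ y.as).symm (φ y.as (cov.monodromy γ ((φ x.as).symm r)))))
    rw [cov.monodromy_trans_apply]; simp
  · intro i x y p hp
    refine Equiv.ext fun r => ?_
    change φ y (cov.monodromy (Path.Homotopic.Quotient.mk p) ((φ x).symm r)) = _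
    rw [← Equiv.eq_symm_apply]
    set c : R := (θ i x)⁻¹ r with hc
    -- The constant section in the trivialisation over `U i` is a lift of `p`, and by uniqueness of
    -- lifts it computes the monodromy.
    let Γ : C(I, Z.TotalSpace) :=
      { toFun := fun s => (Z.localTriv i).toOpenPartialHomeomorph.symm (p s, c)
        continuous_toFun := by
          refine (Z.localTriv i).toOpenPartialHomeomorph.continuousOn_symm.comp_continuous
            (f := fun s => (p s, c)) (by fun_prop) fun s => ?_
          exact (Z.mem_localTriv_target i _).2 (hp s) }
    have hΓ : ∀ s, Γ s = ⟨p s, Z.coordChange i (Z.indexAt (p s)) (p s) c⟩ := fun s =>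
      Z.localTriv_symm_apply i (p s, c)
    have h0 : Γ 0 = ((φ x).symm r).1 := by
      rw [hΓ 0]
      have : ∀ x', x' = x → (⟨x', Z.coordChange i (Z.indexAt x') x' c⟩ : Z.TotalSpace) =
          ((φ x).symm r).1 := by
        rintro x' rfl
        exact congrArg (fun v : R => (⟨x', v⟩ : Z.TotalSpace))
          (by simp [Z, frameBundleCore, hc])
      exact this _ p.source
    have h1 : Γ 1 = ((φ y).symm ((θ i y * (θ i x)⁻¹) r)).1 := by
      rw [hΓ 1]
      have : ∀ x', x' = y → (⟨x', Z.coordChange i (Z.indexAt x') x' c⟩ : Z.TotalSpace) =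
          ((φ y).symm ((θ i y * (θ i x)⁻¹) r)).1 := by
        rintro x' rfl
        exact congrArg (fun v : R => (⟨x', v⟩ : Z.TotalSpace))
          (by simp [Z, frameBundleCore, hc])
      exact this _ p.target
    have hpΓ : Bundle.TotalSpace.proj ∘ Γ = p := by
      ext s; simp [hΓ]
    refine Subtype.ext ?_
    rw [← h1]
    have := (cov.eq_liftPath_iff' (γ := (p : C(I, B))) (e := ((φ x).symm r).1)
      (γ_0 := by exact p.source) (Γ := Γ)).2 ⟨hpΓ, h0⟩
    rw [this]
    rfl

end Transport

section Paths

variable {B : Type*} [TopologicalSpace B]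

/-- A property of homotopy classes of paths, which is stable under composition and holds locally
along a path, holds for the path. -/
theorem path_induction (Q : ∀ x y : B, Path.Homotopic.Quotient x y → Prop)
    (hQ : ∀ x y z (p : Path.Homotopic.Quotient x y) (q : Path.Homotopic.Quotient y z),
      Q x y p → Q y z q → Q x z (p.trans q))
    {J : Type*} (U : J → Set B) (hU : ∀ i, IsOpen (U i))
    (hQU : ∀ i x y (p : Path x y), (∀ s, p s ∈ U i) → Q x y (Path.Homotopic.Quotient.mk p))
    {x y : B} (p : Path x y) (hp : ∀ s, ∃ i, p s ∈ U i) :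
    Q x y (Path.Homotopic.Quotient.mk p) := by
  obtain ⟨t, h0, hmono, ⟨n, hn⟩, hsub⟩ := exists_monotone_Icc_subset_open_cover_unitInterval
    (c := fun i => p ⁻¹' U i) (fun i => (hU i).preimage p.continuous)
    (fun s _ => Set.mem_iUnion.2 (hp s))
  have key : ∀ m, Q _ _ (Path.Homotopic.Quotient.mk (p.subpath (t 0) (t (m + 1)))) := by
    have step : ∀ m, Q _ _ (Path.Homotopic.Quotient.mk (p.subpath (t m) (t (m + 1)))) := fun m => by
      obtain ⟨i, hi⟩ := hsub m
      refine hQU i _ _ _ fun s => ?_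
      have h1 : p.subpath (t m) (t (m + 1)) s ∈ Set.range (p.subpath (t m) (t (m + 1))) := ⟨s, rfl⟩
      rw [Path.range_subpath_of_le _ _ _ (hmono (Nat.le_succ m))] at h1
      obtain ⟨s', hs', h⟩ := h1
      rw [← h]
      exact hi hs'
    intro m
    induction m with
    | zero => exact step 0
    | succ m ih =>
      have h := hQ _ _ _ _ _ ih (step (m + 1))
      rw [← Path.Homotopic.Quotient.mk_trans, Path.Homotopic.Quotient.eq.2
        ⟨Path.Homotopy.subpathTransSubpath p (t 0) (t (m + 1)) (t (m + 1 + 1))⟩] at h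
      exact h
  -- The partition has reached `1` by index `n`, so the subpath up to `t (n + 1)` is all of `p`, up
  -- to a cast of its end points.
  have h := key n
  rw [hn (n + 1) (Nat.le_succ n), h0, Path.subpath_zero_one] at h
  have : ∀ x' y' (hx : x' = x) (hy : y' = y),
      Q x' y' (Path.Homotopic.Quotient.mk (p.cast hx hy)) → Q x y (Path.Homotopic.Quotient.mk p) := by
    rintro _ _ rfl rfl h
    exact h
  exact this _ _ _ _ h

instance : ContractibleSpace I := by
  have h : ContractibleSpace (Set.Icc (0 : ℝ) 1) :=
    ((convex_Icc (0 : ℝ) 1).starConvex (x := 0) (by simp)).contractibleSpace ⟨0, by simp⟩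
  exact h

instance : SimplyConnectedSpace (I × I) := inferInstance

/-- The two ways around the boundary of a continuous square are homotopic. -/
theorem square_homotopic (K : C(I × I, B)) {a b c d : B} (top : Path a b) (right : Path b d)
    (left : Path a c) (bottom : Path c d) (h1 : ∀ s, K (0, s) = top s) (h2 : ∀ r, K (r, 1) = right r)
    (h3 : ∀ r, K (r, 0) = left r) (h4 : ∀ s, K (1, s) = bottom s) :
    (Path.Homotopic.Quotient.mk top).trans (Path.Homotopic.Quotient.mk right) =
      (Path.Homotopic.Quotient.mk left).trans (Path.Homotopic.Quotient.mk bottom) := by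
  let t : Path ((0, 0) : I × I) (0, 1) := ⟨⟨fun s => (0, s), by fun_prop⟩, rfl, rfl⟩
  let r : Path ((0, 1) : I × I) (1, 1) := ⟨⟨fun s => (s, 1), by fun_prop⟩, rfl, rfl⟩
  let l : Path ((0, 0) : I × I) (1, 0) := ⟨⟨fun s => (s, 0), by fun_prop⟩, rfl, rfl⟩
  let b' : Path ((1, 0) : I × I) (1, 1) := ⟨⟨fun s => (1, s), by fun_prop⟩, rfl, rfl⟩
  have e1 : K (0, 0) = a := by rw [h1]; simp
  have e2 : K (1, 1) = d := by rw [h4]; simp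
  have h := (SimplyConnectedSpace.paths_homotopic (t.trans r) (l.trans b')).map K
  have hc := h.pathCast e1.symm e2.symm
  rw [← Path.Homotopic.Quotient.mk_trans, ← Path.Homotopic.Quotient.mk_trans,
    Path.Homotopic.Quotient.eq]
  convert hc using 1
  · ext s
    simp only [Path.trans_apply, Path.cast_coe, Path.map_coe, Function.comp]
    split_ifs
    · exact (h1 _).symm
    · exact (h2 _).symm
  · ext s
    simp only [Path.trans_apply, Path.cast_coe, Path.map_coe, Function.comp]
    split_ifs
    · exact (h3 _).symm
    · exact (h4 _).symm

/-- Paths inside a simply connected subset are homotopic. -/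
theorem homotopic_of_isSimplyConnected {W : Set B} (hW : IsSimplyConnected W) {x y : B}
    (p q : Path x y) (hp : ∀ s, p s ∈ W) (hq : ∀ s, q s ∈ W) : p.Homotopic q := by
  have := hW.simplyConnectedSpace
  have hx : x ∈ W := by simpa using hp 0
  have hy : y ∈ W := by simpa using hp 1
  let p' : Path (⟨x, hx⟩ : W) ⟨y, hy⟩ := ⟨⟨fun s => ⟨p s, hp s⟩, by fun_prop⟩, by simp, by simp⟩
  let q' : Path (⟨x, hx⟩ : W) ⟨y, hy⟩ := ⟨⟨fun s => ⟨q s, hq s⟩, by fun_prop⟩, by simp, by simp⟩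
  exact (SimplyConnectedSpace.paths_homotopic p' q').map ⟨Subtype.val, continuous_subtype_val⟩

end Paths

end


noncomputable section

/-! Points of the closed triangle -/

namespace Tri

theorem exists_third (i j : Fin 3) : ∃ k : Fin 3, i ≠ k ∧ j ≠ k := by revert i j; decide

theorem exists_others (i : Fin 3) : ∃ j k : Fin 3, i ≠ j ∧ i ≠ k ∧ j ≠ k := by revert i; decide

theorem eq_or_of_ne {i j k : Fin 3} (hij : i ≠ j) (hik : i ≠ k) (hjk : j ≠ k) (l : Fin 3) :
    l = i ∨ l = j ∨ l = k := by revert i j k l; decide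

theorem nonneg (p : Tri) (i : Fin 3) : 0 ≤ p i := p.2.1 i

theorem sum_eq_one (p : Tri) : p 0 + p 1 + p 2 = 1 := by
  have h := p.2.2
  rwa [Fin.sum_univ_three] at h

theorem add_add_eq_one (p : Tri) {i j k : Fin 3} (hij : i ≠ j) (hik : i ≠ k) (hjk : j ≠ k) :
    p i + p j + p k = 1 := by
  have h := sum_eq_one p
  fin_cases i <;> fin_cases j <;> fin_cases k <;> simp at * <;> linarith

theorem ext_of_ne {p q : Tri} {i j : Fin 3} (hij : i ≠ j) (hi : p i = q i) (hj : p j = q j) :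
    p = q := by
  obtain ⟨k, hik, hjk⟩ := exists_third i j
  have h1 := add_add_eq_one p hij hik hjk
  have h2 := add_add_eq_one q hij hik hjk
  have hk : p k = q k := by linarith
  ext l
  rcases eq_or_of_ne hij hik hjk l with rfl | rfl | rfl <;> assumption

theorem vertex_self (i : Fin 3) : (stdSimplex.vertex i : Tri) i = 1 := by simp

theorem vertex_of_ne {i j : Fin 3} (h : j ≠ i) : (stdSimplex.vertex i : Tri) j = 0 := by simp [h]

theorem eq_vertex_iff {p : Tri} {i : Fin 3} : p = stdSimplex.vertex i ↔ p i = 1 := by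
  constructor
  · rintro rfl; exact vertex_self i
  · intro h
    obtain ⟨j, k, hij, hik, hjk⟩ := exists_others i
    have h1 := add_add_eq_one p hij hik hjk
    have h2 := nonneg p j
    have h3 := nonneg p k
    refine ext_of_ne hij ?_ ?_
    · rw [h, vertex_self]
    · rw [vertex_of_ne hij.symm]; linarith

theorem le_one (p : Tri) (i : Fin 3) : p i ≤ 1 := by
  obtain ⟨j, k, hij, hik, hjk⟩ := exists_others i
  have h1 := add_add_eq_one p hij hik hjk
  have h2 := nonneg p j
  have h3 := nonneg p k
  linarith

/-- The triangle without its vertices. -/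
def NotVertex (p : Tri) : Prop := ∀ i, p ≠ stdSimplex.vertex i

theorem notVertex_iff {p : Tri} : NotVertex p ↔ ∀ i, p i < 1 :=
  forall_congr' fun i => by rw [Ne, eq_vertex_iff, lt_iff_le_and_ne, and_iff_right (le_one p i)]

/-- The points of the triangle which are closer to the side `i` than to the other sides. -/
def collar (i : Fin 3) : Set Tri := {p | ∀ j, j ≠ i → p i < p j}

theorem continuous_coord (i : Fin 3) : Continuous fun p : Tri => p i :=
  (continuous_apply i).comp continuous_subtype_val

theorem isOpen_collar (i : Fin 3) : IsOpen (collar i) := by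
  have : collar i = ⋂ j, {p : Tri | j ≠ i → p i < p j} := by ext; simp [collar]
  rw [this]
  refine isOpen_iInter_of_finite fun j => ?_
  by_cases h : j = i
  · simp [h]
  · simpa [h] using isOpen_lt (continuous_coord i) (continuous_coord j)

theorem isOpen_inner : IsOpen inner := by
  have : inner = ⋂ j, {p : Tri | 0 < p j} := by ext; simp [inner]
  rw [this]
  exact isOpen_iInter_of_finite fun j => isOpen_lt continuous_const (continuous_coord j)

theorem side_subset_collar (i : Fin 3) : side i ⊆ collar i := fun p hp j hj => by
  rw [hp.1]; exact hp.2 j hj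

theorem collar_disjoint {i j : Fin 3} {p : Tri} (hi : p ∈ collar i) (hj : p ∈ collar j) :
    i = j := by
  by_contra h
  exact lt_asymm (hi j (Ne.symm h)) (hj i h)

theorem not_inner_of_side {i : Fin 3} {p : Tri} (hi : p ∈ side i) : p ∉ inner := fun h =>
  (h i).ne' hi.1

theorem inner_or_side_of_collar {i : Fin 3} {p : Tri} (hi : p ∈ collar i) :
    p ∈ inner ∨ p ∈ side i := by
  have h0 := nonneg p i
  rcases h0.eq_or_lt with h | h
  · exact Or.inr ⟨h.symm, fun j hj => by rw [h]; exact hi j hj⟩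
  · refine Or.inl fun j => ?_
    by_cases hj : j = i
    · rwa [hj]
    · exact h.trans (hi j hj)

theorem inner_or_side {p : Tri} (hp : NotVertex p) : p ∈ inner ∨ ∃ i, p ∈ side i := by
  by_cases h : p ∈ inner
  · exact Or.inl h
  · right
    simp only [inner, Set.mem_ofPred_eq, not_forall, not_lt] at h
    obtain ⟨i, hi⟩ := h
    have hi0 : p i = 0 := le_antisymm hi (nonneg p i)
    refine ⟨i, hi0, fun j hj => lt_of_le_of_ne (nonneg p j) fun h0 => ?_⟩
    obtain ⟨k, hik, hjk⟩ := exists_third i j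
    have h1 := add_add_eq_one p hj.symm hik hjk
    exact hp k (eq_vertex_iff.2 (by linarith))

theorem notVertex_of_inner {p : Tri} (hp : p ∈ inner) : NotVertex p :=
  IdealTriangulation.inner_ne_vertex hp

theorem notVertex_of_side {i : Fin 3} {p : Tri} (hp : p ∈ side i) : NotVertex p :=
  IdealTriangulation.side_ne_vertex hp

theorem notVertex_of_collar {i : Fin 3} {p : Tri} (hp : p ∈ collar i) : NotVertex p :=
  (inner_or_side_of_collar hp).elim notVertex_of_inner notVertex_of_side

@[simp] theorem segment_coord (p q : Tri) (s : I) (i : Fin 3) :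
    segment p q s i = (1 - (s : ℝ)) * p i + s * q i := rfl

theorem lerp_lt {a b c : ℝ} (ha : a < c) (hb : b < c) (s : I) :
    (1 - (s : ℝ)) * a + s * b < c := by
  have h1 := s.2.1
  have h2 := s.2.2
  rcases h1.eq_or_lt with h | h
  · rw [← h]; simpa using ha
  · nlinarith

theorem notVertex_segment {p q : Tri} (hp : NotVertex p) (hq : NotVertex q) (s : I) :
    NotVertex (segment p q s) := by
  rw [notVertex_iff] at *
  exact fun i => lerp_lt (hp i) (hq i) s

theorem inner_segment {p q : Tri} (hp : p ∈ inner) (hq : q ∈ inner) (s : I) :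
    segment p q s ∈ inner := fun i => by
  have := lerp_lt (neg_lt_zero.2 (hp i)) (neg_lt_zero.2 (hq i)) s
  rw [segment_coord]; linarith

theorem side_segment {i : Fin 3} {p q : Tri} (hp : p ∈ side i) (hq : q ∈ side i) (s : I) :
    segment p q s ∈ side i := by
  refine ⟨by simp [hp.1, hq.1], fun j hj => ?_⟩
  have := lerp_lt (neg_lt_zero.2 (hp.2 j hj)) (neg_lt_zero.2 (hq.2 j hj)) s
  rw [segment_coord]; linarith

theorem collar_segment {i : Fin 3} {p q : Tri} (hp : p ∈ collar i) (hq : q ∈ collar i) (s : I) :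
    segment p q s ∈ collar i := fun j hj => by
  have := lerp_lt (sub_neg.2 (hp j hj)) (sub_neg.2 (hq j hj)) s
  rw [segment_coord, segment_coord]; linarith

theorem continuous_segment : Continuous fun x : (Tri × Tri) × I => segment x.1.1 x.1.2 x.2 := by
  refine Continuous.subtype_mk
    (f := fun x : (Tri × Tri) × I => (1 - (x.2 : ℝ)) • x.1.1.1 + (x.2 : ℝ) • x.1.2.1) ?_ _
  fun_prop

/-- The barycentre of the triangle. -/
def bary : Tri := ⟨fun _ => 1 / 3, fun _ => by norm_num, by simp⟩

theorem bary_mem : bary ∈ inner := fun _ => by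
  change (0 : ℝ) < 1 / 3
  norm_num

/-- A point of the collar of a side, near a given point of the side, inside the triangle. -/
def pushIn (p : Tri) : Tri := segment p bary ⟨1 / 2, by norm_num, by norm_num⟩

theorem pushIn_inner (p : Tri) : pushIn p ∈ inner := fun i => by
  have := nonneg p i
  change 0 < (1 - (1 / 2 : ℝ)) * p i + 1 / 2 * (1 / 3)
  linarith

theorem pushIn_collar {i : Fin 3} {p : Tri} (hp : p ∈ side i) : pushIn p ∈ collar i :=
  fun j hj => by
    have := hp.2 j hj
    change (1 - (1 / 2 : ℝ)) * p i + 1 / 2 * (1 / 3) < (1 - (1 / 2 : ℝ)) * p j + 1 / 2 * (1 / 3)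
    rw [hp.1]; linarith

end Tri

/-! Sides, gluing and topology of an ideal triangulation -/

namespace IdealTriangulation

variable {X : Type*} [TopologicalSpace X] [ChartedSpace (EuclideanHalfSpace 2) X]
  {S : MarkedSurface X} (τ : IdealTriangulation S)

/-- The sides of the triangles. -/
abbrev Side : Type := Fin τ.num × Fin 3

/-- The open arc which is the image of a side. -/
def edge (a : τ.Side) : Set X := τ.chart a.1 '' Tri.side a.2

open Classical in
/-- The other side which represents the same arc, or the same side for a boundary segment. -/
def bar (a : τ.Side) : τ.Side := if h : ∃ b, b ≠ a ∧ τ.edge b = τ.edge a then h.choose else a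

theorem edge_bar (a : τ.Side) : τ.edge (τ.bar a) = τ.edge a := by
  unfold bar
  split_ifs with h
  · exact h.choose_spec.2
  · rfl

/-- This is the use of `side_count`: a boundary segment is a side once and an inner arc exactly
twice, so no third side carries the same arc. -/
theorem eq_or_eq_bar {a b : τ.Side} (h : τ.edge b = τ.edge a) : b = a ∨ b = τ.bar a := by
  by_cases hb : b = a
  · exact Or.inl hb
  · right
    have hex : ∃ b, b ≠ a ∧ τ.edge b = τ.edge a := ⟨b, hb, h⟩
    rw [bar, dif_pos hex]
    rcases τ.side_count a.1 a.2 with ⟨-, h1⟩ | ⟨-, c, -, h1⟩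
    · exact absurd (Prod.ext (h1 b.1 b.2 h).1 (h1 b.1 b.2 h).2) hb
    · rw [h1 b ⟨hb, h⟩, h1 _ hex.choose_spec]

theorem eq_bar_of_ne {a b : τ.Side} (h : τ.edge b = τ.edge a) (hne : b ≠ a) : b = τ.bar a :=
  (τ.eq_or_eq_bar h).resolve_left hne

theorem bar_bar (a : τ.Side) : τ.bar (τ.bar a) = a := by
  by_cases h : τ.bar a = a
  · rw [h, h]
  · exact (τ.eq_bar_of_ne (τ.edge_bar a).symm (Ne.symm h)).symm

theorem inner_eq {t s : Fin τ.num} {p q : Tri} (hp : p ∈ Tri.inner)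
    (h : τ.chart t p = τ.chart s q) : t = s ∧ p = q := τ.inner_inj t s p q hp h

theorem notVertex_of_eq {t s : Fin τ.num} {p q : Tri} (hp : p.NotVertex)
    (h : τ.chart t p = τ.chart s q) : q.NotVertex := fun i hi => by
  have h1 := τ.vertex_mem s i
  rw [← hi, ← h] at h1
  obtain ⟨j, hj⟩ := τ.eq_vertex t p h1
  exact hp j hj

theorem side_of_eq {t s : Fin τ.num} {i : Fin 3} {p q : Tri} (hp : p ∈ Tri.side i)
    (h : τ.chart t p = τ.chart s q) :
    ∃ j, q ∈ Tri.side j ∧ ((s, j) = (t, i) ∨ (s, j) = τ.bar (t, i)) := by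
  rcases Tri.inner_or_side (τ.notVertex_of_eq (Tri.notVertex_of_side hp) h) with hq | ⟨j, hq⟩
  · obtain ⟨-, rfl⟩ := τ.inner_eq hq h.symm
    exact absurd hq (Tri.not_inner_of_side hp)
  · exact ⟨j, hq, τ.eq_or_eq_bar (τ.side_match s t j i q p hq hp h.symm)⟩

/-- The surface carries the quotient topology of its triangles: they are finitely many and compact,
and the target is Hausdorff, so images of closed sets are closed. -/
theorem isOpen_of_preimage {V : Set X} (h : ∀ t, IsOpen (τ.chart t ⁻¹' V)) : IsOpen V := by
  have := S.hausdorff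
  have hV : Vᶜ = ⋃ t, τ.chart t '' (τ.chart t ⁻¹' V)ᶜ := by
    ext x
    simp only [Set.mem_compl_iff, Set.mem_iUnion, Set.mem_image, Set.mem_preimage]
    constructor
    · intro hx
      obtain ⟨t, p, rfl⟩ := τ.cover x
      exact ⟨t, p, hx, rfl⟩
    · rintro ⟨t, p, hp, rfl⟩
      exact hp
  rw [← isClosed_compl_iff, hV]
  exact isClosed_iUnion_of_finite fun t =>
    ((h t).isClosed_compl.isCompact.image (τ.chart t).continuous).isClosed

/-- The set of all vertices of the triangulation. -/
def verts (_ : IdealTriangulation S) : Set X := S.marked ∪ S.punctures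

theorem mem_verts_iff {t : Fin τ.num} {p : Tri} : τ.chart t p ∈ τ.verts ↔ ¬ p.NotVertex := by
  constructor
  · intro h hp
    obtain ⟨i, hi⟩ := τ.eq_vertex t p h
    exact hp i hi
  · intro h
    simp only [Tri.NotVertex, not_forall, not_not] at h
    obtain ⟨i, rfl⟩ := h
    exact τ.vertex_mem t i

/-- The open triangle, as a subset of the surface. -/
def cell (t : Fin τ.num) : Set X := τ.chart t '' Tri.inner

theorem preimage_cell (t s : Fin τ.num) {p : Tri} :
    τ.chart s p ∈ τ.cell t ↔ s = t ∧ p ∈ Tri.inner := by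
  constructor
  · rintro ⟨q, hq, h⟩
    obtain ⟨rfl, rfl⟩ := τ.inner_eq hq h
    exact ⟨rfl, hq⟩
  · rintro ⟨rfl, hp⟩
    exact ⟨p, hp, rfl⟩

theorem isOpen_cell (t : Fin τ.num) : IsOpen (τ.cell t) := by
  refine τ.isOpen_of_preimage fun s => ?_
  by_cases h : s = t
  · convert Tri.isOpen_inner
    ext p; simp [preimage_cell, h]
  · convert isOpen_empty
    ext p; simp [preimage_cell, h]

/-- The open star of an arc: the arc together with its collars. -/
def star (a : τ.Side) : Set X :=
  τ.chart a.1 '' Tri.collar a.2 ∪ τ.chart (τ.bar a).1 '' Tri.collar (τ.bar a).2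

theorem mem_star_left {t : Fin τ.num} {i : Fin 3} {p : Tri} (hp : p ∈ Tri.collar i) :
    τ.chart t p ∈ τ.star (t, i) := Or.inl ⟨p, hp, rfl⟩

theorem mem_star_right {a : τ.Side} {t : Fin τ.num} {i : Fin 3} (h : τ.bar a = (t, i)) {p : Tri}
    (hp : p ∈ Tri.collar i) : τ.chart t p ∈ τ.star a :=
  Or.inr ⟨p, by rw [h]; exact hp, by rw [h]⟩

theorem collar_of_eq {t s : Fin τ.num} {i : Fin 3} {p q : Tri} (hq : q ∈ Tri.collar i)
    (h : τ.chart s q = τ.chart t p) :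
    ∃ k, p ∈ Tri.collar k ∧ ((t, k) = (s, i) ∨ (t, k) = τ.bar (s, i)) := by
  rcases Tri.inner_or_side_of_collar hq with hq' | hq'
  · obtain ⟨rfl, rfl⟩ := τ.inner_eq hq' h
    exact ⟨i, hq, Or.inl rfl⟩
  · obtain ⟨k, hk, h'⟩ := τ.side_of_eq hq' h
    exact ⟨k, Tri.side_subset_collar k hk, h'⟩

theorem preimage_star (a : τ.Side) (t : Fin τ.num) {p : Tri} :
    τ.chart t p ∈ τ.star a ↔ ∃ k, p ∈ Tri.collar k ∧ ((t, k) = a ∨ (t, k) = τ.bar a) := by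
  constructor
  · rintro (⟨q, hq, h⟩ | ⟨q, hq, h⟩)
    · exact τ.collar_of_eq hq h
    · obtain ⟨k, hk, h'⟩ := τ.collar_of_eq hq h
      refine ⟨k, hk, ?_⟩
      rw [τ.bar_bar] at h'
      exact h'.symm
  · rintro ⟨k, hk, rfl | h⟩
    · exact Or.inl ⟨p, hk, rfl⟩
    · exact τ.mem_star_right h.symm hk

theorem isOpen_star (a : τ.Side) : IsOpen (τ.star a) := by
  refine τ.isOpen_of_preimage fun t => ?_
  have : τ.chart t ⁻¹' τ.star a =
      ⋃ k, {p | p ∈ Tri.collar k ∧ ((t, k) = a ∨ (t, k) = τ.bar a)} := by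
    ext p
    rw [Set.mem_preimage, preimage_star, Set.mem_iUnion]
    rfl
  rw [this]
  refine isOpen_iUnion fun k => ?_
  by_cases h : (t, k) = a ∨ (t, k) = τ.bar a
  · simpa [h] using Tri.isOpen_collar k
  · simp [h]

theorem star_subset (a : τ.Side) {x : X} (hx : x ∈ τ.star a) : x ∉ τ.verts := by
  rcases hx with ⟨p, hp, rfl⟩ | ⟨p, hp, rfl⟩ <;>
  · rw [mem_verts_iff, not_not]
    exact Tri.notVertex_of_collar hp

theorem cell_subset (t : Fin τ.num) {x : X} (hx : x ∈ τ.cell t) : x ∉ τ.verts := by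
  obtain ⟨p, hp, rfl⟩ := hx
  rw [mem_verts_iff, not_not]
  exact Tri.notVertex_of_inner hp

/-- A chosen side representing the arc of a given side. -/
def rep (a : τ.Side) : τ.Side := (⟨a, rfl⟩ : ∃ b, τ.edge b = τ.edge a).choose

theorem edge_rep (a : τ.Side) : τ.edge (τ.rep a) = τ.edge a :=
  (⟨a, rfl⟩ : ∃ b, τ.edge b = τ.edge a).choose_spec

/-- The choice inside `rep` depends on the set `edge a` only, so equal arcs lead to literally the
same choice. -/
theorem rep_eq_of_edge_eq {a b : τ.Side} (h : τ.edge a = τ.edge b) : τ.rep a = τ.rep b := by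
  unfold rep; simp only [h]

theorem rep_rep (a : τ.Side) : τ.rep (τ.rep a) = τ.rep a := τ.rep_eq_of_edge_eq (τ.edge_rep a)

theorem rep_bar (a : τ.Side) : τ.rep (τ.bar a) = τ.rep a := τ.rep_eq_of_edge_eq (τ.edge_bar a)

theorem rep_eq_or (a : τ.Side) : τ.rep a = a ∨ τ.rep a = τ.bar a := τ.eq_or_eq_bar (τ.edge_rep a)

/-- A point which is not a vertex lies in a unique triangle at a unique position, up to the
two positions of a point on an arc; this is the preferred choice. -/
def IsLoc (x : X) (t : Fin τ.num) (p : Tri) : Prop :=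
  τ.chart t p = x ∧ (p ∈ Tri.inner ∨ ∃ i, p ∈ Tri.side i ∧ τ.rep (t, i) = (t, i))

theorem exists_isLoc {x : X} (hx : x ∉ τ.verts) : ∃ t p, τ.IsLoc x t p := by
  obtain ⟨t, p, rfl⟩ := τ.cover x
  rw [mem_verts_iff, not_not] at hx
  rcases Tri.inner_or_side hx with hp | ⟨i, hp⟩
  · exact ⟨t, p, rfl, Or.inl hp⟩
  · have h1 : τ.chart t p ∈ τ.edge (τ.rep (t, i)) := by
      rw [edge_rep]; exact ⟨p, hp, rfl⟩
    obtain ⟨q, hq, h⟩ := h1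
    exact ⟨(τ.rep (t, i)).1, q, h, Or.inr ⟨(τ.rep (t, i)).2, hq, τ.rep_rep _⟩⟩

theorem IsLoc.unique {x : X} {t s : Fin τ.num} {p q : Tri} (h : τ.IsLoc x t p)
    (h' : τ.IsLoc x s q) : t = s ∧ p = q := by
  obtain ⟨hx, hp⟩ := h
  obtain ⟨hx', hq⟩ := h'
  have heq := hx.trans hx'.symm
  rcases hp with hp | ⟨i, hp, hi⟩
  · exact τ.inner_eq hp heq
  rcases hq with hq | ⟨j, hq, hj⟩
  · obtain ⟨rfl, rfl⟩ := τ.inner_eq hq heq.symm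
    exact ⟨rfl, rfl⟩
  have h1 : τ.edge (t, i) = τ.edge (s, j) := τ.side_match t s i j p q hp hq heq
  have h2 := τ.rep_eq_of_edge_eq h1
  rw [hi, hj] at h2
  obtain ⟨rfl, rfl⟩ := Prod.ext_iff.1 h2
  exact ⟨rfl, τ.side_inj t i hp hq heq⟩

theorem IsLoc.notVertex {x : X} {t : Fin τ.num} {p : Tri} (h : τ.IsLoc x t p) : p.NotVertex :=
  h.2.elim Tri.notVertex_of_inner fun ⟨_, hp, _⟩ => Tri.notVertex_of_side hp

theorem isLoc_of_inner {t : Fin τ.num} {p : Tri} (hp : p ∈ Tri.inner) :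
    τ.IsLoc (τ.chart t p) t p := ⟨rfl, Or.inl hp⟩

theorem isLoc_of_side {t : Fin τ.num} {i : Fin 3} {p : Tri} (hp : p ∈ Tri.side i)
    (h : τ.rep (t, i) = (t, i)) : τ.IsLoc (τ.chart t p) t p := ⟨rfl, Or.inr ⟨i, hp, h⟩⟩

theorem isLoc_of_collar {t : Fin τ.num} {i : Fin 3} {p : Tri} (hp : p ∈ Tri.collar i)
    (h : τ.rep (t, i) = (t, i)) : τ.IsLoc (τ.chart t p) t p :=
  (Tri.inner_or_side_of_collar hp).elim τ.isLoc_of_inner fun hp => τ.isLoc_of_side hp h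

end IdealTriangulation

end


/-! ### Letters for crossings, and local frames off the vertices. -/

noncomputable section

namespace IdealTriangulation.NearbyPoints

variable {X : Type*} [TopologicalSpace X] [ChartedSpace (EuclideanHalfSpace 2) X]
  {S : MarkedSurface X} {τ : IdealTriangulation S} (N : τ.NearbyPoints)

/-- The folded sides of the triangles around the punctures. -/
def Folded (a : τ.Side) : Prop := ∃ P, a = (N.tri P, N.fst P) ∨ a = (N.tri P, N.snd P)

theorem bar_fst (P : S.punctures) : τ.bar (N.tri P, N.fst P) = (N.tri P, N.snd P) :=
  (τ.eq_bar_of_ne (a := (N.tri P, N.fst P)) (b := (N.tri P, N.snd P)) (N.folded P).2.1.symm fun h => (N.folded P).1 (Prod.ext_iff.1 h).2.symm).symm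

theorem bar_snd (P : S.punctures) : τ.bar (N.tri P, N.snd P) = (N.tri P, N.fst P) := by
  rw [← bar_fst, τ.bar_bar]

theorem folded_fst (P : S.punctures) : N.Folded (N.tri P, N.fst P) := ⟨P, Or.inl rfl⟩

theorem folded_snd (P : S.punctures) : N.Folded (N.tri P, N.snd P) := ⟨P, Or.inr rfl⟩

theorem Folded.bar {a : τ.Side} (h : N.Folded a) : N.Folded (τ.bar a) := by
  obtain ⟨P, rfl | rfl⟩ := h
  · rw [bar_fst]; exact N.folded_snd P
  · rw [bar_snd]; exact N.folded_fst P

theorem folded_bar_iff {a : τ.Side} : N.Folded (τ.bar a) ↔ N.Folded a :=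
  ⟨fun h => by simpa [τ.bar_bar] using h.bar, fun h => h.bar⟩

theorem folded_rep_iff {a : τ.Side} : N.Folded (τ.rep a) ↔ N.Folded a := by
  rcases τ.rep_eq_or a with h | h <;> rw [h]
  exact N.folded_bar_iff

open Classical in
/-- The letter which records the crossing of an arc, starting from a given side of it. The two
ways to cross the folded side of a triangle around a puncture give the same letter. -/
def letter (a : τ.Side) : τ.Side := if N.Folded a then τ.rep a else a

open Classical in
/-- The involution on the letters which reverses the direction of a crossing. -/
def flip (a : τ.Side) : τ.Side := if N.Folded a then a else τ.bar a

theorem flip_involutive : Function.Involutive N.flip := fun a => by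
  by_cases h : N.Folded a
  · simp [flip, h]
  · simp [flip, h, folded_bar_iff, τ.bar_bar]

theorem letter_bar (a : τ.Side) : N.letter (τ.bar a) = N.flip (N.letter a) := by
  by_cases h : N.Folded a
  · simp [flip, letter, h, folded_bar_iff, folded_rep_iff, τ.rep_bar]
  · simp [flip, letter, h, folded_bar_iff]

/-- `letter` forgets nothing but the direction in which a folded arc is crossed, and a letter still
shows whether its arc is folded. -/
theorem eq_or_of_letter_eq {a b : τ.Side} (h : N.letter a = N.letter b) :
    a = b ∨ (N.Folded a ∧ b = τ.bar a) := by
  have hab : N.Folded a ↔ N.Folded b := by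
    have h1 : ∀ c, N.Folded (N.letter c) ↔ N.Folded c := fun c => by
      by_cases hc : N.Folded c <;> simp [letter, hc, folded_rep_iff]
    rw [← h1 a, h, h1]
  by_cases ha : N.Folded a
  · simp only [letter, ha, hab.1 ha, if_true] at h
    have h1 : τ.edge b = τ.edge a := by rw [← τ.edge_rep b, ← h, τ.edge_rep]
    rcases τ.eq_or_eq_bar h1 with h2 | h2
    · exact Or.inl h2.symm
    · exact Or.inr ⟨ha, h2⟩
  · left
    simpa [letter, ha, mt hab.2 ha] using h

/-- A boundary segment is its own `bar`, so its letter may be fixed by `flip` as well; the second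
hypothesis removes this case. -/
theorem folded_of_flip_letter {a : τ.Side} (h : N.flip (N.letter a) = N.letter a)
    (hne : τ.bar a ≠ a) : N.Folded a := by
  rw [← letter_bar] at h
  rcases N.eq_or_of_letter_eq h with h1 | ⟨h1, -⟩
  · exact absurd h1 hne
  · exact N.folded_bar_iff.1 h1

theorem flip_letter_of_folded {a : τ.Side} (h : N.Folded a) :
    N.flip (N.letter a) = N.letter a := by
  simp [letter, flip, h, folded_rep_iff]

/-- The permutations of the reduced words in the crossings of arcs. -/
abbrev Perms : Type := Equiv.Perm (ReducedWord N.flip)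

/-- The permutation for crossing the arc of the side `a`, starting from this side. -/
def cross (a : τ.Side) : N.Perms := ReducedWord.push N.flip_involutive (N.letter a)

theorem cross_bar (a : τ.Side) : N.cross (τ.bar a) = (N.cross a)⁻¹ := by
  rw [cross, cross, ReducedWord.push_inv, letter_bar]

theorem cross_mul_self {a : τ.Side} (h : N.Folded a) : N.cross a * N.cross a = 1 :=
  ReducedWord.push_mul_self _ (N.flip_letter_of_folded h)

/-- The local pieces of the surface: open triangles and open stars of arcs. -/
abbrev Piece (τ : IdealTriangulation S) : Type := Fin τ.num ⊕ {a : τ.Side // τ.rep a = a}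

/-- The subset of the surface which belongs to a local piece. -/
def pieceSet : Piece τ → Set X
  | Sum.inl t => τ.cell t
  | Sum.inr a => τ.star a.1

open Classical in
/-- The frame over a local piece. -/
def frame : Piece τ → X → N.Perms
  | Sum.inl _, _ => 1
  | Sum.inr a, x =>
    -- The arc itself is counted with the near collar, so the frame jumps on entering the open far
    -- collar. A boundary segment has no far collar.
    if τ.bar a.1 ≠ a.1 ∧ x ∈ τ.chart (τ.bar a.1).1 '' (Tri.collar (τ.bar a.1).2 ∩ Tri.inner) then
      N.cross a.1 else 1

theorem frame_left {a : τ.Side} (ha : τ.rep a = a) {t : Fin τ.num} {i : Fin 3} (h : a = (t, i))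
    {p : Tri} (hp : p ∈ Tri.collar i) : N.frame (Sum.inr ⟨a, ha⟩) (τ.chart t p) = 1 := by
  rw [frame, if_neg]
  rintro ⟨hne, q, ⟨hq, hq'⟩, hpq⟩
  obtain ⟨h1, rfl⟩ := τ.inner_eq hq' hpq
  have h2 := Tri.collar_disjoint hq hp
  exact hne ((Prod.ext h1 h2 : τ.bar a = (t, i)).trans h.symm)

theorem frame_right {a : τ.Side} (ha : τ.rep a = a) {t : Fin τ.num} {i : Fin 3}
    (h : τ.bar a = (t, i)) (hne : τ.bar a ≠ a) {p : Tri} (hp : p ∈ Tri.collar i)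
    (hp' : p ∈ Tri.inner) : N.frame (Sum.inr ⟨a, ha⟩) (τ.chart t p) = N.cross a := by
  rw [frame, if_pos]
  exact ⟨hne, p, by rw [h]; exact ⟨hp, hp'⟩, by rw [h]⟩

theorem isOpen_pieceSet (j : Piece τ) : IsOpen (pieceSet j) := by
  rcases j with t | a
  · exact τ.isOpen_cell t
  · exact τ.isOpen_star a.1

theorem exists_mem_pieceSet {x : X} (hx : x ∉ τ.verts) : ∃ j : Piece τ, x ∈ pieceSet j := by
  obtain ⟨t, p, rfl, hp | ⟨i, hp, h⟩⟩ := τ.exists_isLoc hx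
  · exact ⟨Sum.inl t, p, hp, rfl⟩
  · exact ⟨Sum.inr ⟨_, h⟩, τ.mem_star_left (Tri.side_subset_collar i hp)⟩

theorem pieceSet_subset (j : Piece τ) {x : X} (hx : x ∈ pieceSet j) : x ∉ τ.verts := by
  rcases j with t | a
  · exact τ.cell_subset t hx
  · exact τ.star_subset a.1 hx

theorem isOpen_image_collar_inner (t : Fin τ.num) (k : Fin 3) :
    IsOpen (τ.chart t '' (Tri.collar k ∩ Tri.inner)) := by
  refine τ.isOpen_of_preimage fun s => ?_
  by_cases h : s = t
  · subst h
    convert (Tri.isOpen_collar k).inter Tri.isOpen_inner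
    ext p
    constructor
    · rintro ⟨q, hq, h⟩
      obtain ⟨-, rfl⟩ := τ.inner_eq hq.2 h
      exact hq
    · exact fun hp => ⟨p, hp, rfl⟩
  · convert isOpen_empty
    rw [Set.eq_empty_iff_forall_notMem]
    rintro p ⟨q, hq, h'⟩
    exact h (τ.inner_eq hq.2 h').1.symm

theorem frame_eventually_of_cell {t : Fin τ.num} {a : {a : τ.Side // τ.rep a = a}} {x : X}
    (hx : x ∈ τ.cell t) (hxa : x ∈ τ.star a.1) :
    ∀ᶠ y in 𝓝 x, N.frame (Sum.inr a) y = N.frame (Sum.inr a) x := by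
  obtain ⟨p, hp, rfl⟩ := hx
  obtain ⟨k, hk, h⟩ := (τ.preimage_star a.1 t).1 hxa
  obtain ⟨a, ha⟩ := a
  filter_upwards [(isOpen_image_collar_inner t k).mem_nhds ⟨p, ⟨hk, hp⟩, rfl⟩]
  rintro _ ⟨q, ⟨hq, hq'⟩, rfl⟩
  by_cases h1 : (t, k) = a
  · rw [N.frame_left ha h1.symm hq, N.frame_left ha h1.symm hk]
  · have h2 := h.resolve_left h1
    have h3 : τ.bar a ≠ a := fun h3 => h1 (h2.trans h3)
    rw [N.frame_right ha h2.symm h3 hq hq', N.frame_right ha h2.symm h3 hk hp]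

theorem star_disjoint {a b : τ.Side} (ha : τ.rep a = a) (hb : τ.rep b = b) {x : X}
    (hxa : x ∈ τ.star a) (hxb : x ∈ τ.star b) : a = b := by
  obtain ⟨t, p, rfl⟩ := τ.cover x
  obtain ⟨k, hk, h⟩ := (τ.preimage_star a t).1 hxa
  obtain ⟨l, hl, h'⟩ := (τ.preimage_star b t).1 hxb
  obtain rfl := Tri.collar_disjoint hk hl
  have h1 : τ.rep (t, k) = a := by rcases h with h | h <;> rw [h, ← ha] <;> simp [τ.rep_bar, τ.rep_rep]
  have h2 : τ.rep (t, k) = b := by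
    rcases h' with h | h <;> rw [h, ← hb] <;> simp [τ.rep_bar, τ.rep_rep]
  rw [← h1, h2]

/-- The frame of a star jumps at the arc, but only transitions between frames matter. Distinct stars
are disjoint, the transition from a star to itself is trivial, and a star meets a cell only off the
arc, where its frame is locally constant. -/
theorem frame_locally_constant (i j : Piece τ) (x : X) (hi : x ∈ pieceSet i)
    (hj : x ∈ pieceSet j) :
    ∀ᶠ y in 𝓝 x, (N.frame j y)⁻¹ * N.frame i y = (N.frame j x)⁻¹ * N.frame i x := by
  rcases i with t | a <;> rcases j with s | b
  · simp [frame]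
  · filter_upwards [N.frame_eventually_of_cell hi hj] with y hy
    rw [hy]; simp only [frame]
  · filter_upwards [N.frame_eventually_of_cell hj hi] with y hy
    rw [hy]; simp only [frame]
  · obtain rfl : a = b := Subtype.ext (star_disjoint a.2 b.2 hi hj)
    simp

/-- The surface without the vertices of the triangulation. -/
abbrev NoVerts (τ : IdealTriangulation S) : Type _ := {x : X // x ∉ τ.verts}

theorem exists_transport_noVerts :
    ∃ F : FundamentalGroupoid (NoVerts τ) ⥤ SingleObj N.Perms,
      ∀ (i : Piece τ) (x y : NoVerts τ) (p : Path x y), (∀ s, (p s : X) ∈ pieceSet i) →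
        F.map (X := ⟨x⟩) (Y := ⟨y⟩) (Path.Homotopic.Quotient.mk p) =
          N.frame i y * (N.frame i x)⁻¹ := by
  refine exists_transport (fun i => Subtype.val ⁻¹' pieceSet i)
    (fun i => (isOpen_pieceSet i).preimage continuous_subtype_val)
    (fun x => exists_mem_pieceSet x.2) (fun i (x : NoVerts τ) => N.frame i x.1) fun i j x hi hj => ?_
  exact continuous_subtype_val.continuousAt.eventually (N.frame_locally_constant i j x hi hj)

end IdealTriangulation.NearbyPoints

end


noncomputable section

/-! Small neighbourhoods of points of a topological surface with boundary -/

section Charts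

variable {X : Type*} [TopologicalSpace X] [ChartedSpace (EuclideanHalfSpace 2) X]

theorem exists_ball_subset_extChartAt (x : X) {O : Set X} (hO : O ∈ 𝓝 x) :
    ∃ ε > 0, ∀ y ∈ Metric.ball (extChartAt (𝓡∂ 2) x x) ε ∩ Set.range (𝓡∂ 2),
      y ∈ (extChartAt (𝓡∂ 2) x).target ∧ (extChartAt (𝓡∂ 2) x).symm y ∈ O := by
  have h1 : (extChartAt (𝓡∂ 2) x).target ∈ 𝓝[Set.range (𝓡∂ 2)] extChartAt (𝓡∂ 2) x x :=
    extChartAt_target_mem_nhdsWithin x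
  have h2 : (extChartAt (𝓡∂ 2) x).symm ⁻¹' O ∈ 𝓝 (extChartAt (𝓡∂ 2) x x) :=
    (continuousAt_extChartAt_symm x).preimage_mem_nhds (by rwa [extChartAt_to_inv])
  obtain ⟨ε, hε, h⟩ := Metric.mem_nhdsWithin_iff.1
    (Filter.inter_mem h1 (mem_nhdsWithin_of_mem_nhds h2))
  exact ⟨ε, hε, fun y hy => h hy⟩

theorem image_extChartAt_symm (x : X) {ε : ℝ}
    (h : ∀ y ∈ Metric.ball (extChartAt (𝓡∂ 2) x x) ε ∩ Set.range (𝓡∂ 2),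
      y ∈ (extChartAt (𝓡∂ 2) x).target) :
    (extChartAt (𝓡∂ 2) x).symm '' (Metric.ball (extChartAt (𝓡∂ 2) x x) ε ∩ Set.range (𝓡∂ 2)) =
      (extChartAt (𝓡∂ 2) x).source ∩
        extChartAt (𝓡∂ 2) x ⁻¹' Metric.ball (extChartAt (𝓡∂ 2) x x) ε := by
  ext z
  constructor
  · rintro ⟨y, hy, rfl⟩
    refine ⟨(extChartAt (𝓡∂ 2) x).map_target (h y hy), ?_⟩
    rw [Set.mem_preimage, (extChartAt (𝓡∂ 2) x).right_inv (h y hy)]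
    exact hy.1
  · rintro ⟨hz, hz'⟩
    exact ⟨_, ⟨hz', extChartAt_target_subset_range x ((extChartAt (𝓡∂ 2) x).map_source hz)⟩,
      (extChartAt (𝓡∂ 2) x).left_inv hz⟩

theorem isSimplyConnected_image_extChartAt_symm (x : X) {A : Set (EuclideanSpace ℝ (Fin 2))}
    (hA : A ⊆ (extChartAt (𝓡∂ 2) x).target) (h : IsSimplyConnected A) :
    IsSimplyConnected ((extChartAt (𝓡∂ 2) x).symm '' A) := by
  set e := extChartAt (𝓡∂ 2) x
  have h1 : ∀ z ∈ e.symm '' A, e z ∈ A := by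
    rintro _ ⟨y, hy, rfl⟩
    rwa [e.right_inv (hA hy)]
  have h2 : e.symm '' A ⊆ e.source := by
    rintro _ ⟨y, hy, rfl⟩
    exact e.map_target (hA hy)
  let f : A ≃ₜ (e.symm '' A : Set X) :=
    { toFun := fun y => ⟨e.symm y, y, y.2, rfl⟩
      invFun := fun z => ⟨e z, h1 z z.2⟩
      left_inv := fun y => Subtype.ext (e.right_inv (hA y.2))
      right_inv := fun z => Subtype.ext (e.left_inv (h2 z.2))
      continuous_toFun := Continuous.subtype_mk
        ((continuousOn_extChartAt_symm x).comp_continuous continuous_subtype_val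
          fun y => hA y.2) _
      continuous_invFun := Continuous.subtype_mk
        ((continuousOn_extChartAt x).comp_continuous continuous_subtype_val fun z => h2 z.2) _ }
  exact f.toHomotopyEquiv.simplyConnectedSpace_iff.1 h

theorem mem_range_modelWithCorners_iff {y : EuclideanSpace ℝ (Fin 2)} :
    y ∈ Set.range (𝓡∂ 2) ↔ 0 ≤ y 0 := by
  rw [range_modelWithCornersEuclideanHalfSpace]; rfl

/-- Boundary points have arbitrarily small simply connected open neighbourhoods, which remain
simply connected when the point is removed. -/
theorem exists_simplyConnected_nhds_of_boundary {x : X} (hx : x ∈ (𝓡∂ 2).boundary X) {O : Set X}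
    (hO : O ∈ 𝓝 x) :
    ∃ W, IsOpen W ∧ x ∈ W ∧ W ⊆ O ∧ IsSimplyConnected W ∧ IsSimplyConnected (W \ {x}) := by
  obtain ⟨ε, hε, h⟩ := exists_ball_subset_extChartAt x hO
  have himg := image_extChartAt_symm x fun y hy => (h y hy).1
  have hxs : x ∈ (extChartAt (𝓡∂ 2) x).source := mem_extChartAt_source x
  set e := extChartAt (𝓡∂ 2) x with he
  set D := Metric.ball (e x) ε ∩ Set.range (𝓡∂ 2) with hD
  have hc0 : (e x) 0 = 0 := by
    have h1 : e x ∈ frontier (Set.range (𝓡∂ 2)) := hx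
    rw [frontier_range_modelWithCornersEuclideanHalfSpace] at h1
    exact h1.symm
  have hcD : e x ∈ D := ⟨Metric.mem_ball_self hε, mem_range_modelWithCorners_iff.2 hc0.ge⟩
  have hDc : Convex ℝ D := by
    refine (convex_ball _ _).inter ?_
    intro y hy z hz a b ha hb _
    rw [mem_range_modelWithCorners_iff] at *
    simp only [PiLp.add_apply, PiLp.smul_apply, smul_eq_mul]
    positivity
  have hDs : IsSimplyConnected D := by
    have : ContractibleSpace D := (hDc.starConvex hcD).contractibleSpace ⟨_, hcD⟩
    exact SimplyConnectedSpace.ofContractible D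
  -- A point displaced inwards is a star centre for the punctured half-disc: on a segment from `b`,
  -- the coordinate normal to the boundary stays positive before the far end.
  set b : EuclideanSpace ℝ (Fin 2) := e x + EuclideanSpace.single 0 (ε / 2) with hb
  have hb0 : b 0 = ε / 2 := by simp [hb, hc0]
  have hbD : b ∈ D := by
    refine ⟨?_, mem_range_modelWithCorners_iff.2 (by rw [hb0]; positivity)⟩
    rw [Metric.mem_ball, dist_eq_norm, hb, add_sub_cancel_left, PiLp.norm_single,
      Real.norm_of_nonneg (by positivity)]
    linarith
  have hstar : StarConvex ℝ b (D \ {e x}) := by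
    intro y hy s t hs ht hst
    refine ⟨hDc hbD hy.1 hs ht hst, fun heq => ?_⟩
    have h0 : s * (ε / 2) + t * y 0 = 0 := by
      have := congrArg (fun v : EuclideanSpace ℝ (Fin 2) => v 0) (Set.mem_singleton_iff.1 heq)
      simpa [hb0, hc0] using this
    have hy0 := mem_range_modelWithCorners_iff.1 hy.1.2
    have hs0 : s = 0 := by
      by_contra hs'
      have : 0 < s := lt_of_le_of_ne hs (Ne.symm hs')
      have : 0 < s * (ε / 2) := by positivity
      have : 0 ≤ t * y 0 := by positivity
      linarith
    have ht1 : t = 1 := by linarith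
    rw [hs0, ht1] at heq
    exact hy.2 (by simpa using heq)
  have hbne : b ∈ D \ {e x} := by
    refine ⟨hbD, fun heq => ?_⟩
    rw [Set.mem_singleton_iff.1 heq, hc0] at hb0
    linarith
  have hDs' : IsSimplyConnected (D \ {e x}) := by
    have : ContractibleSpace (D \ {e x} : Set _) := hstar.contractibleSpace ⟨_, hbne⟩
    exact SimplyConnectedSpace.ofContractible _
  refine ⟨e.symm '' D, ?_, ⟨e x, hcD, e.left_inv hxs⟩, ?_, ?_, ?_⟩
  · rw [himg]
    exact (continuousOn_extChartAt x).isOpen_inter_preimage (isOpen_extChartAt_source x)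
      Metric.isOpen_ball
  · rintro _ ⟨y, hy, rfl⟩
    exact (h y hy).2
  · exact isSimplyConnected_image_extChartAt_symm x (fun y hy => (h y hy).1) hDs
  · convert isSimplyConnected_image_extChartAt_symm x (A := D \ {e x})
      (fun y hy => (h y hy.1).1) hDs'
    ext z
    constructor
    · rintro ⟨⟨y, hy, rfl⟩, hz⟩
      refine ⟨y, ⟨hy, ?_⟩, rfl⟩
      rintro rfl
      exact hz (e.left_inv hxs)
    · rintro ⟨y, ⟨hy, hy'⟩, rfl⟩
      refine ⟨⟨y, hy, rfl⟩, fun hz => hy' ?_⟩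
      rw [Set.mem_singleton_iff] at hz ⊢
      rw [← hz, e.right_inv (h y hy).1]

/-- Interior points have arbitrarily small open neighbourhoods which remain connected when the
point is removed. -/
theorem exists_punctured_connected_nhds_of_interior {x : X} (hx : x ∈ (𝓡∂ 2).interior X)
    {O : Set X} (hO : O ∈ 𝓝 x) :
    ∃ W, IsOpen W ∧ x ∈ W ∧ W ⊆ O ∧ IsPreconnected (W \ {x}) := by
  obtain ⟨ε₀, hε₀, h₀⟩ := exists_ball_subset_extChartAt x hO
  have h1 : Set.range (𝓡∂ 2) ∈ 𝓝 (extChartAt (𝓡∂ 2) x x) := mem_interior_iff_mem_nhds.1 hx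
  obtain ⟨ε₁, hε₁, h₁⟩ := Metric.mem_nhds_iff.1 h1
  obtain ⟨ε, hε, h, hsub⟩ : ∃ ε > 0, (∀ y ∈ Metric.ball (extChartAt (𝓡∂ 2) x x) ε,
      y ∈ (extChartAt (𝓡∂ 2) x).target ∧ (extChartAt (𝓡∂ 2) x).symm y ∈ O) ∧
      Metric.ball (extChartAt (𝓡∂ 2) x x) ε ⊆ Set.range (𝓡∂ 2) := by
    refine ⟨min ε₀ ε₁, lt_min hε₀ hε₁, fun y hy => h₀ y ⟨?_, h₁ ?_⟩, fun y hy => h₁ ?_⟩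
    · exact Metric.ball_subset_ball (min_le_left _ _) hy
    · exact Metric.ball_subset_ball (min_le_right _ _) hy
    · exact Metric.ball_subset_ball (min_le_right _ _) hy
  have himg := image_extChartAt_symm x fun y hy => (h y hy.1).1
  have hxs : x ∈ (extChartAt (𝓡∂ 2) x).source := mem_extChartAt_source x
  rw [Set.inter_eq_left.2 hsub] at himg
  set e := extChartAt (𝓡∂ 2) x with he
  have hconn : IsPreconnected (Metric.ball (e x) ε \ {e x}) := by
    -- This stretches the ball to the whole plane, with its centre at `0`; the plane minus a point
    -- is connected.
    let u := OpenPartialHomeomorph.univBall (e x) ε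
    have hs : u.source = Set.univ := OpenPartialHomeomorph.univBall_source _ _
    have ht : u.target = Metric.ball (e x) ε := OpenPartialHomeomorph.univBall_target _ hε
    have h0 : u 0 = e x := OpenPartialHomeomorph.univBall_apply_zero _ _
    have himg' : Metric.ball (e x) ε \ {e x} = u '' {0}ᶜ := by
      ext y
      constructor
      · rintro ⟨hy, hy'⟩
        rw [← ht] at hy
        refine ⟨u.symm y, fun h => hy' ?_, u.right_inv hy⟩
        rw [Set.mem_singleton_iff] at h ⊢
        rw [← u.right_inv hy, h, h0]
      · rintro ⟨z, hz, rfl⟩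
        refine ⟨ht ▸ u.map_source (hs ▸ Set.mem_univ z), fun h => hz ?_⟩
        rw [Set.mem_singleton_iff, ← h0] at h
        exact u.injOn (hs ▸ Set.mem_univ z) (hs ▸ Set.mem_univ 0) h
    rw [himg']
    refine ((isConnected_compl_singleton_of_one_lt_rank ?_ 0).isPreconnected).image _
      (u.continuousOn.mono (hs ▸ Set.subset_univ _))
    rw [← Module.finrank_eq_rank, finrank_euclideanSpace]
    norm_num
  refine ⟨e.symm '' Metric.ball (e x) ε, ?_, ⟨e x, Metric.mem_ball_self hε, e.left_inv hxs⟩, ?_, ?_⟩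
  · rw [himg]
    exact (continuousOn_extChartAt x).isOpen_inter_preimage (isOpen_extChartAt_source x)
      Metric.isOpen_ball
  · rintro _ ⟨y, hy, rfl⟩
    exact (h y hy).2
  · have : e.symm '' Metric.ball (e x) ε \ {x} = e.symm '' (Metric.ball (e x) ε \ {e x}) := by
      ext z
      constructor
      · rintro ⟨⟨y, hy, rfl⟩, hz⟩
        refine ⟨y, ⟨hy, ?_⟩, rfl⟩
        rintro rfl
        exact hz (e.left_inv hxs)
      · rintro ⟨y, ⟨hy, hy'⟩, rfl⟩
        refine ⟨⟨y, hy, rfl⟩, fun hz => hy' ?_⟩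
        rw [Set.mem_singleton_iff] at hz ⊢
        rw [← hz, e.right_inv (h y hy).1]
    rw [this]
    exact hconn.image _ ((continuousOn_extChartAt_symm x).mono fun y hy => (h y hy.1).1)

end Charts

end


/-! ### Extension of the transport over the marked points. -/

noncomputable section

namespace IdealTriangulation

variable {X : Type*} [TopologicalSpace X] [ChartedSpace (EuclideanHalfSpace 2) X]
  {S : MarkedSurface X} (τ : IdealTriangulation S)

theorem finite_verts : τ.verts.Finite := S.marked_finite.union S.punctures_finite

theorem compl_verts_sdiff_mem_nhds (x : X) : (τ.verts \ {x})ᶜ ∈ 𝓝 x := by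
  have := S.hausdorff
  exact (τ.finite_verts.subset Set.sdiff_subset).isClosed.isOpen_compl.mem_nhds (by simp)

/-- A small neighbourhood of a marked point. -/
structure IsMarkedNbhd (m : X) (W : Set X) : Prop where
  isOpen : IsOpen W
  mem : m ∈ W
  eq_of_mem : ∀ x ∈ W, x ∈ τ.verts → x = m
  simply : IsSimplyConnected W
  simply' : IsSimplyConnected (W \ {m})

theorem exists_isMarkedNbhd {m : X} (hm : m ∈ S.marked) : ∃ W, τ.IsMarkedNbhd m W := by
  obtain ⟨W, h1, h2, h3, h4, h5⟩ := exists_simplyConnected_nhds_of_boundary (S.marked_subset hm)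
    (τ.compl_verts_sdiff_mem_nhds m)
  refine ⟨W, h1, h2, fun x hx hv => ?_, h4, h5⟩
  by_contra hne
  exact h3 hx ⟨hv, hne⟩

namespace NearbyPoints

variable {τ} (N : τ.NearbyPoints)

/-- Composition in `SingleObj` multiplies in the reverse order; this is why the last crossing of a
path becomes the first letter of its word. -/
theorem transport_trans {B : Type*} [TopologicalSpace B] {G : Type*} [Monoid G]
    (F : FundamentalGroupoid B ⥤ SingleObj G) {x y z : B} (p : Path x y) (q : Path y z) :
    (F.map (X := ⟨x⟩) (Y := ⟨z⟩) (Path.Homotopic.Quotient.mk (p.trans q)) : G) =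
      (F.map (X := ⟨y⟩) (Y := ⟨z⟩) (Path.Homotopic.Quotient.mk q) : G) *
        (F.map (X := ⟨x⟩) (Y := ⟨y⟩) (Path.Homotopic.Quotient.mk p) : G) :=
  F.map_comp (X := ⟨x⟩) (Y := ⟨y⟩) (Z := ⟨z⟩) (Path.Homotopic.Quotient.mk p)
    (Path.Homotopic.Quotient.mk q)

open Classical in
/-- The frame over a neighbourhood of a marked point, by parallel transport from a base point
nearby. -/
def markedFrame (F : FundamentalGroupoid (NoVerts τ) ⥤ SingleObj N.Perms) (W : Set X)
    (w : NoVerts τ) (x : X) : N.Perms :=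
  if h : ∃ (hx : x ∉ τ.verts) (p : Path w ⟨x, hx⟩), ∀ s, (p s : X) ∈ W then
    F.map (X := ⟨w⟩) (Y := ⟨⟨x, h.choose⟩⟩) (Path.Homotopic.Quotient.mk h.choose_spec.choose)
  else 1

theorem isSimplyConnected_preimage {m : X} {W : Set X} (hm : m ∈ S.marked)
    (hW : τ.IsMarkedNbhd m W) :
    IsSimplyConnected ((Subtype.val : NoVerts τ → X) ⁻¹' W) := by
  rw [← Topology.IsEmbedding.subtypeVal.isSimplyConnected_image]
  convert hW.simply' using 1
  ext x
  constructor
  · rintro ⟨x, hxW, rfl⟩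
    exact ⟨hxW, fun h => x.2 (Set.mem_singleton_iff.1 h ▸ Or.inl hm)⟩
  · rintro ⟨hxW, hne⟩
    exact ⟨⟨x, fun h => hne (hW.eq_of_mem x hxW h)⟩, hxW, rfl⟩

variable {F : FundamentalGroupoid (NoVerts τ) ⥤ SingleObj N.Perms} {m : X} {W : Set X}

/-- The chosen path is immaterial because the neighbourhood stays simply connected when the marked
point is removed. Here it counts that marked points lie on the boundary. -/
theorem markedFrame_eq (hm : m ∈ S.marked) (hW : τ.IsMarkedNbhd m W) {w x : NoVerts τ}
    (p : Path w x) (hp : ∀ s, (p s : X) ∈ W) :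
    N.markedFrame F W w x = F.map (X := ⟨w⟩) (Y := ⟨x⟩) (Path.Homotopic.Quotient.mk p) := by
  have h : ∃ (hx : (x : X) ∉ τ.verts) (p : Path w ⟨x, hx⟩), ∀ s, (p s : X) ∈ W := ⟨x.2, p, hp⟩
  rw [markedFrame, dif_pos h]
  congr 1
  exact Path.Homotopic.Quotient.eq.2 (homotopic_of_isSimplyConnected
    (isSimplyConnected_preimage hm hW) _ _ h.choose_spec.choose_spec hp)

/-- A nearby point is reached by prolonging the path inside both the piece and `W`. The prolongation
contributes `N.frame i y * (N.frame i x)⁻¹`, which the transition cancels. -/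
theorem markedFrame_eventually (hm : m ∈ S.marked) (hW : τ.IsMarkedNbhd m W) {w : NoVerts τ}
    (hw : w.1 ∈ W)
    (hF : ∀ (i : Piece τ) (x y : NoVerts τ) (p : Path x y), (∀ s, (p s : X) ∈ pieceSet i) →
        F.map (X := ⟨x⟩) (Y := ⟨y⟩) (Path.Homotopic.Quotient.mk p) =
          N.frame i y * (N.frame i x)⁻¹) (i : Piece τ) {x : X} (hx : x ∈ pieceSet i)
    (hxW : x ∈ W) :
    ∀ᶠ y in 𝓝 x, (N.frame i y)⁻¹ * N.markedFrame F W w y =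
      (N.frame i x)⁻¹ * N.markedFrame F W w x := by
  have : LocallyPathConnectedSpace X :=
    ChartedSpace.locallyPathConnectedSpace (EuclideanHalfSpace 2) X
  have hO : pieceSet i ∩ W ∈ 𝓝 x := ((isOpen_pieceSet i).inter hW.isOpen).mem_nhds ⟨hx, hxW⟩
  obtain ⟨C, ⟨hC, hCp⟩, hCO⟩ := (LocallyPathConnectedSpace.path_connected_basis x).mem_iff.1 hO
  filter_upwards [hC] with y hy
  have hv : ∀ z ∈ C, z ∉ τ.verts := fun z hz => pieceSet_subset i (hCO hz).1
  obtain ⟨q, hq⟩ := hCp.joinedIn x (mem_of_mem_nhds hC) y hy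
  let x' : NoVerts τ := ⟨x, hv x (mem_of_mem_nhds hC)⟩
  let y' : NoVerts τ := ⟨y, hv y hy⟩
  let q' : Path x' y' := ⟨⟨fun s => ⟨q s, hv _ (hq s)⟩, by fun_prop⟩, by simp [x'], by simp [y']⟩
  obtain ⟨p, hp⟩ := (isSimplyConnected_preimage hm hW).isPathConnected.joinedIn w hw x' hxW
  have h1 := N.markedFrame_eq (F := F) hm hW p hp
  have h2 := N.markedFrame_eq (F := F) hm hW (p.trans q') fun s => by
    rw [Path.trans_apply]
    split_ifs
    · exact hp _
    · exact (hCO (hq _)).2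
  rw [transport_trans, hF i x' y' q' fun s => (hCO (hq s)).1] at h2
  change N.markedFrame F W w x = _ at h1
  change N.markedFrame F W w y = _ at h2
  rw [h1, h2]
  have e : ∀ a b g : N.Perms, a⁻¹ * (a * b⁻¹ * g) = b⁻¹ * g := fun a b g => by group
  exact e _ _ _

/-- The parallel transport along homotopy classes of paths in the complement of the
punctures. -/
theorem exists_transport_complement (N : τ.NearbyPoints) :
    ∃ F : FundamentalGroupoid S.Complement ⥤ SingleObj N.Perms,
      ∀ (i : Piece τ) (x y : S.Complement) (p : Path x y), (∀ s, (p s : X) ∈ pieceSet i) →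
        F.map (X := ⟨x⟩) (Y := ⟨y⟩) (Path.Homotopic.Quotient.mk p) =
          N.frame i y * (N.frame i x)⁻¹ := by
  obtain ⟨F, hF⟩ := N.exists_transport_noVerts
  choose! W hW using fun m (hm : m ∈ S.marked) => τ.exists_isMarkedNbhd hm
  have hne : ∀ m : S.marked, ∃ w : NoVerts τ, w.1 ∈ W m \ {m.1} := fun m => by
    obtain ⟨w, hw⟩ := (hW m m.2).simply'.nonempty
    exact ⟨⟨w, fun h => hw.2 ((hW m m.2).eq_of_mem w hw.1 h)⟩, hw⟩
  choose w hw using hne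
  let U : Piece τ ⊕ S.marked → Set S.Complement := fun j =>
    Subtype.val ⁻¹' (Sum.elim pieceSet (fun m : S.marked => W m) j)
  let θ : Piece τ ⊕ S.marked → S.Complement → N.Perms := fun j x =>
    Sum.elim (fun i => N.frame i x) (fun m : S.marked => N.markedFrame F (W m) (w m) x) j
  have key : ∀ (m : S.marked) (i : Piece τ) (x : X), x ∈ pieceSet i → x ∈ W m →
      ∀ᶠ y in 𝓝 x, (N.frame i y)⁻¹ * N.markedFrame F (W m) (w m) y =
        (N.frame i x)⁻¹ * N.markedFrame F (W m) (w m) x := fun m i x hx hxW =>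
    N.markedFrame_eventually m.2 (hW m m.2) (hw m).1 hF i hx hxW
  have hU : ∀ j, IsOpen (U j) := by
    rintro (i | m)
    · exact (isOpen_pieceSet i).preimage continuous_subtype_val
    · exact (hW m m.2).isOpen.preimage continuous_subtype_val
  have hcov : ∀ x, ∃ j, x ∈ U j := by
    intro x
    by_cases hx : (x : X) ∈ τ.verts
    · have hm : (x : X) ∈ S.marked := hx.resolve_right x.2
      exact ⟨Sum.inr ⟨x, hm⟩, (hW x hm).mem⟩
    · obtain ⟨i, hi⟩ := exists_mem_pieceSet hx
      exact ⟨Sum.inl i, hi⟩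
  have hθ : ∀ i j x, x ∈ U i → x ∈ U j →
      ∀ᶠ y in 𝓝 x, (θ j y)⁻¹ * θ i y = (θ j x)⁻¹ * θ i x := by
    rintro (i | m) (j | m') x hi hj
    · exact continuous_subtype_val.continuousAt.eventually (N.frame_locally_constant i j x hi hj)
    · have h := continuous_subtype_val.continuousAt.eventually (key m' i x hi hj)
      filter_upwards [h] with y hy
      rw [← inv_inj]
      simpa [θ] using hy
    · exact continuous_subtype_val.continuousAt.eventually (key m j x hj hi)
    -- At a vertex both neighbourhoods belong to the same marked point; elsewhere the two frames are
    -- compared through a piece containing `x`.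
    · by_cases hx : (x : X) ∈ τ.verts
      · have h1 := (hW m m.2).eq_of_mem x hi hx
        have h2 := (hW m' m'.2).eq_of_mem x hj hx
        obtain rfl : m = m' := Subtype.ext (h1.symm.trans h2)
        simp
      · obtain ⟨i, hxi⟩ := exists_mem_pieceSet hx
        have h1 := continuous_subtype_val.continuousAt.eventually (key m i x hxi hi)
        have h2 := continuous_subtype_val.continuousAt.eventually (key m' i x hxi hj)
        filter_upwards [h1, h2] with y hy1 hy2
        have e : ∀ a b c : N.Perms, a⁻¹ * b = (c⁻¹ * a)⁻¹ * (c⁻¹ * b) := fun a b c => by group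
        simp only [θ, Sum.elim_inr]
        rw [e _ _ (N.frame i y), hy1, hy2, ← e]
  obtain ⟨F₂, hF₂⟩ := exists_transport U hU hcov θ hθ
  exact ⟨F₂, fun i x y p hp => hF₂ (Sum.inl i) x y p hp⟩

end NearbyPoints

end IdealTriangulation

end


noncomputable section

/-! Classes of straight paths, and paths in the open star of an arc -/

namespace MarkedSurface

variable {X : Type*} [TopologicalSpace X] [ChartedSpace (EuclideanHalfSpace 2) X]
  (S : MarkedSurface X)

theorem cls_trans {x y z : S.Complement} (p : Path x y) (q : Path y z) :
    S.cls (p.trans q) = S.cls p ≫ S.cls q :=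
  (Quotient.functor S.OrbRel).map_comp (X := ⟨x⟩) (Y := ⟨y⟩) (Z := ⟨z⟩)
    (Path.Homotopic.Quotient.mk p) (Path.Homotopic.Quotient.mk q)

theorem cls_refl (x : S.Complement) : S.cls (Path.refl x) = 𝟙 (S.obj x) :=
  (Quotient.functor S.OrbRel).map_id ⟨x⟩

theorem cls_congr {x y : S.Complement} {p q : Path x y} (h : p.Homotopic q) :
    S.cls p = S.cls q := by
  unfold cls
  rw [Path.Homotopic.Quotient.eq.2 h]

theorem cls_eq_of_trans_eq {x y z w : S.Complement} {p : Path x y} {q : Path y w} {p' : Path x z}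
    {q' : Path z w} (h : (Path.Homotopic.Quotient.mk p).trans (Path.Homotopic.Quotient.mk q) =
      (Path.Homotopic.Quotient.mk p').trans (Path.Homotopic.Quotient.mk q')) :
    S.cls p ≫ S.cls q = S.cls p' ≫ S.cls q' := by
  rw [← Path.Homotopic.Quotient.mk_trans, ← Path.Homotopic.Quotient.mk_trans,
    Path.Homotopic.Quotient.eq] at h
  rw [← cls_trans, ← cls_trans, S.cls_congr h]

theorem cls_trans_symm {x y : S.Complement} (p : Path x y) :
    S.cls p ≫ S.cls p.symm = 𝟙 (S.obj x) := by
  rw [← cls_trans, ← cls_refl]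
  exact S.cls_congr ⟨(Path.Homotopy.reflTransSymm p).symm⟩

theorem cls_symm {x y : S.Complement} (p : Path x y) : S.cls p.symm = inv (S.cls p) :=
  IsIso.eq_inv_of_hom_inv_id (S.cls_trans_symm p)

end MarkedSurface

namespace Tri

/-- Vertices are extreme points, so deleting them leaves a convex set. Hence homotopy classes inside
a triangle depend only on end points, and straight segments represent all of them. -/
instance : ContractibleSpace {p : Tri // p.NotVertex} := by
  let C : Set (Fin 3 → ℝ) := stdSimplex ℝ (Fin 3) ∩ {v | ∀ i, v i < 1}
  have hC : Convex ℝ C := by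
    refine (convex_stdSimplex ℝ (Fin 3)).inter fun v hv w hw a b ha hb hab i => ?_
    have h := lerp_lt (hv i) (hw i) ⟨b, hb, by linarith⟩
    have ha' : a = 1 - b := by linarith
    simpa [ha'] using h
  have hb : bary.1 ∈ C := ⟨bary.2, fun i => by change (1 / 3 : ℝ) < 1; norm_num⟩
  have : ContractibleSpace C := (hC.starConvex hb).contractibleSpace ⟨_, hb⟩
  let f : {p : Tri // p.NotVertex} ≃ₜ C :=
    { toFun := fun p => ⟨p.1.1, p.1.2, notVertex_iff.1 p.2⟩
      invFun := fun v => ⟨⟨v.1, v.2.1⟩, notVertex_iff.2 v.2.2⟩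
      left_inv := fun p => rfl
      right_inv := fun v => rfl
      continuous_toFun := by fun_prop
      continuous_invFun := by fun_prop }
  exact f.contractibleSpace

/-- The projection of the triangle to a side. -/
def proj (i : Fin 3) (p : Tri) : Tri :=
  ⟨fun j => if j = i then 0 else p j + p i / 2, fun j => by
    have h1 := nonneg p i
    have h2 := nonneg p j
    change 0 ≤ if j = i then 0 else p j + p i / 2
    split_ifs
    · exact le_rfl
    · linarith, by
    have h := sum_eq_one p
    rw [Fin.sum_univ_three]
    fin_cases i <;> simp at * <;> linarith⟩

theorem proj_self (i : Fin 3) (p : Tri) : proj i p i = 0 := if_pos rfl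

theorem proj_of_ne {i j : Fin 3} (h : j ≠ i) (p : Tri) : proj i p j = p j + p i / 2 := if_neg h

theorem continuous_proj (i : Fin 3) : Continuous (proj i) := by
  refine Continuous.subtype_mk (continuous_pi fun j => ?_) _
  by_cases h : j = i
  · simp only [h, if_true]; exact continuous_const
  · simp only [h, if_false]
    exact (continuous_coord j).add ((continuous_coord i).div_const 2)

theorem proj_mem {i : Fin 3} {p : Tri} (hp : p ∈ collar i) : proj i p ∈ side i :=
  ⟨proj_self i p, fun j hj => by
    rw [proj_of_ne hj]
    have h1 := nonneg p i
    have h2 := hp j hj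
    linarith⟩

theorem proj_eq_self {i : Fin 3} {p : Tri} (hp : p ∈ side i) : proj i p = p := by
  ext j
  by_cases h : j = i
  · rw [h, proj_self, hp.1]
  · rw [proj_of_ne h, hp.1]; simp

theorem segment_self (p : Tri) (s : I) : segment p p s = p := by
  ext i; rw [segment_coord]; ring

end Tri

namespace IdealTriangulation

variable {X : Type*} [TopologicalSpace X] [ChartedSpace (EuclideanHalfSpace 2) X]
  {S : MarkedSurface X} (τ : IdealTriangulation S)

/-- The characteristic map of a triangle without its vertices. -/
def chartMap (t : Fin τ.num) : C({p : Tri // p.NotVertex}, S.Complement) :=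
  ⟨fun p => ⟨τ.chart t p.1, τ.notMem_of_ne_vertex p.2⟩, by fun_prop⟩

/-- The image of a straight segment in a triangle. -/
def straight (t : Fin τ.num) {p q : Tri} (hp : p.NotVertex) (hq : q.NotVertex)
    {x y : S.Complement} (hx : τ.chart t p = x) (hy : τ.chart t q = y) : Path x y where
  toFun s := ⟨τ.chart t (Tri.segment p q s),
    τ.notMem_of_ne_vertex (Tri.notVertex_segment hp hq s)⟩
  continuous_toFun := by fun_prop
  source' := Subtype.ext (by simpa using hx)
  target' := Subtype.ext (by simpa using hy)

/-- The class of the image of a straight segment in a triangle. -/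
def seg (t : Fin τ.num) {p q : Tri} (hp : p.NotVertex) (hq : q.NotVertex)
    {x y : S.Complement} (hx : τ.chart t p = x) (hy : τ.chart t q = y) : S.obj x ⟶ S.obj y :=
  S.cls (τ.straight t hp hq hx hy)

theorem homotopic_straight (t : Fin τ.num) {p q : Tri} (hp : p.NotVertex) (hq : q.NotVertex)
    {x y : S.Complement} (hx : τ.chart t p = x) (hy : τ.chart t q = y) (P : Path x y)
    (γ : I → Tri) (hγ : Continuous γ) (h0 : γ 0 = p) (h1 : γ 1 = q) (hv : ∀ s, (γ s).NotVertex)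
    (hP : ∀ s, (P s : X) = τ.chart t (γ s)) : P.Homotopic (τ.straight t hp hq hx hy) := by
  let a : Path (⟨p, hp⟩ : {p : Tri // p.NotVertex}) ⟨q, hq⟩ :=
    ⟨⟨fun s => ⟨γ s, hv s⟩, by fun_prop⟩, Subtype.ext h0, Subtype.ext h1⟩
  let b : Path (⟨p, hp⟩ : {p : Tri // p.NotVertex}) ⟨q, hq⟩ :=
    ⟨⟨fun s => ⟨Tri.segment p q s, Tri.notVertex_segment hp hq s⟩, by fun_prop⟩,
      Subtype.ext (by simp), Subtype.ext (by simp)⟩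
  have h := ((SimplyConnectedSpace.paths_homotopic a b).map (τ.chartMap t)).pathCast
    (x₂ := x) (x₃ := y) (Subtype.ext hx.symm) (Subtype.ext hy.symm)
  convert h using 1
  · ext s
    exact hP s
  · ext s
    rfl

theorem cls_eq_seg (t : Fin τ.num) {p q : Tri} (hp : p.NotVertex) (hq : q.NotVertex)
    {x y : S.Complement} (hx : τ.chart t p = x) (hy : τ.chart t q = y) (P : Path x y)
    (γ : I → Tri) (hγ : Continuous γ) (h0 : γ 0 = p) (h1 : γ 1 = q) (hv : ∀ s, (γ s).NotVertex)
    (hP : ∀ s, (P s : X) = τ.chart t (γ s)) : S.cls P = τ.seg t hp hq hx hy :=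
  S.cls_congr (τ.homotopic_straight t hp hq hx hy P γ hγ h0 h1 hv hP)

section seg

variable {t : Fin τ.num} {p q r : Tri} (hp : p.NotVertex) (hq : q.NotVertex) (hr : r.NotVertex)
  {x y z : S.Complement} (hx : τ.chart t p = x) (hy : τ.chart t q = y) (hz : τ.chart t r = z)

theorem seg_trans : τ.seg t hp hq hx hy ≫ τ.seg t hq hr hy hz = τ.seg t hp hr hx hz := by
  rw [seg, seg, ← S.cls_trans]
  refine τ.cls_eq_seg t hp hr hx hz _ ((Tri.segment p q).trans (Tri.segment q r))
    (Path.continuous _) (by simp) (by simp) (fun s => ?_) fun s => ?_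
  · rw [Path.trans_apply]
    split_ifs
    · exact Tri.notVertex_segment hp hq _
    · exact Tri.notVertex_segment hq hr _
  · rw [Path.trans_apply, Path.trans_apply]
    split_ifs <;> rfl

theorem seg_trans_assoc {w : S.OrbGroupoid} (k : S.obj z ⟶ w) :
    τ.seg t hp hq hx hy ≫ τ.seg t hq hr hy hz ≫ k = τ.seg t hp hr hx hz ≫ k := by
  rw [← Category.assoc, seg_trans]

theorem seg_self : τ.seg t hp hp hx hx = 𝟙 (S.obj x) := by
  rw [← S.cls_refl]
  exact (τ.cls_eq_seg t hp hp hx hx (Path.refl x) (fun _ => p) continuous_const rfl rfl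
    (fun _ => hp) fun s => by simp [hx]).symm

theorem inv_seg : inv (τ.seg t hp hq hx hy) = τ.seg t hq hp hy hx := by
  symm
  apply IsIso.eq_inv_of_hom_inv_id
  rw [seg_trans, seg_self]

end seg

theorem collar_inj {t : Fin τ.num} {i : Fin 3} {p q : Tri} (hp : p ∈ Tri.collar i)
    (hq : q ∈ Tri.collar i) (h : τ.chart t p = τ.chart t q) : p = q := by
  rcases Tri.inner_or_side_of_collar hp with hp' | hp'
  · exact (τ.inner_eq hp' h).2
  rcases Tri.inner_or_side_of_collar hq with hq' | hq'
  · exact (τ.inner_eq hq' h.symm).2.symm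
  exact τ.side_inj t i hp' hq' h

/-- The closed collar of a side. -/
def _root_.Tri.closedCollar (i : Fin 3) : Set Tri := {p | ∀ j, p i ≤ p j}

theorem _root_.Tri.isClosed_closedCollar (i : Fin 3) : IsClosed (Tri.closedCollar i) := by
  have : Tri.closedCollar i = ⋂ j, {p : Tri | p i ≤ p j} := by
    ext p; rw [Set.mem_iInter]; rfl
  rw [this]
  exact isClosed_iInter fun j => isClosed_le (Tri.continuous_coord i) (Tri.continuous_coord j)

theorem _root_.Tri.collar_subset_closedCollar (i : Fin 3) :
    Tri.collar i ⊆ Tri.closedCollar i := fun p hp j => by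
  by_cases h : j = i
  · rw [h]
  · exact (hp j h).le

/-- The closed collar is compact and the collar is not. Within a star they agree, since each point
there is strictly nearest to one side. -/
theorem mem_collar_of_closedCollar {a : τ.Side} {t : Fin τ.num} {i : Fin 3} {p : Tri}
    (hp : p ∈ Tri.closedCollar i) (h : τ.chart t p ∈ τ.star a) : p ∈ Tri.collar i := by
  obtain ⟨k, hk, -⟩ := (τ.preimage_star a t).1 h
  by_cases hik : i = k
  · rwa [hik]
  · exact absurd (hk i hik) (not_lt.2 (hp k))

/-- A path in the star of an arc can be lifted to a collar, as long as it stays on its side. -/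
theorem exists_lift {a : τ.Side} {γ : I → X} (hγ : Continuous γ) (hs : ∀ s, γ s ∈ τ.star a)
    (t : Fin τ.num) (i : Fin 3) :
    ∃ (A : Set I) (lft : I → Tri), IsClosed A ∧
      (∀ s, s ∈ A ↔ ∃ p ∈ Tri.collar i, τ.chart t p = γ s) ∧ ContinuousOn lft A ∧
      ∀ s ∈ A, lft s ∈ Tri.collar i ∧ τ.chart t (lft s) = γ s := by
  have := S.hausdorff
  let A : Set I := γ ⁻¹' (τ.chart t '' Tri.closedCollar i)
  have hA : ∀ s, s ∈ A ↔ ∃ p ∈ Tri.collar i, τ.chart t p = γ s := fun s => by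
    constructor
    · rintro ⟨p, hp, h⟩
      exact ⟨p, τ.mem_collar_of_closedCollar hp (by rw [h]; exact hs s), h⟩
    · rintro ⟨p, hp, h⟩
      exact ⟨p, Tri.collar_subset_closedCollar i hp, h⟩
  have hcl : ∀ Z : Set Tri, IsClosed Z → IsClosed (γ ⁻¹' (τ.chart t '' (Z ∩ Tri.closedCollar i))) :=
    fun Z hZ => (((hZ.inter (Tri.isClosed_closedCollar i)).isCompact.image
      (τ.chart t).continuous).isClosed).preimage hγ
  have hlift : ∀ s, ∃ p, s ∈ A → p ∈ Tri.collar i ∧ τ.chart t p = γ s := fun s => by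
    by_cases h : s ∈ A
    · obtain ⟨p, hp⟩ := (hA s).1 h
      exact ⟨p, fun _ => hp⟩
    · exact ⟨Tri.bary, fun h' => absurd h' h⟩
  choose lft hl using hlift
  refine ⟨A, lft, ?_, hA, ?_, fun s hs => hl s hs⟩
  · simpa using hcl Set.univ isClosed_univ
  -- The chart is injective on the collar and sends closed subsets of the compact closed collar to
  -- closed sets, so the lift through it is continuous.
  · rw [continuousOn_iff_isClosed]
    refine fun Z hZ => ⟨_, hcl Z hZ, ?_⟩
    ext s
    constructor
    · rintro ⟨h1, h2⟩
      exact ⟨⟨lft s, ⟨h1, Tri.collar_subset_closedCollar i (hl s h2).1⟩, (hl s h2).2⟩, h2⟩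
    · rintro ⟨⟨p, ⟨hpZ, hp⟩, h⟩, h2⟩
      have hp' := τ.mem_collar_of_closedCollar hp (by rw [h]; exact hs s)
      have : p = lft s := τ.collar_inj hp' (hl s h2).1 (h.trans (hl s h2).2.symm)
      exact ⟨(this ▸ hpZ : lft s ∈ Z), h2⟩

theorem edge_subset_star {a : τ.Side} {x : X} (hx : x ∈ τ.edge a) : x ∈ τ.star a := by
  obtain ⟨p, hp, rfl⟩ := hx
  exact τ.mem_star_left (Tri.side_subset_collar _ hp)

/-- A path in an arc can be lifted to a side. -/
theorem exists_lift_side {t : Fin τ.num} {i : Fin 3} {γ : I → X} (hγ : Continuous γ)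
    (hs : ∀ s, γ s ∈ τ.edge (t, i)) :
    ∃ lft : I → Tri, Continuous lft ∧ ∀ s, lft s ∈ Tri.side i ∧ τ.chart t (lft s) = γ s := by
  obtain ⟨A, lft, -, hA, hc, hl⟩ := τ.exists_lift hγ (fun s => τ.edge_subset_star (hs s)) t i
  have hAu : A = Set.univ := by
    refine Set.eq_univ_of_forall fun s => (hA s).2 ?_
    obtain ⟨p, hp, h⟩ := hs s
    exact ⟨p, Tri.side_subset_collar i hp, h⟩
  subst hAu
  refine ⟨lft, continuousOn_univ.1 hc, fun s => ?_⟩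
  obtain ⟨p, hp, h⟩ := hs s
  obtain ⟨h1, h2⟩ := hl s (Set.mem_univ s)
  obtain rfl := τ.collar_inj (Tri.side_subset_collar i hp) h1 (h.trans h2.symm)
  exact ⟨hp, h2⟩

/-- Straight paths in an arc do not depend on the side which is used to represent it. -/
theorem seg_eq_seg_of_edge_eq {t u : Fin τ.num} {i k : Fin 3} (he : τ.edge (u, k) = τ.edge (t, i))
    {w₁ w₂ z₁ z₂ : Tri} (hw₁ : w₁ ∈ Tri.side k) (hw₂ : w₂ ∈ Tri.side k) (hz₁ : z₁ ∈ Tri.side i)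
    (hz₂ : z₂ ∈ Tri.side i) {x y : S.Complement} (h1 : τ.chart u w₁ = x) (h2 : τ.chart u w₂ = y)
    (h3 : τ.chart t z₁ = x) (h4 : τ.chart t z₂ = y) :
    τ.seg u (Tri.notVertex_of_side hw₁) (Tri.notVertex_of_side hw₂) h1 h2 =
      τ.seg t (Tri.notVertex_of_side hz₁) (Tri.notVertex_of_side hz₂) h3 h4 := by
  obtain ⟨lft, hc, hl⟩ := τ.exists_lift_side (t := t) (i := i)
    (γ := fun s => τ.chart u (Tri.segment w₁ w₂ s)) (by fun_prop) fun s => by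
      rw [← he]; exact ⟨_, Tri.side_segment hw₁ hw₂ s, rfl⟩
  refine τ.cls_eq_seg t _ _ h3 h4 _ lft hc ?_ ?_ (fun s => Tri.notVertex_of_side (hl s).1)
    fun s => (hl s).2.symm
  · refine τ.side_inj t i (hl 0).1 hz₁ ?_
    rw [(hl 0).2, h3]; simp [h1]
  · refine τ.side_inj t i (hl 1).1 hz₂ ?_
    rw [(hl 1).2, h4]; simp [h2]

/-- A position of a point in the star of an arc. -/
structure IsPos (a : τ.Side) (x : X) (u : Fin τ.num) (k : Fin 3) (q : Tri) : Prop where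
  side : (u, k) = a ∨ (u, k) = τ.bar a
  mem : q ∈ Tri.collar k
  eq : τ.chart u q = x

variable {τ}

theorem exists_isPos {a : τ.Side} {x : X} (hx : x ∈ τ.star a) : ∃ u k q, τ.IsPos a x u k q := by
  rcases hx with ⟨q, hq, rfl⟩ | ⟨q, hq, rfl⟩
  · exact ⟨_, _, q, Or.inl rfl, hq, rfl⟩
  · exact ⟨_, _, q, Or.inr rfl, hq, rfl⟩

theorem IsPos.edge_eq {a : τ.Side} {x : X} {u : Fin τ.num} {k : Fin 3} {q : Tri}
    (h : τ.IsPos a x u k q) : τ.edge (u, k) = τ.edge a := by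
  rcases h.side with h | h <;> rw [h]
  exact τ.edge_bar a

theorem IsPos.notVertex {a : τ.Side} {x : X} {u : Fin τ.num} {k : Fin 3} {q : Tri}
    (h : τ.IsPos a x u k q) : q.NotVertex := Tri.notVertex_of_collar h.mem

/-- A point has two positions only if it lies on the arc, and there the retraction is stationary; so
the retractions of the two collars fit together. -/
theorem IsPos.retract_eq {a : τ.Side} {x : X} {u u' : Fin τ.num} {k k' : Fin 3} {q q' : Tri}
    (h : τ.IsPos a x u k q) (h' : τ.IsPos a x u' k' q') (r : I) :
    τ.chart u (Tri.segment q (Tri.proj k q) r) = τ.chart u' (Tri.segment q' (Tri.proj k' q') r) := by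
  have heq := h.eq.trans h'.eq.symm
  rcases Tri.inner_or_side_of_collar h.mem with hq | hq
  · obtain ⟨rfl, rfl⟩ := τ.inner_eq hq heq
    obtain rfl := Tri.collar_disjoint h.mem h'.mem
    rfl
  rcases Tri.inner_or_side_of_collar h'.mem with hq' | hq'
  · obtain ⟨rfl, rfl⟩ := τ.inner_eq hq' heq.symm
    obtain rfl := Tri.collar_disjoint h.mem h'.mem
    rfl
  rw [Tri.proj_eq_self hq, Tri.proj_eq_self hq', Tri.segment_self, Tri.segment_self, heq]

/-- Both collars are pushed straight onto the arc. The times spent on a given side form a closed set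
on which the lift is continuous, and the two closed sets cover the interval. -/
theorem exists_retraction {a : τ.Side} {x y : S.Complement} (p : Path x y)
    (hp : ∀ s, (p s : X) ∈ τ.star a) :
    ∃ K : C(I × I, S.Complement), ∀ s r u k q, τ.IsPos a (p s) u k q →
      (K (r, s) : X) = τ.chart u (Tri.segment q (Tri.proj k q) r) := by
  choose u k q hpos using fun s => exists_isPos (hp s)
  let K : I × I → X := fun z => τ.chart (u z.2) (Tri.segment (q z.2) (Tri.proj (k z.2) (q z.2)) z.1)
  have hK : ∀ s r u' k' q', τ.IsPos a (p s) u' k' q' →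
      K (r, s) = τ.chart u' (Tri.segment q' (Tri.proj k' q') r) := fun s r u' k' q' h =>
    (hpos s).retract_eq h r
  have hpc : Continuous fun s => (p s : X) := by fun_prop
  have hcont : ∀ b : τ.Side, (b = a ∨ b = τ.bar a) → ∃ A : Set I, IsClosed A ∧
      (∀ s, s ∈ A ↔ ∃ q ∈ Tri.collar b.2, τ.chart b.1 q = p s) ∧
      ContinuousOn K (Prod.snd ⁻¹' A) := by
    intro b hb
    obtain ⟨A, lft, hA, hAiff, hc, hl⟩ := τ.exists_lift hpc hp b.1 b.2
    refine ⟨A, hA, hAiff, ?_⟩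
    have h1 : ContinuousOn (fun z : I × I => lft z.2) (Prod.snd ⁻¹' A) :=
      hc.comp continuousOn_snd fun z hz => hz
    have h2 : ContinuousOn (fun z : I × I =>
        τ.chart b.1 (Tri.segment (lft z.2) (Tri.proj b.2 (lft z.2)) z.1)) (Prod.snd ⁻¹' A) := by
      refine (τ.chart b.1).continuous.comp_continuousOn ?_
      exact Tri.continuous_segment.comp_continuousOn
        ((h1.prodMk ((Tri.continuous_proj b.2).comp_continuousOn h1)).prodMk continuousOn_fst)
    refine h2.congr fun z hz => ?_
    exact hK z.2 z.1 b.1 b.2 _ ⟨hb, (hl z.2 hz).1, (hl z.2 hz).2⟩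
  have hKc : Continuous K := by
    obtain ⟨A, hA, hAiff, hcA⟩ := hcont a (Or.inl rfl)
    obtain ⟨A', hA', hAiff', hcA'⟩ := hcont (τ.bar a) (Or.inr rfl)
    have h := hcA.union_of_isClosed hcA' (hA.preimage continuous_snd) (hA'.preimage continuous_snd)
    rw [← continuousOn_univ]
    convert h
    symm
    refine Set.eq_univ_of_forall fun z => ?_
    rcases hp z.2 with ⟨q, hq, h⟩ | ⟨q, hq, h⟩
    · exact Or.inl ((hAiff _).2 ⟨q, hq, h⟩)
    · exact Or.inr ((hAiff' _).2 ⟨q, hq, h⟩)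
  refine ⟨⟨fun z => ⟨K z, τ.notMem_of_ne_vertex ?_⟩, by fun_prop⟩, hK⟩
  exact Tri.notVertex_segment (hpos z.2).notVertex
    (Tri.notVertex_of_side (Tri.proj_mem (hpos z.2).mem)) z.1

/-- A path in the star of an arc is determined by its end points, up to homotopy: it can be
replaced by two straight paths via a point of the arc. -/
theorem cls_star {a : τ.Side} {x y c : S.Complement} (p : Path x y)
    (hp : ∀ s, (p s : X) ∈ τ.star a) {u u' : Fin τ.num} {k k' : Fin 3} {q q' r r' : Tri}
    (hq : τ.IsPos a x u k q) (hq' : τ.IsPos a y u' k' q') (hr : r ∈ Tri.side k)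
    (hr' : r' ∈ Tri.side k') (hc : τ.chart u r = c) (hc' : τ.chart u' r' = c) :
    S.cls p = τ.seg u hq.notVertex (Tri.notVertex_of_side hr) hq.eq hc ≫
      τ.seg u' (Tri.notVertex_of_side hr') hq'.notVertex hc' hq'.eq := by
  obtain ⟨K, hK⟩ := exists_retraction p hp
  have hx : τ.IsPos a (p 0) u k q := by simpa using hq
  have hy : τ.IsPos a (p 1) u' k' q' := by simpa using hq'
  have hz := Tri.proj_mem hq.mem
  have hz' := Tri.proj_mem hq'.mem
  let x₁ : S.Complement := K (1, 0)
  let y₁ : S.Complement := K (1, 1)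
  have hx₁ : τ.chart u (Tri.proj k q) = x₁ := by rw [hK 0 1 u k q hx]; simp
  have hy₁ : τ.chart u' (Tri.proj k' q') = y₁ := by rw [hK 1 1 u' k' q' hy]; simp
  let bottom : Path x₁ y₁ := ⟨⟨fun s => K (1, s), by fun_prop⟩, rfl, rfl⟩
  let left := τ.straight u hq.notVertex (Tri.notVertex_of_side hz) hq.eq hx₁
  let right := τ.straight u' hq'.notVertex (Tri.notVertex_of_side hz') hq'.eq hy₁
  -- The retraction is a square with the given path on top and a path inside the arc at the bottom;
  -- the latter can be straightened in a side.
  have hsq := S.cls_eq_of_trans_eq (square_homotopic K p right left bottom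
    (fun s => by
      obtain ⟨v, l, w, hpos⟩ := exists_isPos (hp s)
      refine Subtype.ext ?_
      rw [hK s 0 v l w hpos, ← hpos.eq]; simp)
    (fun s => Subtype.ext (hK 1 s u' k' q' hy)) (fun s => Subtype.ext (hK 0 s u k q hx))
    fun s => rfl)
  have hbottom : S.cls bottom = τ.seg u (Tri.notVertex_of_side hz) (Tri.notVertex_of_side hr) hx₁ hc ≫
      τ.seg u' (Tri.notVertex_of_side hr') (Tri.notVertex_of_side hz') hc' hy₁ := by
    obtain ⟨lft, hlc, hl⟩ := τ.exists_lift_side (t := u) (i := k)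
      (γ := fun s => (K (1, s) : X)) (by fun_prop) fun s => by
        obtain ⟨v, l, w, hpos⟩ := exists_isPos (hp s)
        rw [hK s 1 v l w hpos, hq.edge_eq, ← hpos.edge_eq]
        exact ⟨_, by simpa using Tri.proj_mem hpos.mem, rfl⟩
    have h1 := τ.cls_eq_seg u (Tri.notVertex_of_side hz) (Tri.notVertex_of_side (hl 1).1) hx₁
      (hl 1).2 bottom lft hlc
      (τ.side_inj u k (hl 0).1 hz ((hl 0).2.trans hx₁.symm)) rfl
      (fun s => Tri.notVertex_of_side (hl s).1) fun s => (hl s).2.symm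
    rw [h1, ← τ.seg_trans _ (Tri.notVertex_of_side hr) _ hx₁ hc (hl 1).2]
    congr 1
    exact τ.seg_eq_seg_of_edge_eq (hq.edge_eq.trans hq'.edge_eq.symm) hr (hl 1).1 hr' hz' hc _ hc' _
  have hright : S.cls right = inv (τ.seg u' (Tri.notVertex_of_side hz') hq'.notVertex hy₁ hq'.eq) := by
    rw [τ.inv_seg]; rfl
  rw [hright, hbottom] at hsq
  rw [← cancel_mono (inv (τ.seg u' (Tri.notVertex_of_side hz') hq'.notVertex hy₁ hq'.eq)), hsq]
  change τ.seg u hq.notVertex (Tri.notVertex_of_side hz) hq.eq hx₁ ≫ _ = _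
  rw [τ.inv_seg, τ.seg_trans_assoc, Category.assoc, τ.seg_trans]

end IdealTriangulation

end


noncomputable section

/-! The corner of a self-folded triangle at its puncture -/

namespace Tri

/-- The point at a given distance from a vertex on the way to another vertex. -/
def ray (k l : Fin 3) (u : I) : Tri := segment (stdSimplex.vertex k) (stdSimplex.vertex l) u

theorem ray_target {k l : Fin 3} (h : k ≠ l) (u : I) : ray k l u l = u := by
  rw [ray, segment_coord, vertex_of_ne h.symm, vertex_self]; ring

theorem ray_source {k l : Fin 3} (h : k ≠ l) (u : I) : ray k l u k = 1 - u := by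
  rw [ray, segment_coord, vertex_of_ne h, vertex_self]; ring

theorem ray_other {k l m : Fin 3} (hk : m ≠ k) (hl : m ≠ l) (u : I) : ray k l u m = 0 := by
  rw [ray, segment_coord, vertex_of_ne hk, vertex_of_ne hl]; ring

@[simp] theorem ray_zero (k l : Fin 3) : ray k l 0 = stdSimplex.vertex k := Path.source _

@[simp] theorem ray_one (k l : Fin 3) : ray k l 1 = stdSimplex.vertex l := Path.target _

theorem continuous_ray (k l : Fin 3) : Continuous (ray k l) := Path.continuous _

theorem ray_mem_side {i j k : Fin 3} (hij : i ≠ j) (hki : k ≠ i) (hkj : k ≠ j) {u : I}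
    (h0 : 0 < u) (h1 : u < 1) : ray k j u ∈ side i := by
  have h0' : (0 : ℝ) < u := h0
  have h1' : (u : ℝ) < 1 := h1
  refine ⟨ray_other hki.symm hij u, fun l hl => ?_⟩
  rcases eq_or_of_ne hki hkj hij l with rfl | rfl | rfl
  · rw [ray_source hkj]; linarith
  · exact absurd rfl hl
  · rwa [ray_target hkj]

theorem eq_ray {i j k : Fin 3} (hij : i ≠ j) (hki : k ≠ i) (hkj : k ≠ j) {p : Tri}
    (hp : p ∈ side i) : ∃ u : I, p = ray k j u ∧ 0 < u ∧ u < 1 ∧ (u : ℝ) = p j := by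
  have hs := add_add_eq_one p hki hkj hij
  have hk := hp.2 k hki
  have hj := hp.2 j hij.symm
  refine ⟨⟨p j, nonneg p j, le_one p j⟩, ?_, hj, ?_, rfl⟩
  · refine ext_of_ne hij ?_ ?_
    · rw [hp.1, ray_other hki.symm hij]
    · rw [ray_target hkj]
  · change p j < 1
    rw [hp.1] at hs; linarith

theorem exists_inner_near_vertex (l : Fin 3) {O : Set Tri} (hO : O ∈ 𝓝 (stdSimplex.vertex l)) :
    ∃ p ∈ inner, p ∈ O := by
  let γ : I → Tri := fun u => segment (stdSimplex.vertex l) bary u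
  have hγ : Continuous γ := Path.continuous _
  have h0 : γ 0 = stdSimplex.vertex l := Path.source _
  have h1 : γ ⁻¹' O ∈ 𝓝 0 := hγ.continuousAt.preimage_mem_nhds (by rwa [h0])
  have h2 : (0 : I) ∈ closure (Set.Ioo 0 1) := by
    rw [closure_Ioo zero_ne_one]; exact ⟨le_rfl, zero_le_one⟩
  obtain ⟨u, hu, hu0, hu1⟩ := mem_closure_iff_nhds.1 h2 _ h1
  refine ⟨γ u, fun m => ?_, hu⟩
  have h3 : (0 : ℝ) < u := hu0
  have h4 : (u : ℝ) < 1 := hu1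
  have h5 := nonneg (stdSimplex.vertex l) m
  change 0 < (1 - (u : ℝ)) * (stdSimplex.vertex l : Tri) m + u * (1 / 3)
  have h6 : 0 ≤ (1 - (u : ℝ)) * (stdSimplex.vertex l : Tri) m := mul_nonneg (by linarith) h5
  linarith

end Tri

namespace IdealTriangulation

variable {X : Type*} [TopologicalSpace X] [ChartedSpace (EuclideanHalfSpace 2) X]
  {S : MarkedSurface X} {τ : IdealTriangulation S}

/-- Interior parameters are matched because the open arcs coincide. The two ends follow by closure,
as the other ray has compact image. -/
theorem exists_ray_eq {t : Fin τ.num} {i j k : Fin 3} (hij : i ≠ j) (hki : k ≠ i) (hkj : k ≠ j)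
    (he : τ.edge (t, i) = τ.edge (t, j)) (u : I) :
    ∃ v, τ.chart t (Tri.ray k j v) = τ.chart t (Tri.ray k i u) := by
  have := S.hausdorff
  have hc : ∀ l, Continuous fun v => τ.chart t (Tri.ray k l v) := fun l =>
    (τ.chart t).continuous.comp (Tri.continuous_ray k l)
  let A : Set I := (fun v => τ.chart t (Tri.ray k i v)) ⁻¹'
    Set.range fun v => τ.chart t (Tri.ray k j v)
  have hA : IsClosed A := (isCompact_range (hc j)).isClosed.preimage (hc i)
  have h1 : Set.Ioo (0 : I) 1 ⊆ A := by
    rintro v ⟨hv0, hv1⟩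
    have h2 : τ.chart t (Tri.ray k i v) ∈ τ.edge (t, i) := by
      rw [he]; exact ⟨_, Tri.ray_mem_side hij.symm hkj hki hv0 hv1, rfl⟩
    obtain ⟨p, hp, h⟩ := h2
    obtain ⟨w, rfl, -⟩ := Tri.eq_ray hij hki hkj hp
    exact ⟨w, h⟩
  have h2 := closure_minimal h1 hA
  rw [closure_Ioo zero_ne_one] at h2
  exact h2 ⟨u.2.1, u.2.2⟩

/-- A corner of a self-folded triangle between its two folded sides `i` and `j`, at the
puncture `P`. -/
structure FoldedCorner (τ : IdealTriangulation S) (t : Fin τ.num) (i j k : Fin 3) (P : X) :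
    Prop where
  hij : i ≠ j
  hki : k ≠ i
  hkj : k ≠ j
  edge_eq : τ.edge (t, i) = τ.edge (t, j)
  vertex : τ.chart t (stdSimplex.vertex k) = P
  ne : τ.chart t (stdSimplex.vertex i) ≠ P
  mem : P ∈ S.punctures

namespace FoldedCorner

variable {t : Fin τ.num} {i j k : Fin 3} {P : X}

theorem not_vertex_eq (c : τ.FoldedCorner t i j k P) {u : I} (h0 : 0 < u) (h1 : u < 1)
    (l : Fin 3) : τ.chart t (Tri.ray k j u) ≠ τ.chart t (stdSimplex.vertex l) := fun h =>
  τ.notVertex_of_eq (Tri.notVertex_of_side (Tri.ray_mem_side c.hij c.hki c.hkj h0 h1)) h l rfl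

/-- The end of one folded side at vertex `i` is matched by some point of the other side. It must be
an end of that side, since interior points do not map to vertices; if vertex `j` also went to `P`,
both ends would be `P`. -/
theorem ne' (c : τ.FoldedCorner t i j k P) : τ.chart t (stdSimplex.vertex j) ≠ P := by
  intro h
  obtain ⟨v, hv⟩ := exists_ray_eq c.hij c.hki c.hkj c.edge_eq 1
  rw [Tri.ray_one] at hv
  rcases (unitInterval.nonneg' (t := v)).eq_or_lt with rfl | h0
  · rw [Tri.ray_zero, c.vertex] at hv
    exact c.ne hv.symm
  rcases (unitInterval.le_one' (t := v)).eq_or_lt with rfl | h1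
  · rw [Tri.ray_one, h] at hv
    exact c.ne hv.symm
  · exact c.not_vertex_eq h0 h1 i hv

theorem symm (c : τ.FoldedCorner t i j k P) : τ.FoldedCorner t j i k P :=
  ⟨c.hij.symm, c.hkj, c.hki, c.edge_eq.symm, c.vertex, c.ne', c.mem⟩

theorem ray_injective (c : τ.FoldedCorner t i j k P) :
    Function.Injective fun u => τ.chart t (Tri.ray k j u) := by
  have key : ∀ u v : I, u < v → τ.chart t (Tri.ray k j u) ≠ τ.chart t (Tri.ray k j v) := by
    intro u v huv h
    rcases (unitInterval.nonneg' (t := u)).eq_or_lt with rfl | h0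
    · rcases (unitInterval.le_one' (t := v)).eq_or_lt with rfl | h1
      · rw [Tri.ray_zero, Tri.ray_one, c.vertex] at h
        exact c.ne' h.symm
      · rw [Tri.ray_zero] at h
        exact c.not_vertex_eq huv h1 k h.symm
    · have hu1 : u < 1 := huv.trans_le unitInterval.le_one'
      rcases (unitInterval.le_one' (t := v)).eq_or_lt with rfl | h1
      · rw [Tri.ray_one] at h
        exact c.not_vertex_eq h0 hu1 j h
      · have h2 := τ.side_inj t i (Tri.ray_mem_side c.hij c.hki c.hkj h0 hu1)
          (Tri.ray_mem_side c.hij c.hki c.hkj (h0.trans huv) h1) h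
        have h3 := Tri.ray_target c.hkj u
        rw [h2, Tri.ray_target c.hkj] at h3
        exact huv.ne (Subtype.ext h3.symm)
  intro u v h
  rcases lt_trichotomy u v with h' | h' | h'
  · exact absurd h (key u v h')
  · exact h'
  · exact absurd h.symm (key v u h')

/-- The two folded sides are identified by an increasing homeomorphism. -/
theorem exists_gluing (c : τ.FoldedCorner t i j k P) :
    ∃ g : I → I, Continuous g ∧ StrictMono g ∧ g 0 = 0 ∧ Function.Surjective g ∧
      ∀ u, τ.chart t (Tri.ray k i (g u)) = τ.chart t (Tri.ray k j u) := by
  have := S.hausdorff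
  choose g hg using exists_ray_eq c.symm.hij c.symm.hki c.symm.hkj c.symm.edge_eq
  have hci : Continuous fun u => τ.chart t (Tri.ray k i u) :=
    (τ.chart t).continuous.comp (Tri.continuous_ray k i)
  have hcj : Continuous fun u => τ.chart t (Tri.ray k j u) :=
    (τ.chart t).continuous.comp (Tri.continuous_ray k j)
  have hgc : Continuous g := by
    rw [(hci.isClosedEmbedding c.symm.ray_injective).isEmbedding.continuous_iff]
    exact hcj.congr fun u => (hg u).symm
  have hginj : Function.Injective g := fun u v h => by
    refine c.ray_injective ?_
    change τ.chart t (Tri.ray k j u) = τ.chart t (Tri.ray k j v)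
    rw [← hg u, ← hg v, h]
  -- Both rays start at `P` and are injective, so the gluing fixes the start; this forces it to
  -- increase rather than decrease.
  have hg0 : g 0 = 0 := by
    refine c.symm.ray_injective ?_
    change τ.chart t (Tri.ray k i (g 0)) = τ.chart t (Tri.ray k i 0)
    rw [hg 0, Tri.ray_zero, Tri.ray_zero]
  refine ⟨g, hgc, hgc.strictMono_of_inj_boundedOrder ?_ hginj, hg0, fun v => ?_, hg⟩
  · change g 0 ≤ g 1
    rw [hg0]; exact unitInterval.nonneg'
  · obtain ⟨u, hu⟩ := exists_ray_eq c.hij c.hki c.hkj c.edge_eq v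
    refine ⟨u, c.symm.ray_injective ?_⟩
    exact (hg u).trans hu

/-- The points of the triangle which are separated from the opposite side by the segment between
two points on the sides at a vertex. -/
def _root_.Tri.cut (i j : Fin 3) (α β : ℝ) : Set Tri := {p | β * p j + α * p i < α * β}

theorem _root_.Tri.isOpen_cut (i j : Fin 3) (α β : ℝ) : IsOpen (Tri.cut i j α β) :=
  isOpen_lt (((Tri.continuous_coord j).const_mul β).add ((Tri.continuous_coord i).const_mul α))
    continuous_const

/-- A matching pair of points on the folded sides, and the gluing of these sides. -/
structure Gluing (c : τ.FoldedCorner t i j k P) (α β : I) (g : I → I) : Prop where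
  cont : Continuous g
  mono : StrictMono g
  zero : g 0 = 0
  surj : Function.Surjective g
  glue : ∀ u, τ.chart t (Tri.ray k i (g u)) = τ.chart t (Tri.ray k j u)
  map : g α = β
  pos : 0 < α
  lt_one : α < 1
  pos' : 0 < β
  lt_one' : β < 1

variable {c : τ.FoldedCorner t i j k P} {α β : I} {g : I → I}

theorem Gluing.pos_real (G : c.Gluing α β g) : (0 : ℝ) < α := G.pos

theorem Gluing.pos_real' (G : c.Gluing α β g) : (0 : ℝ) < β := G.pos'

theorem Gluing.lt_real (G : c.Gluing α β g) : (α : ℝ) < 1 := G.lt_one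

theorem Gluing.lt_real' (G : c.Gluing α β g) : (β : ℝ) < 1 := G.lt_one'

/-- The bounding line meets the two folded sides at the parameters `α` and `β`. Since both are below
`1`, the region avoids the opposite side and the other two vertices. -/
theorem Gluing.cut_cases (G : c.Gluing α β g) {p : Tri} (hp : β * p j + α * p i ≤ α * β) :
    p = stdSimplex.vertex k ∨ p.NotVertex ∧ (p ∈ Tri.inner ∨ p ∈ Tri.side i ∨ p ∈ Tri.side j) := by
  have hα := G.pos_real
  have hβ := G.pos_real'
  have hα1 := G.lt_real
  have hβ1 := G.lt_real'
  by_cases hpv : p.NotVertex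
  · right
    refine ⟨hpv, ?_⟩
    rcases Tri.inner_or_side hpv with h | ⟨l, hl⟩
    · exact Or.inl h
    · rcases Tri.eq_or_of_ne c.hki c.hkj c.hij l with rfl | rfl | rfl
      · exfalso
        have hs := Tri.add_add_eq_one p c.hki c.hkj c.hij
        have hi := hl.2 i c.hki.symm
        have hj := hl.2 j c.hkj.symm
        rw [hl.1] at hs
        have h1 : β * p j ≥ α * β * p j := by
          have := mul_le_mul_of_nonneg_right hα1.le (mul_pos hβ hj).le
          linarith
        have h2 : α * p i > α * β * p i := by
          have := mul_lt_mul_of_pos_right hβ1 (mul_pos hα hi)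
          linarith
        have h3 : (α * β * p j + α * β * p i : ℝ) = α * β := by
          rw [← mul_add]; rw [show p j + p i = 1 by linarith, mul_one]
        linarith
      · exact Or.inr (Or.inl hl)
      · exact Or.inr (Or.inr hl)
  · left
    simp only [Tri.NotVertex, not_forall, not_not] at hpv
    obtain ⟨l, rfl⟩ := hpv
    rcases Tri.eq_or_of_ne c.hki c.hkj c.hij l with rfl | rfl | rfl
    · rfl
    · rw [Tri.vertex_self, Tri.vertex_of_ne c.hij.symm] at hp
      nlinarith
    · rw [Tri.vertex_self, Tri.vertex_of_ne c.hij] at hp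
      nlinarith

theorem Gluing.side_mem_cut_iff (G : c.Gluing α β g) (u : I) :
    Tri.ray k j u ∈ Tri.cut i j α β ↔ u < α := by
  have hβ := G.pos_real'
  change (β : ℝ) * Tri.ray k j u j + α * Tri.ray k j u i < α * β ↔ (u : ℝ) < α
  rw [Tri.ray_target c.hkj, Tri.ray_other c.hki.symm c.hij, mul_zero, add_zero, mul_comm,
    mul_lt_mul_iff_left₀ hβ]

theorem Gluing.side_mem_cut_iff' (G : c.Gluing α β g) (u : I) :
    Tri.ray k i u ∈ Tri.cut i j α β ↔ u < β := by
  have hα := G.pos_real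
  change (β : ℝ) * Tri.ray k i u j + α * Tri.ray k i u i < α * β ↔ (u : ℝ) < β
  rw [Tri.ray_target c.hki, Tri.ray_other c.hkj.symm c.hij.symm, mul_zero, zero_add,
    mul_lt_mul_iff_right₀ hα]

theorem bar_eq (c : τ.FoldedCorner t i j k P) : τ.bar (t, i) = (t, j) :=
  (τ.eq_bar_of_ne c.edge_eq.symm fun h => c.hij (Prod.ext_iff.1 h).2.symm).symm

/-- The cut is saturated away from its vertex: `g` is increasing and takes `α` to `β`, so the parts
of the two folded sides inside the cut correspond under the gluing. -/
theorem Gluing.preimage_cut (G : c.Gluing α β g) {u : Fin τ.num} {p q : Tri}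
    (hq : q ∈ Tri.cut i j α β) (hqv : q.NotVertex) (h : τ.chart t q = τ.chart u p) :
    u = t ∧ p ∈ Tri.cut i j α β ∧ p.NotVertex := by
  rcases G.cut_cases (le_of_lt hq) with rfl | ⟨-, hq' | hq' | hq'⟩
  · exact absurd rfl (hqv k)
  · obtain ⟨rfl, rfl⟩ := τ.inner_eq hq' h
    exact ⟨rfl, hq, hqv⟩
  · obtain ⟨m, hm, h1⟩ := τ.side_of_eq hq' h
    rw [c.bar_eq] at h1
    rcases h1 with h1 | h1 <;> obtain ⟨rfl, rfl⟩ := Prod.ext_iff.1 h1 <;>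
      refine ⟨rfl, ?_, Tri.notVertex_of_side hm⟩
    · rwa [← τ.side_inj _ _ hq' hm h]
    · obtain ⟨v, rfl, -⟩ := Tri.eq_ray c.hij c.hki c.hkj hq'
      obtain ⟨w, rfl, -⟩ := Tri.eq_ray c.hij.symm c.hkj c.hki hm
      rw [G.side_mem_cut_iff] at hq
      rw [G.side_mem_cut_iff', ← G.map]
      have h2 : g v = w := c.symm.ray_injective ((G.glue v).trans h)
      rw [← h2]
      exact G.mono hq
  · obtain ⟨m, hm, h1⟩ := τ.side_of_eq hq' h
    rw [c.symm.bar_eq] at h1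
    rcases h1 with h1 | h1 <;> obtain ⟨rfl, rfl⟩ := Prod.ext_iff.1 h1 <;>
      refine ⟨rfl, ?_, Tri.notVertex_of_side hm⟩
    · rwa [← τ.side_inj _ _ hq' hm h]
    · obtain ⟨v, rfl, -⟩ := Tri.eq_ray c.hij c.hki c.hkj hm
      obtain ⟨w, rfl, -⟩ := Tri.eq_ray c.hij.symm c.hkj c.hki hq'
      rw [G.side_mem_cut_iff', ← G.map] at hq
      rw [G.side_mem_cut_iff]
      have h2 : g v = w := c.symm.ray_injective ((G.glue v).trans h.symm)
      rw [← h2] at hq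
      exact G.mono.lt_iff_lt.1 hq

theorem vertex_mem_cut (G : c.Gluing α β g) : stdSimplex.vertex k ∈ Tri.cut i j α β := by
  change (β : ℝ) * _ + α * _ < _
  rw [Tri.vertex_of_ne c.hki.symm, Tri.vertex_of_ne c.hkj.symm]
  have := mul_pos G.pos_real G.pos_real'
  linarith

theorem isOpen_image_cut_sdiff (G : c.Gluing α β g) :
    IsOpen (τ.chart t '' (Tri.cut i j α β ∩ {p | p.NotVertex})) := by
  refine τ.isOpen_of_preimage fun u => ?_
  by_cases hu : u = t
  · subst hu
    have hopen : IsOpen {p : Tri | p.NotVertex} := by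
      have : {p : Tri | p.NotVertex} = ⋂ l, {p | p l < 1} := by
        ext p; rw [Set.mem_iInter]; exact Tri.notVertex_iff
      rw [this]
      exact isOpen_iInter_of_finite fun l => isOpen_lt (Tri.continuous_coord l) continuous_const
    convert (Tri.isOpen_cut i j α β).inter hopen
    ext p
    constructor
    · rintro ⟨q, ⟨hq, hqv⟩, h⟩
      exact (G.preimage_cut hq hqv h).2
    · exact fun hp => ⟨p, hp, rfl⟩
  · convert isOpen_empty
    rw [Set.eq_empty_iff_forall_notMem]
    rintro p ⟨q, ⟨hq, hqv⟩, h⟩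
    exact hu (G.preimage_cut hq hqv h).1

/-- The corner of the self-folded triangle is the only corner at its puncture. -/
theorem corner_unique (G : c.Gluing α β g) {u : Fin τ.num} {l : Fin 3}
    (h : τ.chart u (stdSimplex.vertex l) = P) : u = t ∧ l = k := by
  have := S.hausdorff
  by_cases hu : u = t
  · subst hu
    refine ⟨rfl, ?_⟩
    rcases Tri.eq_or_of_ne c.hki c.hkj c.hij l with rfl | rfl | rfl
    · rfl
    · exact absurd h c.ne
    · exact absurd h c.ne'
  exfalso
  let f : Tri → ℝ := fun p => β * p j + α * p i
  have hf : Continuous f :=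
    ((Tri.continuous_coord j).const_mul _).add ((Tri.continuous_coord i).const_mul _)
  have hB : IsClosed (τ.chart t '' {p | f p ≤ α * β}) :=
    ((isClosed_le hf continuous_const).isCompact.image (τ.chart t).continuous).isClosed
  have hC : IsClosed (τ.chart t '' {p | f p = α * β}) :=
    ((isClosed_eq hf continuous_const).isCompact.image (τ.chart t).continuous).isClosed
  have hPC : P ∉ τ.chart t '' {p | f p = α * β} := by
    rintro ⟨p, hp, hpP⟩
    rcases G.cut_cases (le_of_eq hp) with rfl | ⟨hv, -⟩
    · exact (vertex_mem_cut G).ne hp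
    · exact τ.mem_verts_iff.1 (show τ.chart t p ∈ τ.verts from hpP ▸ Or.inr c.mem) hv
  -- As `W` avoids the bounding segment, `W` without `P` splits into the open cut and the complement
  -- of the closed cut. A second corner at `P`, in another triangle, would make both parts non-empty
  -- and contradict connectedness.
  obtain ⟨W, hWo, hPW, hWC, hconn⟩ := exists_punctured_connected_nhds_of_interior
    (S.punctures_subset c.mem) (hC.isOpen_compl.mem_nhds hPC)
  have hcover : W \ {P} ⊆ τ.chart t '' (Tri.cut i j α β ∩ {p | p.NotVertex}) ∪
      (τ.chart t '' {p | f p ≤ α * β})ᶜ := by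
    rintro z ⟨hzW, hzP⟩
    by_cases hz : z ∈ τ.chart t '' {p | f p ≤ α * β}
    · left
      obtain ⟨p, hp, rfl⟩ := hz
      have hlt : f p < α * β := lt_of_le_of_ne hp fun h' => hWC hzW ⟨p, h', rfl⟩
      refine ⟨p, ⟨hlt, ?_⟩, rfl⟩
      rcases G.cut_cases hp with rfl | ⟨hv, -⟩
      · exact absurd c.vertex hzP
      · exact hv
    · exact Or.inr hz
  have hin : (W \ {P} ∩ τ.chart t '' (Tri.cut i j α β ∩ {p | p.NotVertex})).Nonempty := by
    have hO : τ.chart t ⁻¹' W ∩ Tri.cut i j α β ∈ 𝓝 (stdSimplex.vertex k) :=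
      ((hWo.preimage (τ.chart t).continuous).inter (Tri.isOpen_cut i j α β)).mem_nhds
        ⟨by rw [Set.mem_preimage, c.vertex]; exact hPW, vertex_mem_cut G⟩
    obtain ⟨p, hp, hpW, hpc⟩ := Tri.exists_inner_near_vertex k hO
    refine ⟨τ.chart t p, ⟨hpW, fun h' => ?_⟩, p, ⟨hpc, Tri.notVertex_of_inner hp⟩, rfl⟩
    exact τ.notVertex_of_eq (Tri.notVertex_of_inner hp)
      ((Set.mem_singleton_iff.1 h').trans c.vertex.symm) k rfl
  have hout : (W \ {P} ∩ (τ.chart t '' {p | f p ≤ α * β})ᶜ).Nonempty := by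
    have hO : τ.chart u ⁻¹' W ∈ 𝓝 (stdSimplex.vertex l) :=
      (hWo.preimage (τ.chart u).continuous).mem_nhds (by rw [Set.mem_preimage, h]; exact hPW)
    obtain ⟨p, hp, hpW⟩ := Tri.exists_inner_near_vertex l hO
    refine ⟨τ.chart u p, ⟨hpW, fun h' => ?_⟩, ?_⟩
    · exact τ.notVertex_of_eq (Tri.notVertex_of_inner hp)
        ((Set.mem_singleton_iff.1 h').trans h.symm) l rfl
    · rintro ⟨q, -, hq⟩
      exact hu (τ.inner_eq hp hq.symm).1
  obtain ⟨z, -, hz1, hz2⟩ := hconn _ _ (isOpen_image_cut_sdiff G) hB.isOpen_compl hcover hin hout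
  obtain ⟨p, hp, rfl⟩ := hz1
  exact hz2 ⟨p, le_of_lt (show f p < α * β from hp.1), rfl⟩

/-- Since no other corner touches `P`, the cut is saturated at its vertex too, and its image is
open. -/
theorem image_cut_mem_nhds (G : c.Gluing α β g) : τ.chart t '' Tri.cut i j α β ∈ 𝓝 P := by
  refine IsOpen.mem_nhds (τ.isOpen_of_preimage fun u => ?_) ⟨_, vertex_mem_cut G, c.vertex⟩
  have key : ∀ p q, q ∈ Tri.cut i j α β → τ.chart t q = τ.chart u p →
      u = t ∧ p ∈ Tri.cut i j α β := by
    intro p q hq h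
    rcases G.cut_cases (le_of_lt hq) with rfl | ⟨hqv, -⟩
    · have hv : ¬ p.NotVertex := fun hv => τ.notVertex_of_eq hv h.symm k rfl
      simp only [Tri.NotVertex, not_forall, not_not] at hv
      obtain ⟨l, rfl⟩ := hv
      obtain ⟨rfl, rfl⟩ := corner_unique G (h.symm.trans c.vertex)
      exact ⟨rfl, hq⟩
    · obtain ⟨h1, h2, -⟩ := G.preimage_cut hq hqv h
      exact ⟨h1, h2⟩
  by_cases hu : u = t
  · subst hu
    convert Tri.isOpen_cut i j α β
    ext p
    exact ⟨fun ⟨q, hq, h⟩ => (key p q hq h).2, fun hp => ⟨p, hp, rfl⟩⟩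
  · convert isOpen_empty
    rw [Set.eq_empty_iff_forall_notMem]
    rintro p ⟨q, hq, h⟩
    exact hu (key p q hq h).1

end FoldedCorner

end IdealTriangulation

end


noncomputable section

/-! Polar coordinates on the disc, and discs around punctures -/

/-- Polar coordinates on the closed unit disc. -/
def polar (z : I × I) : ℂ := (z.1 : ℝ) * Complex.exp (2 * Real.pi * (z.2 : ℝ) * Complex.I)

theorem continuous_polar : Continuous polar := by
  unfold polar
  fun_prop

theorem norm_polar (z : I × I) : ‖polar z‖ = z.1 := by
  have h : (2 * Real.pi * (z.2 : ℝ) * Complex.I : ℂ) = ((2 * Real.pi * (z.2 : ℝ) : ℝ) : ℂ) * Complex.I := by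
    push_cast; ring
  rw [polar, norm_mul, h, Complex.norm_exp_ofReal_mul_I, mul_one, Complex.norm_real,
    Real.norm_of_nonneg z.1.2.1]

theorem exists_polar {w : ℂ} (hw : w ∈ Metric.closedBall (0 : ℂ) 1) : ∃ z, polar z = w := by
  have hw' : ‖w‖ ≤ 1 := by simpa using hw
  -- The argument measured in full turns may be negative; its fractional part is an angle in the
  -- unit interval.
  let x := w.arg / (2 * Real.pi)
  refine ⟨(⟨‖w‖, norm_nonneg w, hw'⟩, ⟨Int.fract x, Int.fract_nonneg _, (Int.fract_lt_one _).le⟩), ?_⟩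
  have h1 : (2 * Real.pi * (Int.fract x : ℝ) * Complex.I : ℂ) =
      w.arg * Complex.I - (⌊x⌋ : ℤ) * (2 * Real.pi * Complex.I) := by
    rw [Int.fract]
    have h2 : (2 * Real.pi : ℂ) * ((x : ℝ) : ℂ) = w.arg := by
      rw [← Complex.ofReal_ofNat, ← Complex.ofReal_mul, ← Complex.ofReal_mul]
      congr 1
      exact mul_div_cancel₀ _ (by positivity)
    rw [← h2]
    push_cast; ring
  change (‖w‖ : ℂ) * Complex.exp (2 * Real.pi * (Int.fract x : ℝ) * Complex.I) = w
  rw [h1, Complex.exp_sub, Complex.exp_int_mul_two_pi_mul_I, div_one]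
  exact Complex.norm_mul_exp_arg_mul_I w

/-- The equivalence relation on the square which is given by polar coordinates. -/
def PolarRel (z z' : I × I) : Prop :=
  z.1 = z'.1 ∧ (z.1 = 0 ∨ z.2 = z'.2 ∨ (z.2 = 0 ∧ z'.2 = 1) ∨ (z.2 = 1 ∧ z'.2 = 0))

theorem polar_eq_iff (z z' : I × I) : polar z = polar z' ↔ PolarRel z z' := by
  obtain ⟨r, θ⟩ := z
  obtain ⟨r', θ'⟩ := z'
  constructor
  · intro h
    have hr : r = r' := by
      have h1 := congrArg norm h
      rw [norm_polar, norm_polar] at h1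
      exact Subtype.ext h1
    subst hr
    refine ⟨rfl, ?_⟩
    by_cases hr : r = 0
    · exact Or.inl hr
    right
    have hr' : ((r : ℝ) : ℂ) ≠ 0 := fun h => hr (Subtype.ext (by exact_mod_cast h))
    have h1 := mul_left_cancel₀ hr' h
    obtain ⟨n, hn⟩ := Complex.exp_eq_exp_iff_exists_int.1 h1
    have h2 : (2 * Real.pi * Complex.I : ℂ) * ((θ : ℝ) : ℂ) =
        (2 * Real.pi * Complex.I) * (((θ' : ℝ) + n : ℝ) : ℂ) := by
      push_cast
      linear_combination hn
    have h3 : (θ : ℝ) = θ' + n := by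
      exact_mod_cast mul_left_cancel₀ Complex.two_pi_I_ne_zero h2
    have a1 := θ.2.1
    have a2 := θ.2.2
    have a3 := θ'.2.1
    have a4 := θ'.2.2
    have hn1 : (n : ℝ) ≤ 1 := by linarith
    have hn2 : (-1 : ℝ) ≤ n := by linarith
    have hn1' : n ≤ 1 := by exact_mod_cast hn1
    have hn2' : -1 ≤ n := by exact_mod_cast hn2
    obtain rfl | rfl | rfl : n = -1 ∨ n = 0 ∨ n = 1 := by omega
    · push_cast at h3
      refine Or.inr (Or.inl ⟨Subtype.ext ?_, Subtype.ext ?_⟩)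
      · change (θ : ℝ) = 0; linarith
      · change (θ' : ℝ) = 1; linarith
    · push_cast at h3
      exact Or.inl (Subtype.ext (by linarith))
    · push_cast at h3
      refine Or.inr (Or.inr ⟨Subtype.ext ?_, Subtype.ext ?_⟩)
      · change (θ : ℝ) = 1; linarith
      · change (θ' : ℝ) = 0; linarith
  · rintro ⟨h1, h2⟩
    simp only at h1 h2
    subst h1
    rcases h2 with rfl | rfl | ⟨rfl, rfl⟩ | ⟨rfl, rfl⟩ <;> simp [polar]

/-- A map on the square which is compatible with polar coordinates is a map on the disc. -/
theorem exists_disc {Y : Type*} [TopologicalSpace Y] {f : I × I → Y} (hf : Continuous f)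
    (hrel : ∀ z z', f z = f z' ↔ PolarRel z z') :
    ∃ h : ℂ → Y, ContinuousOn h (Metric.closedBall 0 1) ∧ Set.InjOn h (Metric.closedBall 0 1) ∧
      ∀ z, h (polar z) = f z := by
  have hp : ∀ z z', polar z = polar z' ↔ f z = f z' := fun z z' => by
    rw [polar_eq_iff, hrel]
  have hex : ∀ w : ℂ, ∃ y, ∀ z, polar z = w → f z = y := fun w => by
    by_cases hw : ∃ z, polar z = w
    · obtain ⟨z, rfl⟩ := hw
      exact ⟨f z, fun z' h => (hp z' z).1 h⟩
    · exact ⟨f 0, fun z h => absurd ⟨z, h⟩ hw⟩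
  choose h hh using hex
  have hpol : ∀ z, h (polar z) = f z := fun z => (hh _ z rfl).symm
  refine ⟨h, ?_, ?_, hpol⟩
  -- Polar coordinates map the compact square to a Hausdorff space, so they carry closed sets to
  -- closed sets.
  · rw [continuousOn_iff_isClosed]
    refine fun C hC => ⟨polar '' (f ⁻¹' C),
      ((hC.preimage hf).isCompact.image continuous_polar).isClosed, ?_⟩
    ext w
    constructor
    · rintro ⟨h1, h2⟩
      obtain ⟨z, rfl⟩ := exists_polar h2
      exact ⟨⟨z, by rw [Set.mem_preimage, hpol] at h1; exact h1, rfl⟩, h2⟩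
    · rintro ⟨⟨z, h1, rfl⟩, h2⟩
      exact ⟨by rw [Set.mem_preimage, hpol]; exact h1, h2⟩
  · intro w hw w' hw' h
    obtain ⟨z, rfl⟩ := exists_polar hw
    obtain ⟨z', rfl⟩ := exists_polar hw'
    rw [hpol, hpol] at h
    exact (hp z z').2 h

namespace IdealTriangulation.FoldedCorner

variable {X : Type*} [TopologicalSpace X] [ChartedSpace (EuclideanHalfSpace 2) X]
  {S : MarkedSurface X} {τ : IdealTriangulation S} {t : Fin τ.num} {i j k : Fin 3} {P : X}
  {c : τ.FoldedCorner t i j k P} {α β : I} {g : I → I}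

/-- Polar coordinates on the corner of a triangle. -/
def _root_.Tri.sector (i j k : Fin 3) (α : I) (g : I → I) (z : I × I) : Tri :=
  Tri.segment (Tri.ray k j (α * z.1)) (Tri.ray k i (g (α * z.1))) z.2

theorem sector_snd (c : τ.FoldedCorner t i j k P) (z : I × I) :
    Tri.sector i j k α g z j = (1 - (z.2 : ℝ)) * (α * z.1 : I) := by
  rw [Tri.sector, Tri.segment_coord, Tri.ray_target c.hkj, Tri.ray_other c.hkj.symm c.hij.symm]
  ring

theorem sector_fst (c : τ.FoldedCorner t i j k P) (z : I × I) : Tri.sector i j k α g z i = z.2 * g (α * z.1) := by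
  rw [Tri.sector, Tri.segment_coord, Tri.ray_target c.hki, Tri.ray_other c.hki.symm c.hij]
  ring

namespace Gluing

theorem continuous_sector (G : c.Gluing α β g) : Continuous (Tri.sector i j k α g) := by
  have h1 : Continuous fun z : I × I => α * z.1 := by fun_prop
  exact Tri.continuous_segment.comp ((((Tri.continuous_ray k j).comp h1).prodMk
    ((Tri.continuous_ray k i).comp (G.cont.comp h1))).prodMk continuous_snd)

theorem mul_pos_iff (G : c.Gluing α β g) {r : I} (hr : r ≠ 0) : 0 < α * r :=
  pos_iff_ne_zero.2 (mul_ne_zero G.pos.ne' hr)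

theorem map_pos (G : c.Gluing α β g) {u : I} (hu : 0 < u) : 0 < g u := by
  rw [← G.zero]; exact G.mono hu

theorem mul_lt_one (G : c.Gluing α β g) (r : I) : α * r < 1 :=
  (unitInterval.mul_le_left (x := α) (y := r)).trans_lt G.lt_one

theorem map_lt_one (G : c.Gluing α β g) (r : I) : g (α * r) < 1 :=
  (G.mono.monotone (unitInterval.mul_le_left (x := α) (y := r))).trans_lt
    (by rw [G.map]; exact G.lt_one')

theorem sector_notVertex (G : c.Gluing α β g) {z : I × I} (hz : z.1 ≠ 0) :
    (Tri.sector i j k α g z).NotVertex := by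
  have h1 : (0 : ℝ) < (α * z.1 : I) := G.mul_pos_iff hz
  have h2 : (0 : ℝ) < g (α * z.1) := G.map_pos (G.mul_pos_iff hz)
  have h3 : ((α * z.1 : I) : ℝ) < 1 := G.mul_lt_one z.1
  have h4 : (g (α * z.1) : ℝ) < 1 := G.map_lt_one z.1
  have hs := Tri.add_add_eq_one (Tri.sector i j k α g z) c.hki c.hkj c.hij
  have a1 := z.2.2.1
  have a2 := z.2.2.2
  rw [Tri.notVertex_iff]
  have hi := sector_fst c (α := α) (g := g) z
  have hj := sector_snd c (α := α) (g := g) z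
  have b1 : 0 ≤ (z.2 : ℝ) * g (α * z.1) := by positivity
  have b2 : 0 ≤ (1 - (z.2 : ℝ)) * (α * z.1 : I) := mul_nonneg (by linarith) h1.le
  intro l
  rcases Tri.eq_or_of_ne c.hki c.hkj c.hij l with rfl | rfl | rfl
  · rcases a1.eq_or_lt with h | h
    · rw [← h] at hj; linarith
    · have := mul_pos h h2
      linarith
  · rw [hi]; nlinarith
  · rw [hj]; nlinarith

theorem sector_mem_inner (G : c.Gluing α β g) {z : I × I} (hz : z.1 ≠ 0) (h0 : z.2 ≠ 0)
    (h1 : z.2 ≠ 1) : Tri.sector i j k α g z ∈ Tri.inner := by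
  have h1 : (0 : ℝ) < (α * z.1 : I) := G.mul_pos_iff hz
  have h2 : (0 : ℝ) < g (α * z.1) := G.map_pos (G.mul_pos_iff hz)
  have h3 : ((α * z.1 : I) : ℝ) < 1 := G.mul_lt_one z.1
  have h4 : (g (α * z.1) : ℝ) < 1 := G.map_lt_one z.1
  have hs := Tri.add_add_eq_one (Tri.sector i j k α g z) c.hki c.hkj c.hij
  have a1 : (0 : ℝ) < z.2 := unitInterval.pos_iff_ne_zero.2 h0
  have a2 : (z.2 : ℝ) < 1 := unitInterval.lt_one_iff_ne_one.2 ‹z.2 ≠ 1›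
  have hi := sector_fst c (α := α) (g := g) z
  have hj := sector_snd c (α := α) (g := g) z
  intro l
  rcases Tri.eq_or_of_ne c.hki c.hkj c.hij l with rfl | rfl | rfl
  · nlinarith
  · rw [hi]; positivity
  · rw [hj]; exact mul_pos (by linarith) h1

/-- Segments of different radii do not cross. The coordinates are $(1-\theta)a$ and $\theta b$ with
$a$ and $b$ both strictly increasing in the radius; agreement at two radii forces equal $\theta$,
and then $\theta=1$ and $\theta=0$ at once. -/
theorem sector_injective (G : c.Gluing α β g) {z z' : I × I}
    (h : Tri.sector i j k α g z = Tri.sector i j k α g z') :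
    z.1 = z'.1 ∧ (z.1 = 0 ∨ z.2 = z'.2) := by
  have key : ∀ z z' : I × I, z.1 < z'.1 →
      Tri.sector i j k α g z ≠ Tri.sector i j k α g z' := by
    intro z z' hlt h
    have hj := congrArg (fun p : Tri => p j) h
    have hi := congrArg (fun p : Tri => p i) h
    simp only [sector_fst c, sector_snd c] at hi hj
    have h1 : ((α * z.1 : I) : ℝ) < (α * z'.1 : I) := by
      have := G.pos_real
      have hlt' : (z.1 : ℝ) < z'.1 := hlt
      simpa using mul_lt_mul_of_pos_left hlt' this
    have h2 : (g (α * z.1) : ℝ) < g (α * z'.1) := G.mono h1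
    have b1 := (α * z.1).2.1
    have b2 := (g (α * z.1)).2.1
    have a1 := z.2.2.1
    have a2 := z.2.2.2
    have a3 := z'.2.2.1
    have a4 := z'.2.2.2
    generalize ((α * z.1 : I) : ℝ) = a at *
    generalize ((α * z'.1 : I) : ℝ) = a' at *
    generalize (g (α * z.1) : ℝ) = b at *
    generalize (g (α * z'.1) : ℝ) = b' at *
    generalize (z.2 : ℝ) = θ at *
    generalize (z'.2 : ℝ) = θ' at *
    have c1 : (1 - θ') * a' ≤ (1 - θ) * a' := hj ▸ mul_le_mul_of_nonneg_left h1.le (by linarith)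
    have c2 : θ' * b' ≤ θ * b' := hi ▸ mul_le_mul_of_nonneg_left h2.le a1
    have c3 := le_of_mul_le_mul_right c1 (b1.trans_lt h1)
    have c4 := le_of_mul_le_mul_right c2 (b2.trans_lt h2)
    obtain rfl : θ = θ' := by linarith
    have c5 : (1 - θ) * (a' - a) = 0 := by linarith
    have c6 : θ * (b' - b) = 0 := by linarith
    have c7 := (mul_eq_zero.1 c5).resolve_right (by linarith)
    have c8 := (mul_eq_zero.1 c6).resolve_right (by linarith)
    linarith
  have hr : z.1 = z'.1 := by
    rcases lt_trichotomy z.1 z'.1 with h' | h' | h'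
    · exact absurd h (key _ _ h')
    · exact h'
    · exact absurd h.symm (key _ _ h')
  refine ⟨hr, ?_⟩
  by_cases h0 : z.1 = 0
  · exact Or.inl h0
  right
  have hj := congrArg (fun p : Tri => p j) h
  simp only [sector_snd c, ← hr] at hj
  have h1 : (0 : ℝ) < (α * z.1 : I) := G.mul_pos_iff h0
  have := mul_right_cancel₀ h1.ne' hj
  exact Subtype.ext (by linarith)

theorem chart_sector_eq (G : c.Gluing α β g) {z : I × I} (hz : z.1 = 0 ∨ z.2 = 0 ∨ z.2 = 1) :
    τ.chart t (Tri.sector i j k α g z) = τ.chart t (Tri.ray k j (α * z.1)) := by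
  rw [Tri.sector]
  rcases hz with h | h | h
  · rw [h, mul_zero, G.zero, Tri.ray_zero, Tri.ray_zero, Tri.segment_self]
  · rw [h, Path.source]
  · rw [h, Path.target, G.glue]

/-- Open triangles are embedded, so identifications occur only at the vertex or between the two
extreme rays. The gluing matches equal radii there, exactly as polar coordinates do. -/
theorem chart_sector_eq_iff (G : c.Gluing α β g) (z z' : I × I) :
    τ.chart t (Tri.sector i j k α g z) = τ.chart t (Tri.sector i j k α g z') ↔ PolarRel z z' := by
  constructor
  · intro h
    by_cases hz : z.1 = 0 ∨ z.2 = 0 ∨ z.2 = 1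
    · by_cases hz' : z'.1 = 0 ∨ z'.2 = 0 ∨ z'.2 = 1
      · have h1 := h
        rw [G.chart_sector_eq hz, G.chart_sector_eq hz'] at h1
        have h2 : z.1 = z'.1 := mul_left_cancel₀ G.pos.ne' (c.ray_injective h1)
        refine ⟨h2, ?_⟩
        rcases hz with hz | hz | hz
        · exact Or.inl hz
        all_goals
          rcases hz' with hz' | hz' | hz'
          · exact Or.inl (h2.trans hz')
          all_goals simp [hz, hz']
      · push Not at hz'
        have h1 := (τ.inner_eq (G.sector_mem_inner hz'.1 hz'.2.1 hz'.2.2) h.symm).2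
        obtain ⟨h2, h3⟩ := G.sector_injective h1.symm
        exact ⟨h2, h3.imp_right Or.inl⟩
    · push Not at hz
      have h1 := (τ.inner_eq (G.sector_mem_inner hz.1 hz.2.1 hz.2.2) h).2
      obtain ⟨h2, h3⟩ := G.sector_injective h1
      exact ⟨h2, h3.imp_right Or.inl⟩
  · rintro ⟨h1, h2⟩
    obtain ⟨r, θ⟩ := z
    obtain ⟨r', θ'⟩ := z'
    simp only at h1 h2
    subst h1
    rcases h2 with rfl | rfl | ⟨rfl, rfl⟩ | ⟨rfl, rfl⟩
    · rw [G.chart_sector_eq (Or.inl rfl), G.chart_sector_eq (Or.inl rfl)]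
    · rfl
    · rw [G.chart_sector_eq (by simp), G.chart_sector_eq (by simp)]
    · rw [G.chart_sector_eq (by simp), G.chart_sector_eq (by simp)]

theorem exists_sector_eq (G : c.Gluing α β g) {p : Tri} (hp : p ∈ Tri.cut i j α β) :
    ∃ z, Tri.sector i j k α g z = p := by
  have hα := G.pos_real
  have hp' : β * p j + α * p i < α * β := hp
  have hβ := G.pos_real'
  have hi := Tri.nonneg p i
  have hj := Tri.nonneg p j
  have hext : ∀ z : I × I, (1 - (z.2 : ℝ)) * (α * z.1 : I) = p j →
      z.2 * g (α * z.1) = p i → Tri.sector i j k α g z = p := fun z h1 h2 =>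
    Tri.ext_of_ne c.hij ((sector_fst c z).trans h2) ((sector_snd c z).trans h1)
  have hjα : p j ≤ α := by
    by_contra h
    push Not at h
    nlinarith
  have hdiv : ∀ {u : I}, (u : ℝ) ≤ α → ∃ r : I, α * r = u := fun {u} hu =>
    ⟨⟨u / α, div_nonneg u.2.1 hα.le, (div_le_one hα).2 hu⟩, Subtype.ext (mul_div_cancel₀ _ hα.ne')⟩
  rcases hj.eq_or_lt with h0 | h0
  · obtain ⟨u, hu⟩ := G.surj ⟨p i, hi, Tri.le_one p i⟩
    have h1 : u < α := by
      rw [← G.mono.lt_iff_lt, G.map, hu]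
      change p i < β
      rw [← h0] at hp'
      nlinarith
    obtain ⟨r, hr⟩ := hdiv (le_of_lt (show (u : ℝ) < α from h1))
    refine ⟨(r, 1), hext _ ?_ ?_⟩
    · simp [← h0]
    · rw [hr, hu]; simp
  · obtain ⟨r₀, hr₀⟩ := hdiv (u := ⟨p j, hj, Tri.le_one p j⟩) hjα
    -- With denominators cleared, `ψ r = 0` says that `p` lies on the segment of radius `r`. At
    -- `r₀`, where `α * r₀ = p j`, the value is `p i * p j`; at `1` it is not positive because `p`
    -- is in the cut.
    let ψ : I → ℝ := fun r => p j * g (α * r) + p i * (α * r : I) - (α * r : I) * g (α * r)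
    have hψ : Continuous ψ := by
      have := G.cont
      fun_prop
    have h1 : 0 ≤ ψ r₀ := by
      simp only [ψ, hr₀]
      have := mul_nonneg hi hj
      linarith
    have h2 : ψ 1 ≤ 0 := by
      simp only [ψ, mul_one, G.map]
      linarith
    obtain ⟨r, ⟨hr, -⟩, hr0⟩ := intermediate_value_Icc' (unitInterval.le_one' (t := r₀))
      hψ.continuousOn ⟨h2, h1⟩
    have hr' : (r₀ : ℝ) ≤ r := hr
    have h3 : p j ≤ (α * r : I) := by
      have h4 : ((α * r₀ : I) : ℝ) = p j := by rw [hr₀]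
      rw [← h4]
      exact mul_le_mul_of_nonneg_left hr' hα.le
    have hpos : (0 : ℝ) < (α * r : I) := h0.trans_le h3
    refine ⟨(r, ⟨1 - p j / (α * r : I), ?_, ?_⟩), hext _ ?_ ?_⟩
    · rw [sub_nonneg]; exact (div_le_one hpos).2 h3
    · have := div_nonneg hj hpos.le
      linarith
    · change (1 - (1 - p j / (α * r : I))) * ((α * r : I) : ℝ) = p j
      rw [sub_sub_cancel, div_mul_cancel₀ _ hpos.ne']
    · change (1 - p j / (α * r : I)) * (g (α * r) : ℝ) = p i
      simp only [ψ] at hr0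
      rw [one_sub_div hpos.ne', div_mul_eq_mul_div, div_eq_iff hpos.ne']
      linarith

/-- The segment between two matching points on the folded sides is a simple loop around the
puncture. -/
theorem isLoopAround (G : c.Gluing α β g) {z : S.Complement} (l : Path z z)
    (hl : ∀ s, (l s : X) = τ.chart t (Tri.segment (Tri.ray k j α) (Tri.ray k i β) s)) :
    S.IsLoopAround P l := by
  obtain ⟨h, hc, hinj, hpol⟩ := exists_disc ((τ.chart t).continuous.comp G.continuous_sector)
    G.chart_sector_eq_iff
  have hmem : ∀ z, polar z ∈ Metric.closedBall (0 : ℂ) 1 := fun z => by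
    rw [mem_closedBall_zero_iff, norm_polar]; exact z.1.2.2
  have h0 : polar (0, 0) = 0 := by simp [polar]
  refine ⟨h, hc, hinj, ?_, ?_, ?_, fun s => ?_⟩
  · rw [← h0, hpol, Function.comp_apply, G.chart_sector_eq (Or.inl rfl), mul_zero, Tri.ray_zero,
      c.vertex]
  · refine Filter.mem_of_superset (image_cut_mem_nhds G) ?_
    rintro _ ⟨p, hp, rfl⟩
    obtain ⟨z, rfl⟩ := G.exists_sector_eq hp
    exact ⟨polar z, hmem z, hpol z⟩
  · intro w hw hP
    obtain ⟨z, rfl⟩ := exists_polar hw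
    by_contra hne
    have hz : z.1 ≠ 0 := fun h1 => hne (by simp [polar, h1])
    rw [hpol] at hP
    exact τ.notMem_of_ne_vertex (G.sector_notVertex hz) hP
  · have h1 := hpol (1, s)
    rw [hl, Function.comp_apply, Tri.sector, mul_one, G.map] at *
    rw [← h1]
    simp [polar]

end Gluing

end IdealTriangulation.FoldedCorner

end


noncomputable section

/-! The parallel transport on the orbifold fundamental groupoid -/

namespace IdealTriangulation.NearbyPoints

variable {X : Type*} [TopologicalSpace X] [ChartedSpace (EuclideanHalfSpace 2) X]
  {S : MarkedSurface X} {τ : IdealTriangulation S} (N : τ.NearbyPoints)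

theorem exists_corner (P : S.punctures) :
    ∃ (k : Fin 3) (c : τ.FoldedCorner (N.tri P) (N.fst P) (N.snd P) k P) (α β : I) (g : I → I),
      c.Gluing α β g ∧ N.inn P = Tri.ray k (N.snd P) α ∧ N.out P = Tri.ray k (N.fst P) β := by
  obtain ⟨hij, he, hk, hne⟩ := N.folded P
  obtain ⟨k, hik, hjk⟩ := Tri.exists_third (N.fst P) (N.snd P)
  have c : τ.FoldedCorner (N.tri P) (N.fst P) (N.snd P) k P :=
    ⟨hij, hik.symm, hjk.symm, he, hk k hik.symm hjk.symm, hne, P.2⟩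
  obtain ⟨α, hα, hα0, hα1, -⟩ := Tri.eq_ray hij hik.symm hjk.symm (N.inn_mem P)
  obtain ⟨β, hβ, hβ0, hβ1, -⟩ := Tri.eq_ray hij.symm hjk.symm hik.symm (N.out_mem P)
  obtain ⟨g, hgc, hgm, hg0, hgs, hg⟩ := c.exists_gluing
  refine ⟨k, c, α, β, g, ⟨hgc, hgm, hg0, hgs, hg, ?_, hα0, hα1, hβ0, hβ1⟩, hα, hβ⟩
  have h : τ.chart (N.tri P) (N.inn P) = τ.chart (N.tri P) (N.out P) := N.inn_eq_out P
  rw [hα, hβ] at h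
  exact c.symm.ray_injective ((hg α).trans h)

theorem cls_mul_self {z : S.Complement} {l : Path z z} {P : X} (hP : P ∈ S.punctures)
    (hl : S.IsLoopAround P l) : S.cls l ≫ S.cls l = 𝟙 (S.obj z) := by
  rw [← S.cls_trans, ← S.cls_refl]
  exact CategoryTheory.Quotient.sound _ (MarkedSurface.OrbRel.square P hP z l hl)

/-- The point on the folded arc where the loop around a puncture crosses it. -/
def mid (P : S.punctures) : S.Complement :=
  ⟨τ.chart (N.tri P) (N.inn P), τ.notMem_of_ne_vertex (Tri.notVertex_of_side (N.inn_mem P))⟩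

theorem chart_pt (P : S.punctures) : τ.chart (N.tri P) (N.pt P) = N.point P := rfl

theorem chart_inn (P : S.punctures) : τ.chart (N.tri P) (N.inn P) = N.mid P := rfl

theorem chart_out (P : S.punctures) : τ.chart (N.tri P) (N.out P) = N.mid P :=
  (N.inn_eq_out P).symm

theorem pt_notVertex (P : S.punctures) : (N.pt P).NotVertex := Tri.notVertex_of_inner (N.pt_mem P)

theorem inn_notVertex (P : S.punctures) : (N.inn P).NotVertex :=
  Tri.notVertex_of_side (N.inn_mem P)

theorem out_notVertex (P : S.punctures) : (N.out P).NotVertex :=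
  Tri.notVertex_of_side (N.out_mem P)

theorem e_eq (P : S.punctures) :
    N.e P = τ.seg (N.tri P) (N.pt_notVertex P) (N.inn_notVertex P) (N.chart_pt P) (N.chart_inn P) ≫
      τ.seg (N.tri P) (N.out_notVertex P) (N.pt_notVertex P) (N.chart_out P) (N.chart_pt P) := by
  refine (S.cls_trans (y := N.mid P) _ _).trans ?_
  congr 1
  exact τ.cls_eq_seg _ _ _ _ _ _ (fun s => Tri.segment (N.pt P) (N.out P) (σ s)) (by fun_prop)
    (by simp) (by simp) (fun s => Tri.notVertex_segment (N.pt_notVertex P) (N.out_notVertex P) _)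
    fun s => rfl

/-- In the surface the segment from `inn` to `out` closes up to a simple loop around the puncture,
so the orbifold relation makes it its own inverse. -/
theorem seg_inn_out (P : S.punctures) :
    τ.seg (N.tri P) (N.inn_notVertex P) (N.out_notVertex P) (N.chart_inn P) (N.chart_out P) =
      τ.seg (N.tri P) (N.out_notVertex P) (N.inn_notVertex P) (N.chart_out P) (N.chart_inn P) := by
  obtain ⟨k, c, α, β, g, G, hinn, hout⟩ := N.exists_corner P
  have hl : S.IsLoopAround P (τ.straight (N.tri P) (N.inn_notVertex P) (N.out_notVertex P)
      (N.chart_inn P) (N.chart_out P)) := G.isLoopAround _ fun s => by rw [← hinn, ← hout]; rfl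
  exact (IsIso.eq_inv_of_hom_inv_id (cls_mul_self P.2 hl)).trans (τ.inv_seg _ _ _ _)

/-- In the middle of $e_P^2$ stands the segment from `out` to `inn`. Replacing it by the segment
from `inn` to `out` turns the product into a closed path inside the contractible triangle. -/
theorem e_mul_self (P : S.punctures) : N.e P ≫ N.e P = 𝟙 (S.obj (N.point P)) := by
  have h := N.seg_inn_out P
  have e1 := τ.seg_trans (N.inn_notVertex P) (N.out_notVertex P) (N.pt_notVertex P) (N.chart_inn P)
    (N.chart_out P) (N.chart_pt P)
  have e2 := τ.seg_trans (N.out_notVertex P) (N.inn_notVertex P) (N.pt_notVertex P) (N.chart_out P)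
    (N.chart_inn P) (N.chart_pt P)
  rw [e_eq, Category.assoc, τ.seg_trans_assoc, ← h, e1, τ.seg_trans, τ.seg_self]

theorem frame_mem {a : τ.Side} (ha : τ.rep a = a) (x : X) :
    N.frame (Sum.inr ⟨a, ha⟩) x = 1 ∨ N.frame (Sum.inr ⟨a, ha⟩) x = N.cross a := by
  rw [frame]
  split_ifs
  · exact Or.inr rfl
  · exact Or.inl rfl

/-- The value of a functor on a homotopy class of paths. -/
def hol {B G : Type*} [TopologicalSpace B] [Monoid G] (F : FundamentalGroupoid B ⥤ SingleObj G)
    {x y : B} (p : Path.Homotopic.Quotient x y) : G := F.map (X := ⟨x⟩) (Y := ⟨y⟩) p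

theorem hol_trans {B G : Type*} [TopologicalSpace B] [Monoid G]
    (F : FundamentalGroupoid B ⥤ SingleObj G) {x y z : B} (p : Path.Homotopic.Quotient x y)
    (q : Path.Homotopic.Quotient y z) : hol F (p.trans q) = hol F q * hol F p :=
  F.map_comp (X := ⟨x⟩) (Y := ⟨y⟩) (Z := ⟨z⟩) p q

/-- The disc bounded by the loop shrinks it to a small circle in the corner at `P`, changing its
transport by conjugation only. Near `P` just one arc can be crossed, and its letter has order two.
-/
theorem map_loop_mul_self {F : FundamentalGroupoid S.Complement ⥤ SingleObj N.Perms}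
    (hF : ∀ (i : Piece τ) (x y : S.Complement) (p : Path x y), (∀ s, (p s : X) ∈ pieceSet i) →
        F.map (X := ⟨x⟩) (Y := ⟨y⟩) (Path.Homotopic.Quotient.mk p) =
          N.frame i y * (N.frame i x)⁻¹) {z : S.Complement} {l : Path z z} {P : X}
    (hP : P ∈ S.punctures) (hl : S.IsLoopAround P l) :
    (F.map (X := ⟨z⟩) (Y := ⟨z⟩) (Path.Homotopic.Quotient.mk l) *
      F.map (X := ⟨z⟩) (Y := ⟨z⟩) (Path.Homotopic.Quotient.mk l) : N.Perms) = 1 := by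
  obtain ⟨k, c, α, β, g, G, -, -⟩ := N.exists_corner ⟨P, hP⟩
  obtain ⟨h, hc, hinj, h0, -, hpun, hbd⟩ := hl
  let b := τ.rep (N.tri ⟨P, hP⟩, N.fst ⟨P, hP⟩)
  have hb : τ.rep b = b := τ.rep_rep _
  have hbf : N.Folded b := (N.folded_rep_iff).2 (N.folded_fst _)
  have hbb := N.cross_mul_self hbf
  have hball : Metric.closedBall (0 : ℂ) 1 ∈ 𝓝 0 := Metric.closedBall_mem_nhds 0 one_pos
  have hV : h ⁻¹' (τ.chart (N.tri ⟨P, hP⟩) '' Tri.cut (N.fst ⟨P, hP⟩) (N.snd ⟨P, hP⟩) α β) ∈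
      𝓝 (0 : ℂ) := (hc.continuousAt hball).preimage_mem_nhds
    (by rw [h0]; exact FoldedCorner.image_cut_mem_nhds G)
  obtain ⟨ε, hε, hεV⟩ := Metric.mem_nhds_iff.1 hV
  -- A radius below `ε`, so that its circle lies in the cut, capped at `1` to stay in the unit
  -- interval.
  let δ : I := ⟨min 1 (ε / 2), by positivity, min_le_left _ _⟩
  have hδ0 : (0 : ℝ) < δ := lt_min one_pos (by positivity)
  have hδε : (δ : ℝ) < ε := (min_le_right _ _).trans_lt (by linarith)
  let ρ : I → I := fun r => ⟨1 - r * (1 - δ), by nlinarith [r.2.1, r.2.2, δ.2.2], by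
    nlinarith [r.2.1, r.2.2, δ.2.2]⟩
  have hρ : Continuous ρ := by fun_prop
  have hρ0 : ∀ r, ρ r ≠ 0 := fun r hr => by
    have h1 : 1 - (r : ℝ) * (1 - δ) = 0 := congrArg Subtype.val hr
    nlinarith [r.2.1, r.2.2, δ.2.2]
  have hmem : ∀ z, polar z ∈ Metric.closedBall (0 : ℂ) 1 := fun z => by
    rw [mem_closedBall_zero_iff, norm_polar]; exact z.1.2.2
  have hne : ∀ z : I × I, z.1 ≠ 0 → polar z ≠ 0 := fun z hz h1 => hz (by
    have h2 := norm_polar z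
    rw [h1, norm_zero] at h2
    exact Subtype.ext h2.symm)
  have hcp : Continuous fun z => h (polar z) := by
    rw [← continuousOn_univ]
    exact hc.comp continuous_polar.continuousOn fun z _ => hmem z
  let K : C(I × I, S.Complement) :=
    ⟨fun z => ⟨h (polar (ρ z.1, z.2)), fun h1 =>
      hne (ρ z.1, z.2) (hρ0 z.1) (hpun _ (hmem _) h1)⟩,
      (hcp.comp ((hρ.comp continuous_fst).prodMk continuous_snd)).subtype_mk _⟩
  have hp1 : ∀ r, polar (r, 1) = polar (r, 0) := fun r => (polar_eq_iff _ _).2 ⟨rfl, by simp⟩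
  have hK1 : ∀ r, K (r, 1) = K (r, 0) := fun r => Subtype.ext (by
    change h (polar (ρ r, 1)) = h (polar (ρ r, 0))
    rw [hp1])
  have hKl : ∀ s, K (0, s) = l s := fun s => by
    refine Subtype.ext ?_
    rw [hbd]
    change h (polar (ρ 0, s)) = _
    congr 1
    simp [polar, ρ]
  let left : Path z (K (1, 0)) := ⟨⟨fun r => K (r, 0), by fun_prop⟩, by simp [hKl], rfl⟩
  let bottom : Path (K (1, 0)) (K (1, 0)) := ⟨⟨fun s => K (1, s), by fun_prop⟩, rfl, hK1 1⟩
  have hsq := square_homotopic K l left left bottom hKl (fun r => hK1 r) (fun r => rfl) fun s => rfl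
  have hbot : ∀ s, bottom s ∈ Subtype.val ⁻¹' τ.cell (N.tri ⟨P, hP⟩) ∨
      bottom s ∈ (Subtype.val ⁻¹' τ.star b : Set S.Complement) := by
    intro s
    have hρ1 : ρ 1 = δ := Subtype.ext (by simp [ρ])
    have h1 : h (polar (δ, s)) ∈ τ.chart (N.tri ⟨P, hP⟩) ''
        Tri.cut (N.fst ⟨P, hP⟩) (N.snd ⟨P, hP⟩) α β := by
      refine hεV ?_
      rw [mem_ball_zero_iff, norm_polar]
      exact hδε
    have h2 : h (polar (δ, s)) ≠ P := fun h2 => by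
      refine hne (δ, s) (fun h3 => hδ0.ne' (congrArg Subtype.val h3)) ?_
      exact hinj (hmem _) (Metric.mem_closedBall_self zero_le_one) (h2.trans h0.symm)
    change h (polar (ρ 1, s)) ∈ τ.cell _ ∨ h (polar (ρ 1, s)) ∈ τ.star b
    rw [hρ1]
    obtain ⟨p, hp, hpe⟩ := h1
    rw [← hpe] at h2 ⊢
    rcases G.cut_cases (le_of_lt hp) with rfl | ⟨-, hq | hq | hq⟩
    · exact absurd c.vertex h2
    · exact Or.inl ⟨p, hq, rfl⟩
    · right
      refine τ.edge_subset_star ?_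
      rw [τ.edge_rep]; exact ⟨p, hq, rfl⟩
    · right
      refine τ.edge_subset_star ?_
      rw [τ.edge_rep, c.edge_eq]; exact ⟨p, hq, rfl⟩
  have hFb : hol F (Path.Homotopic.Quotient.mk bottom) = 1 ∨
      hol F (Path.Homotopic.Quotient.mk bottom) = N.cross b := by
    -- The circle stays in the cell of the triangle and the star of its folded arc, so all values
    -- remain in `{1, N.cross b}`, which is closed under products. No crossings have to be counted
    -- and no winding number is needed.
    refine path_induction (J := Bool) (fun x y p => hol F p = 1 ∨ hol F p = N.cross b) ?_
      (fun u => Subtype.val ⁻¹' if u then τ.cell (N.tri ⟨P, hP⟩) else τ.star b) ?_ ?_ bottom ?_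
    · intro x y w p q hp hq
      rw [hol_trans]
      rcases hp with hp | hp <;> rcases hq with hq | hq <;> rw [hp, hq]
      · exact Or.inl (one_mul _)
      · exact Or.inr (mul_one _)
      · exact Or.inr (one_mul _)
      · exact Or.inl hbb
    · rintro (_ | _)
      · exact (τ.isOpen_star b).preimage continuous_subtype_val
      · exact (τ.isOpen_cell _).preimage continuous_subtype_val
    · rintro (_ | _) x y p hp
      · have h3 : hol F (Path.Homotopic.Quotient.mk p) = _ := hF (Sum.inr ⟨b, hb⟩) x y p hp
        have hbi : (N.cross b)⁻¹ = N.cross b := inv_eq_of_mul_eq_one_left hbb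
        rw [h3]
        rcases N.frame_mem hb x with h1 | h1 <;> rcases N.frame_mem hb y with h2 | h2 <;>
          rw [h1, h2]
        · exact Or.inl (by simp)
        · exact Or.inr (by simp)
        · exact Or.inr (by simp [hbi])
        · exact Or.inl (by simp)
      · have h3 : hol F (Path.Homotopic.Quotient.mk p) = _ := hF (Sum.inl (N.tri ⟨P, hP⟩)) x y p hp
        rw [h3]
        exact Or.inl (by simp [frame])
    · intro s
      rcases hbot s with h1 | h1
      · exact ⟨true, h1⟩
      · exact ⟨false, h1⟩
  have hsq' : hol F (Path.Homotopic.Quotient.mk left) * hol F (Path.Homotopic.Quotient.mk l) =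
      hol F (Path.Homotopic.Quotient.mk bottom) * hol F (Path.Homotopic.Quotient.mk left) := by
    rw [← hol_trans, ← hol_trans]
    exact congrArg _ hsq
  have hFb2 : hol F (Path.Homotopic.Quotient.mk bottom) *
      hol F (Path.Homotopic.Quotient.mk bottom) = 1 := by
    rcases hFb with h1 | h1 <;> rw [h1]
    · exact one_mul _
    · exact hbb
  have key : ∀ a b c : N.Perms, b * a = c * b → c * c = 1 → a * a = 1 := fun a b c h1 h2 => by
    have h3 : a = b⁻¹ * c * b := by rw [mul_assoc, ← h1]; group
    rw [h3, show b⁻¹ * c * b * (b⁻¹ * c * b) = b⁻¹ * (c * c) * b by group, h2]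
    group
  exact key _ _ _ hsq' hFb2

/-- A functor on the orbifold fundamental groupoid which is given by the frames over the local
pieces of the surface. -/
def IsTransport (F : S.OrbGroupoid ⥤ SingleObj N.Perms) : Prop :=
  ∀ (i : Piece τ) (x y : S.Complement) (p : Path x y), (∀ s, (p s : X) ∈ pieceSet i) →
    F.map (S.cls p) = N.frame i y * (N.frame i x)⁻¹

theorem exists_isTransport : ∃ F, N.IsTransport F := by
  obtain ⟨F, hF⟩ := N.exists_transport_complement
  refine ⟨CategoryTheory.Quotient.lift S.OrbRel F ?_, fun i x y p hp => hF i x y p hp⟩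
  rintro _ _ _ _ ⟨P, hP, z, l, hl⟩
  have h1 := N.map_loop_mul_self hF hP hl
  have h2 := transport_trans F l l
  have h3 : F.map (X := ⟨z⟩) (Y := ⟨z⟩) (Path.Homotopic.Quotient.mk (Path.refl z)) = (1 : N.Perms) :=
    F.map_id _
  rw [h3]
  exact h2.trans h1

end IdealTriangulation.NearbyPoints

end


noncomputable section

/-! Crossing an arc, and words in the crossings -/

namespace IdealTriangulation

variable {X : Type*} [TopologicalSpace X] [ChartedSpace (EuclideanHalfSpace 2) X]
  {S : MarkedSurface X} (τ : IdealTriangulation S)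

theorem _root_.Tri.bary_notVertex : Tri.bary.NotVertex := Tri.notVertex_of_inner Tri.bary_mem

/-- The barycentre of a triangle of the triangulation. -/
def center (t : Fin τ.num) : S.Complement :=
  ⟨τ.chart t Tri.bary, τ.notMem_of_ne_vertex Tri.bary_notVertex⟩

theorem chart_bary (t : Fin τ.num) : τ.chart t Tri.bary = τ.center t := rfl

/-- The barycentre of a triangle, as an object of the orbifold fundamental groupoid. -/
abbrev base (t : Fin τ.num) : S.OrbGroupoid := S.obj (τ.center t)

/-- The path from the barycentre of a triangle to the barycentre of another one, via a common
point. -/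
def via {t s : Fin τ.num} {p q : Tri} (hp : p.NotVertex) (hq : q.NotVertex) {c : S.Complement}
    (hc : τ.chart t p = c) (hc' : τ.chart s q = c) : τ.base t ⟶ τ.base s :=
  τ.seg t Tri.bary_notVertex hp (τ.chart_bary t) hc ≫
    τ.seg s hq Tri.bary_notVertex hc' (τ.chart_bary s)

/-- Sliding the crossing point along the open arc can be read in either triangle, and both readings
give the same morphism. -/
theorem via_eq {t s : Fin τ.num} {i j : Fin 3} (h : τ.edge (t, i) = τ.edge (s, j)) {p q p' q' : Tri}
    (hp : p ∈ Tri.side i) (hq : q ∈ Tri.side j) (hp' : p' ∈ Tri.side i) (hq' : q' ∈ Tri.side j)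
    {c c' : S.Complement} (h1 : τ.chart t p = c) (h2 : τ.chart s q = c)
    (h1' : τ.chart t p' = c') (h2' : τ.chart s q' = c') :
    τ.via (Tri.notVertex_of_side hp) (Tri.notVertex_of_side hq) h1 h2 =
      τ.via (Tri.notVertex_of_side hp') (Tri.notVertex_of_side hq') h1' h2' := by
  unfold via
  have e1 := τ.seg_eq_seg_of_edge_eq h hp' hp hq' hq h1' h1 h2' h2
  rw [← τ.seg_trans _ (Tri.notVertex_of_side hp') (Tri.notVertex_of_side hp) _ h1' h1,
    Category.assoc, e1, τ.seg_trans]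

theorem _root_.Tri.mid_mem (i : Fin 3) : Tri.proj i Tri.bary ∈ Tri.side i :=
  ⟨Tri.proj_self i _, fun j hj => by
    rw [Tri.proj_of_ne hj]
    have h1 := Tri.bary_mem j
    have h2 := Tri.bary_mem i
    linarith⟩

theorem exists_match {t s : Fin τ.num} {i j : Fin 3} (h : τ.edge (t, i) = τ.edge (s, j)) {p : Tri}
    (hp : p ∈ Tri.side i) {c : S.Complement} (hc : τ.chart t p = c) :
    ∃ q, q ∈ Tri.side j ∧ τ.chart s q = c := by
  have h1 : (c : X) ∈ τ.edge (s, j) := h ▸ ⟨p, hp, hc⟩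
  exact h1

/-- The midpoint of a side. -/
def midpoint (t : Fin τ.num) (i : Fin 3) : S.Complement :=
  ⟨τ.chart t (Tri.proj i Tri.bary), τ.notMem_of_ne_vertex (Tri.notVertex_of_side (Tri.mid_mem i))⟩

theorem chart_mid (t : Fin τ.num) (i : Fin 3) :
    τ.chart t (Tri.proj i Tri.bary) = τ.midpoint t i := rfl

/-- The path from the barycentre of a triangle to the barycentre of another one which crosses an
arc. -/
def arc {t s : Fin τ.num} {i j : Fin 3} (h : τ.edge (t, i) = τ.edge (s, j)) :
    τ.base t ⟶ τ.base s :=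
  τ.via (c := τ.midpoint t i) (Tri.notVertex_of_side (Tri.mid_mem i))
    (Tri.notVertex_of_side (τ.exists_match h (Tri.mid_mem i) (τ.chart_mid t i)).choose_spec.1) (τ.chart_mid t i)
    (τ.exists_match h (Tri.mid_mem i) (τ.chart_mid t i)).choose_spec.2

section arc

variable {τ} {t s u : Fin τ.num} {i j k : Fin 3} (h : τ.edge (t, i) = τ.edge (s, j))

theorem arc_eq {p q : Tri} (hp : p ∈ Tri.side i) (hq : q ∈ Tri.side j) {c : S.Complement}
    (h1 : τ.chart t p = c) (h2 : τ.chart s q = c) :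
    τ.arc h = τ.via (Tri.notVertex_of_side hp) (Tri.notVertex_of_side hq) h1 h2 :=
  τ.via_eq h (Tri.mid_mem i) (τ.exists_match h (Tri.mid_mem i) (τ.chart_mid t i)).choose_spec.1 hp hq _ _ _ _

theorem arc_self (h : τ.edge (t, i) = τ.edge (t, i)) : τ.arc h = 𝟙 (τ.base t) := by
  rw [arc_eq h (Tri.mid_mem i) (Tri.mid_mem i) (τ.chart_mid t i) (τ.chart_mid t i)]
  unfold via
  rw [τ.seg_trans, τ.seg_self]

theorem arc_trans (h' : τ.edge (s, j) = τ.edge (u, k)) :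
    τ.arc h ≫ τ.arc h' = τ.arc (h.trans h') := by
  obtain ⟨q, hq, hq'⟩ := τ.exists_match h (Tri.mid_mem i) (τ.chart_mid t i)
  obtain ⟨r, hr, hr'⟩ := τ.exists_match (h.trans h') (Tri.mid_mem i) (τ.chart_mid t i)
  rw [arc_eq h (Tri.mid_mem i) hq (τ.chart_mid t i) hq',
    arc_eq h' hq hr (c := τ.midpoint t i) hq' hr',
    arc_eq (h.trans h') (Tri.mid_mem i) hr (τ.chart_mid t i) hr']
  unfold via
  rw [Category.assoc, τ.seg_trans_assoc, τ.seg_self, Category.id_comp]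

end arc

namespace NearbyPoints

variable {τ} (N : τ.NearbyPoints)

theorem edge_fst (P : S.punctures) :
    τ.edge (N.tri P, N.fst P) = τ.edge (N.tri P, N.snd P) := (N.folded P).2.1

/-- The conjugate of `e_P` at the barycentre. -/
def turnArc (P : S.punctures) : τ.base (N.tri P) ⟶ τ.base (N.tri P) := τ.arc (N.edge_fst P)

/-- The crossings in the two directions differ by the segment between the two positions of a point
of the folded arc, used forwards or backwards; `seg_inn_out` identifies these. This justifies one
letter for both. -/
theorem arc_snd (P : S.punctures) : τ.arc (N.edge_fst P).symm = N.turnArc P := by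
  rw [turnArc, arc_eq _ (N.inn_mem P) (N.out_mem P) (N.chart_inn P) (N.chart_out P),
    arc_eq _ (N.out_mem P) (N.inn_mem P) (N.chart_out P) (N.chart_inn P)]
  unfold via
  rw [← τ.seg_trans _ (N.inn_notVertex P) (N.out_notVertex P) _ (N.chart_inn P), N.seg_inn_out P,
    Category.assoc, τ.seg_trans]

theorem turnArc_mul_self (P : S.punctures) : N.turnArc P ≫ N.turnArc P = 𝟙 _ := by
  have h := arc_trans (N.edge_fst P) (N.edge_fst P).symm
  rwa [arc_snd, arc_self] at h

/-- The path from the barycentre of the triangle around a puncture to the chosen point nearby. -/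
def toPoint (P : S.punctures) : τ.base (N.tri P) ⟶ S.obj (N.point P) :=
  τ.seg (N.tri P) Tri.bary_notVertex (N.pt_notVertex P) (τ.chart_bary _) (N.chart_pt P)

instance (P : S.punctures) : IsIso (N.toPoint P) := inferInstanceAs (IsIso (S.cls _))

theorem toPoint_e (P : S.punctures) : N.toPoint P ≫ N.e P = N.turnArc P ≫ N.toPoint P := by
  rw [turnArc, arc_eq _ (N.inn_mem P) (N.out_mem P) (N.chart_inn P) (N.chart_out P), e_eq]
  unfold toPoint via
  rw [τ.seg_trans_assoc, Category.assoc, τ.seg_trans]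

/-- The value of a functor to a group. -/
def val {C G : Type*} [Category C] [Monoid G] (F : C ⥤ SingleObj G) {x y : C} (f : x ⟶ y) : G :=
  F.map f

section val

variable {C G : Type*} [Groupoid C] [Group G] (F : C ⥤ SingleObj G) {x y z : C}

theorem val_comp (f : x ⟶ y) (g : y ⟶ z) : val F (f ≫ g) = val F g * val F f := F.map_comp f g

theorem val_id (x : C) : val F (𝟙 x) = 1 := F.map_id x

theorem val_inv (f : x ⟶ y) : val F (inv f) = (val F f)⁻¹ := by
  rw [eq_inv_iff_mul_eq_one, ← val_comp, IsIso.hom_inv_id, val_id]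

end val

variable {N} {F : S.OrbGroupoid ⥤ SingleObj N.Perms}

theorem IsTransport.val_seg_inner (hF : N.IsTransport F) {t : Fin τ.num} {p q : Tri}
    (hp : p ∈ Tri.inner) (hq : q ∈ Tri.inner) {x y : S.Complement} (hx : τ.chart t p = x)
    (hy : τ.chart t q = y) :
    val F (τ.seg t (Tri.notVertex_of_inner hp) (Tri.notVertex_of_inner hq) hx hy) = 1 := by
  have h : val F _ = _ := hF (Sum.inl t) x y (τ.straight t (Tri.notVertex_of_inner hp)
    (Tri.notVertex_of_inner hq) hx hy) fun s => ⟨_, Tri.inner_segment hp hq s, rfl⟩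
  rw [seg, h]
  simp [frame]

/-- Detour through an interior point of the collar: the first leg stays in the cell and has trivial
transport, the second stays in the star, where the frame gives the value. -/
theorem IsTransport.val_seg_bary (hF : N.IsTransport F) {a : τ.Side} (ha : τ.rep a = a)
    {t : Fin τ.num} {i : Fin 3} (h : a = (t, i) ∨ τ.bar a = (t, i)) {p : Tri}
    (hp : p ∈ Tri.side i) {x : S.Complement} (hx : τ.chart t p = x) :
    val F (τ.seg t Tri.bary_notVertex (Tri.notVertex_of_side hp) (τ.chart_bary t) hx) =
      N.frame (Sum.inr ⟨a, ha⟩) x * (N.frame (Sum.inr ⟨a, ha⟩) (τ.chart t (Tri.pushIn p)))⁻¹ := by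
  have hi := Tri.pushIn_inner p
  have hc := Tri.pushIn_collar hp
  let y : S.Complement := ⟨τ.chart t (Tri.pushIn p), τ.notMem_of_ne_vertex (Tri.notVertex_of_inner hi)⟩
  rw [← τ.seg_trans _ (Tri.notVertex_of_inner hi) _ _ (show _ = (y : X) from rfl), val_comp,
    hF.val_seg_inner Tri.bary_mem hi, mul_one, seg]
  refine hF (Sum.inr ⟨a, ha⟩) y x _ fun s => ?_
  have h1 := Tri.collar_segment hc (Tri.side_subset_collar i hp) s
  rcases h with h | h
  · change _ ∈ τ.star a
    rw [h]
    exact τ.mem_star_left h1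
  · exact τ.mem_star_right h h1

/-- The two halves meet on the arc, where the frame value cancels; the jump of the frame between the
collars remains. If the preferred representative is the far side, the jump is inverted, and
`cross_bar` accounts for this. -/
theorem IsTransport.val_arc (hF : N.IsTransport F) {t s : Fin τ.num} {i j : Fin 3}
    (h : τ.edge (t, i) = τ.edge (s, j)) (hb : τ.bar (t, i) = (s, j)) (hne : (s, j) ≠ (t, i)) :
    val F (τ.arc h) = N.cross (t, i) := by
  obtain ⟨q, hq, hqc⟩ := τ.exists_match h (Tri.mid_mem i) (τ.chart_mid t i)
  have hp := Tri.mid_mem i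
  have hb' : τ.bar (s, j) = (t, i) := by rw [← hb, τ.bar_bar]
  rw [arc_eq h (Tri.mid_mem i) hq (τ.chart_mid t i) hqc]
  unfold via
  rw [← τ.inv_seg Tri.bary_notVertex (Tri.notVertex_of_side hq) (τ.chart_bary s) hqc, val_comp, val_inv]
  have key : ∀ a b c : N.Perms, (a * b⁻¹)⁻¹ * (a * c⁻¹) = b * c⁻¹ := fun a b c => by group
  rcases τ.rep_eq_or (t, i) with ha | ha
  · rw [hF.val_seg_bary ha (Or.inl rfl) hp, hF.val_seg_bary ha (Or.inr hb) hq, key,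
      N.frame_right ha hb (by rw [hb]; exact hne) (Tri.pushIn_collar hq) (Tri.pushIn_inner q),
      N.frame_left ha rfl (Tri.pushIn_collar hp)]
    simp
  · rw [hb] at ha
    have ha' : τ.rep (s, j) = (s, j) := by rw [← ha, τ.rep_rep, ha]
    rw [hF.val_seg_bary ha' (Or.inr hb') hp, hF.val_seg_bary ha' (Or.inl rfl) hq, key,
      N.frame_right ha' hb' (by rw [hb']; exact hne.symm) (Tri.pushIn_collar hp)
        (Tri.pushIn_inner _), N.frame_left ha' rfl (Tri.pushIn_collar hq), ← hb, cross_bar]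
    simp

variable (N) in
/-- A morphism between barycentres is represented by a word in the crossings, the last crossing
being the first letter. -/
def Rep (t₀ : Fin τ.num) : List τ.Side → (Σ t, τ.base t₀ ⟶ τ.base t) → Prop
  | [], ρ => ρ = ⟨t₀, 𝟙 _⟩
  | c :: w, ρ => ∃ (t s : Fin τ.num) (i j : Fin 3) (h : τ.edge (t, i) = τ.edge (s, j))
      (g : τ.base t₀ ⟶ τ.base t), τ.bar (t, i) = (s, j) ∧ (s, j) ≠ (t, i) ∧ N.letter (t, i) = c ∧
        Rep t₀ w ⟨t, g⟩ ∧ ρ = ⟨s, g ≫ τ.arc h⟩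

/-- From a given triangle a letter determines the next crossing: equal letters mean the same side,
or the two sides of one folded arc, and then `arc_snd` applies. The target triangle is part of the
conclusion, hence the sigma type. -/
theorem arc_eq_of_folded {t s s' : Fin τ.num} {i j i' j' : Fin 3}
    (h : τ.edge (t, i) = τ.edge (s, j)) (h' : τ.edge (t, i') = τ.edge (s', j'))
    (hb : τ.bar (t, i) = (s, j)) (hb' : τ.bar (t, i') = (s', j'))
    (hl : N.letter (t, i) = N.letter (t, i')) {t₀ : Fin τ.num} (g : τ.base t₀ ⟶ τ.base t) :
    (⟨s, g ≫ τ.arc h⟩ : Σ t, τ.base t₀ ⟶ τ.base t) = ⟨s', g ≫ τ.arc h'⟩ := by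
  rcases N.eq_or_of_letter_eq hl with h1 | ⟨⟨P, h1⟩, h2⟩
  · obtain ⟨-, rfl⟩ := Prod.ext_iff.1 h1
    obtain ⟨rfl, rfl⟩ := Prod.ext_iff.1 (hb.symm.trans hb')
    rfl
  · have h3 : (s', j') = (t, i) := by rw [← hb', h2, τ.bar_bar]
    rw [hb] at h2
    obtain ⟨rfl, rfl⟩ := Prod.ext_iff.1 h2
    obtain ⟨rfl, rfl⟩ := Prod.ext_iff.1 h3
    rcases h1 with h1 | h1 <;> obtain ⟨rfl, rfl⟩ := Prod.ext_iff.1 h1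
    · rw [N.bar_fst] at hb
      obtain ⟨-, rfl⟩ := Prod.ext_iff.1 hb
      have := N.arc_snd P
      unfold turnArc at this
      rw [this]
    · rw [N.bar_snd] at hb
      obtain ⟨-, rfl⟩ := Prod.ext_iff.1 hb
      have := N.arc_snd P
      unfold turnArc at this
      rw [this]

theorem Rep.unique {t₀ : Fin τ.num} {w : List τ.Side} {ρ ρ' : Σ t, τ.base t₀ ⟶ τ.base t}
    (h : N.Rep t₀ w ρ) (h' : N.Rep t₀ w ρ') : ρ = ρ' := by
  induction w generalizing ρ ρ' with
  | nil => exact Eq.trans h (Eq.symm h')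
  | cons c w ih =>
    obtain ⟨t, s, i, j, he, g, hb, -, hl, hr, rfl⟩ := h
    obtain ⟨t', s', i', j', he', g', hb', -, hl', hr', rfl⟩ := h'
    obtain ⟨rfl, h1⟩ := Sigma.mk.inj (ih hr hr')
    obtain rfl := eq_of_heq h1
    exact arc_eq_of_folded he he' hb hb' (hl.trans hl'.symm) g

theorem Rep.val_eq {t₀ : Fin τ.num} (hF : N.IsTransport F) {w : List τ.Side}
    {ρ : Σ t, τ.base t₀ ⟶ τ.base t} (h : N.Rep t₀ w ρ) :
    val F ρ.2 = ReducedWord.wordPerm N.flip_involutive w := by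
  induction w generalizing ρ with
  | nil =>
    obtain rfl : ρ = _ := h
    exact val_id F _
  | cons c w ih =>
    obtain ⟨t, s, i, j, he, g, hb, hne, rfl, hr, rfl⟩ := h
    rw [ReducedWord.wordPerm_cons, ← ih hr, val_comp, hF.val_arc he hb hne]
    rfl

theorem Rep.suffix {t₀ : Fin τ.num} {w w' : List τ.Side} {ρ : Σ t, τ.base t₀ ⟶ τ.base t}
    (h : N.Rep t₀ (w' ++ w) ρ) : ∃ ρ', N.Rep t₀ w ρ' := by
  induction w' generalizing ρ with
  | nil => exact ⟨ρ, h⟩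
  | cons c w' ih =>
    obtain ⟨t, s, i, j, he, g, hb, hne, hl, hr, rfl⟩ := h
    exact ih hr

variable (N F) in
/-- A morphism between barycentres which is compatible with the representation by words. -/
def Pres {t s : Fin τ.num} (h : τ.base t ⟶ τ.base s) : Prop :=
  ∀ (t₀ : Fin τ.num) (w : ReducedWord N.flip) (g : τ.base t₀ ⟶ τ.base t),
    N.Rep t₀ w.1 ⟨t, g⟩ → N.Rep t₀ (val F h w).1 ⟨s, g ≫ h⟩

theorem Pres.id (t : Fin τ.num) : N.Pres F (𝟙 (τ.base t)) := fun t₀ w g hg => by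
  rw [val_id, Category.comp_id]; exact hg

theorem Pres.comp {t s u : Fin τ.num} {h : τ.base t ⟶ τ.base s} {k : τ.base s ⟶ τ.base u}
    (hh : N.Pres F h) (hk : N.Pres F k) : N.Pres F (h ≫ k) := fun t₀ w g hg => by
  rw [val_comp, ← Category.assoc]
  exact hk t₀ _ _ (hh t₀ w g hg)

/-- The cases are those of `push`. A letter which does not cancel is one more crossing; a letter
which cancels shows that the previous crossing used the same arc, and the new crossing undoes it. -/
theorem IsTransport.pres_arc (hF : N.IsTransport F) {t s : Fin τ.num} {i j : Fin 3}
    (h : τ.edge (t, i) = τ.edge (s, j)) : N.Pres F (τ.arc h) := by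
  by_cases hne : (s, j) = (t, i)
  · obtain ⟨rfl, rfl⟩ := Prod.ext_iff.1 hne
    rw [arc_self]
    exact Pres.id s
  have hb : τ.bar (t, i) = (s, j) := (τ.eq_bar_of_ne h.symm hne).symm
  have hb' : τ.bar (s, j) = (t, i) := by rw [← hb, τ.bar_bar]
  intro t₀ w g hg
  rw [hF.val_arc h hb hne]
  obtain ⟨w, hw⟩ := w
  by_cases hred : IsReducedWord N.flip (N.letter (t, i) :: w)
  · rw [cross, ReducedWord.push_of_isReduced _ hred]
    exact ⟨t, s, i, j, h, g, hb, hne, rfl, hg, rfl⟩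
  · obtain ⟨c, w, rfl, hc⟩ : ∃ c w', w = c :: w' ∧ c = N.flip (N.letter (t, i)) := by
      cases w with
      | nil => exact absurd (List.isChain_singleton _) hred
      | cons c w =>
        refine ⟨c, w, rfl, ?_⟩
        by_contra hc
        exact hred (List.isChain_cons_cons.2 ⟨hc, hw⟩)
    rw [cross, ReducedWord.push_cons_self _ hc]
    obtain ⟨t', s', i', j', h', g', hb₁, hne', hl, hr, he⟩ := hg
    have hl' : N.letter (t', i') = N.letter (s, j) := by rw [hl, hc, ← letter_bar, hb]
    have hrev : N.letter (s', j') = N.letter (t, i) := by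
      rw [← hb₁, letter_bar, hl', ← letter_bar, hb']
    obtain ⟨rfl, h1⟩ := Sigma.mk.inj he
    obtain rfl := eq_of_heq h1
    have h2 := arc_eq_of_folded h h'.symm hb (by rw [← hb₁, τ.bar_bar]) hrev.symm (g' ≫ τ.arc h')
    change N.Rep t₀ w _
    rw [h2, Category.assoc, arc_trans, arc_self, Category.comp_id]
    exact hr

end NearbyPoints

end IdealTriangulation

end


noncomputable section

/-! The transport is faithful -/

namespace IdealTriangulation

variable {X : Type*} [TopologicalSpace X] [ChartedSpace (EuclideanHalfSpace 2) X]
  {S : MarkedSurface X} (τ : IdealTriangulation S)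

/-- The straight path from a point which is not a vertex to the barycentre of its triangle. -/
def innerAnchor {y : S.Complement} (hy : (y : X) ∉ τ.verts) : Σ t, S.obj y ⟶ τ.base t :=
  ⟨(τ.exists_isLoc hy).choose, τ.seg _ (τ.exists_isLoc hy).choose_spec.choose_spec.notVertex
    Tri.bary_notVertex (τ.exists_isLoc hy).choose_spec.choose_spec.1 (τ.chart_bary _)⟩

theorem innerAnchor_eq {y : S.Complement} (hy : (y : X) ∉ τ.verts) {t : Fin τ.num} {p : Tri}
    (h : τ.IsLoc y t p) :
    τ.innerAnchor hy = ⟨t, τ.seg t h.notVertex Tri.bary_notVertex h.1 (τ.chart_bary t)⟩ := by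
  obtain ⟨rfl, rfl⟩ := h.unique _ (τ.exists_isLoc hy).choose_spec.choose_spec
  rfl

/-- A path from a marked point to a point nearby. -/
structure MarkedTrack (m : S.marked) where
  nbhd : Set X
  isMarkedNbhd : τ.IsMarkedNbhd m nbhd
  near : S.Complement
  near_mem : (near : X) ∈ nbhd
  near_notVert : (near : X) ∉ τ.verts
  path : Path (⟨m, S.marked_notMem m.2⟩ : S.Complement) near
  path_mem : ∀ s, (path s : X) ∈ nbhd

variable {τ}

theorem IsMarkedNbhd.notMem_punctures {m : X} {W : Set X} (h : τ.IsMarkedNbhd m W)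
    (hm : m ∈ S.marked) {x : X} (hx : x ∈ W) : x ∉ S.punctures := fun hP =>
  S.marked_notMem hm (h.eq_of_mem x hx (Or.inr hP) ▸ hP)

theorem IsMarkedNbhd.exists_path {m : X} {W V : Set X} (h : τ.IsMarkedNbhd m W)
    (hm : m ∈ S.marked) (hVW : V ⊆ W) (hV : IsPathConnected V) {x y : S.Complement}
    (hx : (x : X) ∈ V) (hy : (y : X) ∈ V) : ∃ p : Path x y, ∀ s, (p s : X) ∈ V := by
  obtain ⟨p, hp⟩ := hV.joinedIn x hx y hy
  exact ⟨⟨⟨fun s => ⟨p s, h.notMem_punctures hm (hVW (hp s))⟩, by fun_prop⟩,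
    by simp, by simp⟩, hp⟩

theorem IsMarkedNbhd.isSimplyConnected_preimage {m : X} {W : Set X} (h : τ.IsMarkedNbhd m W)
    (hm : m ∈ S.marked) : IsSimplyConnected ((Subtype.val : S.Complement → X) ⁻¹' W) := by
  rw [← Topology.IsEmbedding.subtypeVal.isSimplyConnected_image]
  convert h.simply using 1
  ext x
  constructor
  · rintro ⟨x, hxW, rfl⟩
    exact hxW
  · exact fun hxW => ⟨⟨x, h.notMem_punctures hm hxW⟩, hxW, rfl⟩

theorem nonempty_markedTrack (m : S.marked) : Nonempty (τ.MarkedTrack m) := by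
  obtain ⟨W, hW⟩ := τ.exists_isMarkedNbhd m.2
  obtain ⟨w, hw, hne⟩ := hW.simply'.nonempty
  have hwP := hW.notMem_punctures m.2 hw
  obtain ⟨p, hp⟩ := hW.exists_path m.2 subset_rfl hW.simply.isPathConnected
    (x := ⟨m, S.marked_notMem m.2⟩) (y := ⟨w, hwP⟩) hW.mem hw
  exact ⟨⟨W, hW, ⟨w, hwP⟩, hw, fun h => hne (hW.eq_of_mem w hw h), p, hp⟩⟩

variable (τ)

/-- A chosen path from a marked point to a point nearby. -/
def track (m : S.marked) : τ.MarkedTrack m := (nonempty_markedTrack m).some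

open Classical in
/-- A chosen path from a point to the barycentre of a triangle nearby. -/
def anchor (y : S.Complement) : Σ t, S.obj y ⟶ τ.base t :=
  if hy : (y : X) ∉ τ.verts then τ.innerAnchor hy
  else ⟨_, S.cls (τ.track ⟨y, (not_not.1 hy).resolve_right y.2⟩).path ≫
    (τ.innerAnchor (τ.track ⟨y, (not_not.1 hy).resolve_right y.2⟩).near_notVert).2⟩

theorem anchor_of_isLoc {y : S.Complement} {t : Fin τ.num} {p : Tri} (h : τ.IsLoc y t p) :
    τ.anchor y = ⟨t, τ.seg t h.notVertex Tri.bary_notVertex h.1 (τ.chart_bary t)⟩ := by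
  have hy : (y : X) ∉ τ.verts := by
    rw [← h.1, τ.mem_verts_iff, not_not]; exact h.notVertex
  rw [anchor, dif_pos hy, τ.innerAnchor_eq hy h]

theorem anchor_of_notMem {y : S.Complement} (hy : (y : X) ∉ τ.verts) :
    τ.anchor y = τ.innerAnchor hy := dif_pos hy

theorem anchor_of_marked (m : S.marked) :
    τ.anchor ⟨m, S.marked_notMem m.2⟩ =
      ⟨_, S.cls (τ.track m).path ≫ (τ.anchor (τ.track m).near).2⟩ := by
  have hm : (m : X) ∈ τ.verts := Or.inl m.2
  rw [anchor, dif_neg (not_not.2 hm), anchor_of_notMem]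

theorem anchor_center (t : Fin τ.num) : τ.anchor (τ.center t) = ⟨t, 𝟙 (τ.base t)⟩ := by
  rw [τ.anchor_of_isLoc (t := t) (p := Tri.bary) ⟨rfl, Or.inl Tri.bary_mem⟩, τ.seg_self]

/-- A path in an open triangle is homotopic to a straight path. -/
theorem cls_cell {t : Fin τ.num} {x y : S.Complement} (p : Path x y)
    (hp : ∀ s, (p s : X) ∈ τ.cell t) {q q' : Tri} (hq : q ∈ Tri.inner) (hq' : q' ∈ Tri.inner)
    (hx : τ.chart t q = x) (hy : τ.chart t q' = y) :
    S.cls p = τ.seg t (Tri.notVertex_of_inner hq) (Tri.notVertex_of_inner hq') hx hy := by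
  have := S.hausdorff
  choose lft hl hle using hp
  refine τ.cls_eq_seg t _ _ _ _ p lft ?_ ?_ ?_ (fun s => Tri.notVertex_of_inner (hl s))
    fun s => (hle s).symm
  · rw [continuous_iff_isClosed]
    intro Z hZ
    have hpc : Continuous fun s => (p s : X) := by fun_prop
    convert ((hZ.isCompact.image (τ.chart t).continuous).isClosed).preimage hpc using 1
    ext s
    constructor
    · exact fun hs => ⟨lft s, hs, hle s⟩
    · rintro ⟨z, hz, hzs⟩
      have h := (τ.inner_eq (hl s) ((hle s).trans hzs.symm)).2
      rw [Set.mem_preimage, h]; exact hz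
  · exact (τ.inner_eq (hl 0) ((hle 0).trans (by rw [hx]; simp))).2
  · exact (τ.inner_eq (hl 1) ((hle 1).trans (by rw [hy]; simp))).2

theorem exists_isPos_isLoc {a : τ.Side} (ha : τ.rep a = a) {x : X} (hx : x ∈ τ.star a) :
    ∃ u k q, τ.IsPos a x u k q ∧ τ.IsLoc x u q := by
  rcases hx with ⟨q, hq, rfl⟩ | ⟨q, hq, rfl⟩
  · exact ⟨_, _, q, ⟨Or.inl rfl, hq, rfl⟩, τ.isLoc_of_collar hq ha⟩
  · rcases Tri.inner_or_side_of_collar hq with hq' | hq'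
    · exact ⟨_, _, q, ⟨Or.inr rfl, hq, rfl⟩, τ.isLoc_of_inner hq'⟩
    · have h1 : τ.chart (τ.bar a).1 q ∈ τ.edge a := by
        rw [← τ.edge_bar a]; exact ⟨q, hq', rfl⟩
      obtain ⟨q', h2, h3⟩ := h1
      refine ⟨_, _, q', ⟨Or.inl rfl, Tri.side_subset_collar _ h2, h3⟩, ?_⟩
      rw [← h3]
      exact τ.isLoc_of_side h2 ha

namespace NearbyPoints

variable {τ} (N : τ.NearbyPoints) (F : S.OrbGroupoid ⥤ SingleObj N.Perms)

/-- A morphism is good if it is compatible with the representation by words, after it is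
transported to barycentres. -/
def Good {x y : S.OrbGroupoid} (A : Σ t, x ⟶ τ.base t) (B : Σ t, y ⟶ τ.base t) (f : x ⟶ y) : Prop :=
  N.Pres F (inv A.2 ≫ f ≫ B.2)

variable {N F}

theorem Good.comp {x y z : S.OrbGroupoid} {A : Σ t, x ⟶ τ.base t} {B : Σ t, y ⟶ τ.base t}
    {C : Σ t, z ⟶ τ.base t} {f : x ⟶ y} {g : y ⟶ z} (hf : N.Good F A B f) (hg : N.Good F B C g) :
    N.Good F A C (f ≫ g) := by
  have h := Pres.comp hf hg
  simp only [Category.assoc, IsIso.hom_inv_id_assoc] at h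
  simpa [Good] using h

/-- When the source is anchored through `f` itself, transport to barycentres turns `f` into an
identity. Marked points are anchored in this way, so their tracks are good by construction. -/
theorem good_comp_hom {x y : S.OrbGroupoid} (f : x ⟶ y) (B : Σ t, y ⟶ τ.base t) :
    N.Good F ⟨B.1, f ≫ B.2⟩ B f := by
  unfold Good
  rw [IsIso.inv_hom_id]
  exact Pres.id B.1

theorem good_comp_inv {x y : S.OrbGroupoid} (f : x ⟶ y) (B : Σ t, y ⟶ τ.base t) :
    N.Good F B ⟨B.1, f ≫ B.2⟩ (inv f) := by
  unfold Good
  rw [IsIso.inv_hom_id_assoc, IsIso.inv_hom_id]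
  exact Pres.id B.1

theorem good_cell {t : Fin τ.num} {x y : S.Complement} (p : Path x y)
    (hp : ∀ s, (p s : X) ∈ τ.cell t) : N.Good F (τ.anchor x) (τ.anchor y) (S.cls p) := by
  have hx := hp 0
  have hy := hp 1
  rw [p.source] at hx
  rw [p.target] at hy
  obtain ⟨q, hq, hqx⟩ := hx
  obtain ⟨q', hq', hqy⟩ := hy
  rw [τ.cls_cell p hp hq hq' hqx hqy, τ.anchor_of_isLoc (t := t) (p := q) ⟨hqx, Or.inl hq⟩,
    τ.anchor_of_isLoc (t := t) (p := q') ⟨hqy, Or.inl hq'⟩, Good]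
  simp only
  rw [τ.inv_seg, τ.seg_trans, τ.seg_trans, τ.seg_self]
  exact Pres.id t

/-- By `cls_star` only two straight pieces via the arc remain. Anchored at barycentres they form a
morphism `arc`, which is the identity if both ends are on the same side. -/
theorem IsTransport.good_star (hF : N.IsTransport F) {a : τ.Side} (ha : τ.rep a = a)
    {x y : S.Complement} (p : Path x y) (hp : ∀ s, (p s : X) ∈ τ.star a) :
    N.Good F (τ.anchor x) (τ.anchor y) (S.cls p) := by
  have hx := hp 0
  have hy := hp 1
  rw [p.source] at hx
  rw [p.target] at hy
  obtain ⟨u, k, q, hq, hl⟩ := τ.exists_isPos_isLoc ha hx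
  obtain ⟨u', k', q', hq', hl'⟩ := τ.exists_isPos_isLoc ha hy
  have he : τ.edge (u, k) = τ.edge (u', k') := hq.edge_eq.trans hq'.edge_eq.symm
  obtain ⟨r, hr, hrc⟩ := τ.exists_match he (Tri.mid_mem k) (τ.chart_mid u k)
  rw [cls_star p hp hq hq' (Tri.mid_mem k) hr (τ.chart_mid u k) hrc, τ.anchor_of_isLoc hl,
    τ.anchor_of_isLoc hl', Good]
  simp only
  rw [τ.inv_seg, Category.assoc, τ.seg_trans, τ.seg_trans_assoc]
  have h := hF.pres_arc he
  rw [arc_eq he (Tri.mid_mem k) hr (τ.chart_mid u k) hrc] at h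
  exact h

theorem IsTransport.good_piece (hF : N.IsTransport F) (i : Piece τ) {x y : S.Complement}
    (p : Path x y) (hp : ∀ s, (p s : X) ∈ pieceSet i) :
    N.Good F (τ.anchor x) (τ.anchor y) (S.cls p) := by
  rcases i with t | a
  · exact good_cell p hp
  · exact hF.good_star a.2 p hp

/-- The image of a homotopy class in the orbifold fundamental groupoid. -/
def orbClass (S : MarkedSurface X) {x y : S.Complement} (p : Path.Homotopic.Quotient x y) :
    S.obj x ⟶ S.obj y :=
  (CategoryTheory.Quotient.functor S.OrbRel).map (X := ⟨x⟩) (Y := ⟨y⟩) p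

theorem good_trans (x y z : S.Complement) (p : Path.Homotopic.Quotient x y)
    (q : Path.Homotopic.Quotient y z) (hp : N.Good F (τ.anchor x) (τ.anchor y) (orbClass S p))
    (hq : N.Good F (τ.anchor y) (τ.anchor z) (orbClass S q)) :
    N.Good F (τ.anchor x) (τ.anchor z) (orbClass S (p.trans q)) := by
  have h : orbClass S (p.trans q) = orbClass S p ≫ orbClass S q :=
    (CategoryTheory.Quotient.functor S.OrbRel).map_comp (X := ⟨x⟩) (Y := ⟨y⟩) (Z := ⟨z⟩) p q
  rw [h]
  exact hp.comp hq

theorem IsTransport.good_of_notMem (hF : N.IsTransport F) {x y : S.Complement} (p : Path x y)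
    (hp : ∀ s, (p s : X) ∉ τ.verts) : N.Good F (τ.anchor x) (τ.anchor y) (S.cls p) :=
  path_induction (J := Piece τ)
    (fun x y p => N.Good F (τ.anchor x) (τ.anchor y) (orbClass S p)) good_trans
    (fun i => Subtype.val ⁻¹' pieceSet i)
    (fun i => (isOpen_pieceSet i).preimage continuous_subtype_val)
    (fun i _ _ p hp => hF.good_piece i p hp) p fun s => exists_mem_pieceSet (hp s)

theorem IsTransport.exists_good_track (hF : N.IsTransport F) (m : S.marked) {x : S.Complement}
    (hx : (x : X) ∈ (τ.track m).nbhd) :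
    ∃ p : Path (τ.track m).near x, (∀ s, (p s : X) ∈ (τ.track m).nbhd) ∧
      N.Good F (τ.anchor (τ.track m).near) (τ.anchor x) (S.cls p) ∧
      N.Good F (τ.anchor x) (τ.anchor (τ.track m).near) (inv (S.cls p)) := by
  have hW := (τ.track m).isMarkedNbhd
  by_cases hxm : (x : X) = m
  · obtain rfl : x = ⟨m, S.marked_notMem m.2⟩ := Subtype.ext hxm
    refine ⟨(τ.track m).path.symm, fun s => (τ.track m).path_mem _, ?_, ?_⟩
    · rw [τ.anchor_of_marked, S.cls_symm]
      exact good_comp_inv _ _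
    · rw [τ.anchor_of_marked, S.cls_symm, IsIso.inv_inv]
      exact good_comp_hom _ _
  · have hn : ((τ.track m).near : X) ∈ (τ.track m).nbhd \ {m.1} :=
      ⟨(τ.track m).near_mem, fun h => (τ.track m).near_notVert
        (by rw [Set.mem_singleton_iff.1 h]; exact Or.inl m.2)⟩
    obtain ⟨p, hp⟩ := hW.exists_path m.2 Set.sdiff_subset hW.simply'.isPathConnected hn
      (y := x) ⟨hx, hxm⟩
    have hv : ∀ s, (p s : X) ∉ τ.verts := fun s h => (hp s).2 (hW.eq_of_mem _ (hp s).1 h)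
    refine ⟨p, fun s => (hp s).1, hF.good_of_notMem p hv, ?_⟩
    rw [← S.cls_symm]
    exact hF.good_of_notMem p.symm fun s => hv _

/-- Simple connectedness of the neighbourhood lets the path be rerouted through the near point of
the track. Each leg is the track or a path avoiding all vertices, possibly reversed, and is good in
either case. -/
theorem IsTransport.good_marked (hF : N.IsTransport F) (m : S.marked) {x y : S.Complement}
    (p : Path x y) (hp : ∀ s, (p s : X) ∈ (τ.track m).nbhd) :
    N.Good F (τ.anchor x) (τ.anchor y) (S.cls p) := by
  have hx := hp 0
  have hy := hp 1
  rw [p.source] at hx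
  rw [p.target] at hy
  obtain ⟨q, hq, -, hg⟩ := hF.exists_good_track m hx
  obtain ⟨q', hq', hg', -⟩ := hF.exists_good_track m hy
  have h : S.cls p = inv (S.cls q) ≫ S.cls q' := by
    rw [IsIso.eq_inv_comp, ← S.cls_trans]
    refine S.cls_congr (homotopic_of_isSimplyConnected
      ((τ.track m).isMarkedNbhd.isSimplyConnected_preimage m.2) _ _ (fun s => ?_) hq')
    rw [Path.trans_apply]
    split_ifs
    · exact hq _
    · exact hp _
  rw [h]
  exact hg.comp hg'

/-- Goodness composes and holds in every piece and near every marked point. These sets cover the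
complement of the punctures, so subdividing a path suffices. -/
theorem IsTransport.good (hF : N.IsTransport F) {x y : S.Complement} (f : S.obj x ⟶ S.obj y) :
    N.Good F (τ.anchor x) (τ.anchor y) f := by
  obtain ⟨p, rfl⟩ : ∃ p : Path.Homotopic.Quotient x y, orbClass S p = f :=
    Quot.exists_rep f
  obtain ⟨p, rfl⟩ := Path.Homotopic.Quotient.mk_surjective p
  refine path_induction (J := Piece τ ⊕ S.marked)
    (fun x y p => N.Good F (τ.anchor x) (τ.anchor y) (orbClass S p)) good_trans
    (fun j => Subtype.val ⁻¹' Sum.elim pieceSet (fun m => (τ.track m).nbhd) j) ?_ ?_ p fun s => ?_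
  · rintro (i | m)
    · exact (isOpen_pieceSet i).preimage continuous_subtype_val
    · exact (τ.track m).isMarkedNbhd.isOpen.preimage continuous_subtype_val
  · rintro (i | m) x y p hp
    · exact hF.good_piece i p hp
    · exact hF.good_marked m p hp
  · by_cases h : (p s : X) ∈ τ.verts
    · have hm : (p s : X) ∈ S.marked := h.resolve_right (p s).2
      exact ⟨Sum.inr ⟨_, hm⟩, (τ.track ⟨_, hm⟩).isMarkedNbhd.mem⟩
    · obtain ⟨i, hi⟩ := exists_mem_pieceSet h
      exact ⟨Sum.inl i, hi⟩

/-- Every morphism between barycentres is represented by a reduced word. -/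
theorem IsTransport.rep (hF : N.IsTransport F) {t s : Fin τ.num} (h : τ.base t ⟶ τ.base s) :
    N.Rep t (val F h ReducedWord.nil).1 ⟨s, h⟩ := by
  have h1 := hF.good h
  rw [τ.anchor_center, τ.anchor_center, Good] at h1
  have h2 := h1 t ReducedWord.nil (𝟙 _) rfl
  simpa using h2

theorem IsTransport.val_eq_wordPerm (hF : N.IsTransport F) {t s : Fin τ.num}
    (h : τ.base t ⟶ τ.base s) :
    val F h = ReducedWord.wordPerm N.flip_involutive (val F h ReducedWord.nil).1 :=
  (hF.rep h).val_eq hF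

/-- Faithfulness: equal values give the same reduced word, and a word represents only one morphism
from a given triangle. -/
theorem IsTransport.eq_of_val_eq (hF : N.IsTransport F) {t s : Fin τ.num}
    {h k : τ.base t ⟶ τ.base s} (hk : val F h = val F k) : h = k := by
  have h1 := hF.rep h
  rw [hk] at h1
  exact eq_of_heq (Sigma.mk.inj (h1.unique (hF.rep k))).2

end NearbyPoints

end IdealTriangulation

end


noncomputable section

/-! Involutions of the orbifold fundamental groupoid -/

namespace IdealTriangulation.NearbyPoints

variable {X : Type*} [TopologicalSpace X] [ChartedSpace (EuclideanHalfSpace 2) X]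
  {S : MarkedSurface X} {τ : IdealTriangulation S} {N : τ.NearbyPoints}
  {F : S.OrbGroupoid ⥤ SingleObj N.Perms}

/-- The letter for the crossing of the folded arc of the triangle around a puncture. -/
def foldedLetter (N : τ.NearbyPoints) (P : S.punctures) : τ.Side := N.letter (N.tri P, N.fst P)

theorem flip_foldedLetter (P : S.punctures) : N.flip (N.foldedLetter P) = N.foldedLetter P :=
  N.flip_letter_of_folded (N.folded_fst P)

theorem letter_snd (P : S.punctures) : N.letter (N.tri P, N.snd P) = N.foldedLetter P := by
  rw [← bar_fst, letter_bar, N.flip_letter_of_folded (N.folded_fst P), foldedLetter]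

/-- The letter determines the triangle and the unordered pair of folded sides, hence their common
vertex, which is the puncture. -/
theorem foldedLetter_injective : Function.Injective N.foldedLetter := by
  intro P Q h
  have hs : N.tri P = N.tri Q ∧ (N.fst P = N.fst Q ∧ N.snd P = N.snd Q ∨
      N.fst P = N.snd Q ∧ N.snd P = N.fst Q) := by
    rcases N.eq_or_of_letter_eq h with h1 | ⟨-, h1⟩
    · have h2 := N.bar_fst P
      rw [h1, N.bar_fst] at h2
      rw [Prod.ext_iff] at h1 h2
      exact ⟨h1.1, Or.inl ⟨h1.2, h2.2.symm⟩⟩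
    · rw [bar_fst] at h1
      have h2 := N.bar_fst Q
      rw [h1, N.bar_snd] at h2
      rw [Prod.ext_iff] at h1 h2
      exact ⟨h1.1.symm, Or.inr ⟨h2.2, h1.2.symm⟩⟩
  obtain ⟨k, hk1, hk2⟩ := Tri.exists_third (N.fst P) (N.snd P)
  have hP := (N.folded P).2.2.1 k hk1.symm hk2.symm
  refine Subtype.ext (hP.symm.trans ?_)
  rw [hs.1]
  rcases hs.2 with ⟨h1, h2⟩ | ⟨h1, h2⟩ <;> rw [h1] at hk1 <;> rw [h2] at hk2
  · exact (N.folded Q).2.2.1 k hk1.symm hk2.symm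
  · exact (N.folded Q).2.2.1 k hk2.symm hk1.symm

theorem IsTransport.val_turnArc (hF : N.IsTransport F) (P : S.punctures) :
    val F (N.turnArc P) = ReducedWord.push N.flip_involutive (N.foldedLetter P) :=
  hF.val_arc _ (N.bar_fst P) fun h => (N.folded P).1 (Prod.ext_iff.1 h).2.symm

theorem IsTransport.turnArc_ne_id (hF : N.IsTransport F) (P : S.punctures) :
    N.turnArc P ≠ 𝟙 _ := fun h => by
  have h1 := hF.val_turnArc P
  rw [h, val_id] at h1
  exact ReducedWord.push_ne_one _ _ h1.symm

theorem IsTransport.val_conj (hF : N.IsTransport F) {t : Fin τ.num} {P : S.punctures}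
    (g : τ.base t ⟶ τ.base (N.tri P)) {u : List τ.Side}
    (hu : val F g = ReducedWord.wordPerm N.flip_involutive u) :
    val F (g ≫ N.turnArc P ≫ inv g) =
      ReducedWord.wordPerm N.flip_involutive (wordInv N.flip u ++ N.foldedLetter P :: u) := by
  rw [val_comp, val_comp, val_inv, hF.val_turnArc, hu, ReducedWord.wordPerm_append,
    ReducedWord.wordPerm_wordInv, ReducedWord.wordPerm_cons, mul_assoc]

/-- The reduced word equals its formal inverse, so it is $u^{-1}cu$ with $c$ fixed by `flip`. The
side crossed at $c$ is then folded, and the part of the path recorded by $u$ ends in the triangle of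
a puncture. -/
theorem IsTransport.exists_eq_conj (hF : N.IsTransport F) {t : Fin τ.num} {h : τ.base t ⟶ τ.base t}
    (hne : h ≠ 𝟙 _) (hh : h ≫ h = 𝟙 _) :
    ∃ (P : S.punctures) (g : τ.base t ⟶ τ.base (N.tri P)), g ≫ N.turnArc P ≫ inv g = h := by
  have hrep := hF.rep h
  have hval := hF.val_eq_wordPerm h
  generalize val F h ReducedWord.nil = w at hrep hval
  obtain ⟨w, hw⟩ := w
  have hinv : (val F h)⁻¹ = val F h := by
    rw [inv_eq_iff_mul_eq_one, ← val_comp, hh, val_id]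
  have hw' : wordInv N.flip w = w := by
    have h1 := congrArg (fun f : N.Perms => (f ReducedWord.nil).1) hinv
    rwa [hval, ← ReducedWord.wordPerm_wordInv, ReducedWord.wordPerm_apply_nil _ hw,
      ReducedWord.wordPerm_apply_nil _ (ReducedWord.isReducedWord_wordInv N.flip_involutive hw)] at h1
  have hw0 : w ≠ [] := by
    rintro rfl
    exact hne (eq_of_heq (Sigma.mk.inj hrep).2)
  obtain ⟨u, c, rfl, hc⟩ := ReducedWord.exists_middle_of_eq_wordInv w hw hw0 hw'.symm
  -- Words list the last crossing first, so dropping the letters before `c` leaves an initial part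
  -- of the path that ends by crossing `c`; `g` is what precedes this crossing.
  obtain ⟨_, t', s, i, j, -, g, hb, hne', rfl, hg, -⟩ := hrep.suffix
  obtain ⟨P, hP⟩ := N.folded_of_flip_letter hc (by rw [hb]; exact hne')
  have key : ∀ (g : τ.base t ⟶ τ.base (N.tri P)), N.letter (t', i) = N.foldedLetter P →
      N.Rep t u ⟨_, g⟩ → g ≫ N.turnArc P ≫ inv g = h := fun g hl hg => by
    refine hF.eq_of_val_eq ?_
    rw [hF.val_conj g (hg.val_eq hF), ← hl, hval]
  rcases hP with hP | hP
  · have hl : N.letter (t', i) = N.foldedLetter P := by rw [hP]; rfl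
    obtain ⟨rfl, -⟩ := Prod.ext_iff.1 hP
    exact ⟨P, g, key g hl hg⟩
  · have hl : N.letter (t', i) = N.foldedLetter P := by rw [hP, letter_snd]
    obtain ⟨rfl, -⟩ := Prod.ext_iff.1 hP
    exact ⟨P, g, key g hl hg⟩

theorem turnArc_conj {t : Fin τ.num} {P : S.punctures} (g : τ.base t ⟶ τ.base (N.tri P)) :
    (g ≫ N.turnArc P) ≫ N.turnArc P ≫ inv (g ≫ N.turnArc P) = g ≫ N.turnArc P ≫ inv g := by
  have h : inv (N.turnArc P) = N.turnArc P :=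
    (IsIso.eq_inv_of_hom_inv_id (N.turnArc_mul_self P)).symm
  rw [IsIso.inv_comp, h, Category.assoc, reassoc_of% N.turnArc_mul_self P]

/-- If the word of `g` begins with the folded letter, the turn removes that letter, and the
remainder cannot begin with it again because the word was reduced. -/
theorem IsTransport.exists_reduced (hF : N.IsTransport F) {t : Fin τ.num} {P : S.punctures}
    (g : τ.base t ⟶ τ.base (N.tri P)) :
    ∃ g' : τ.base t ⟶ τ.base (N.tri P), (g' = g ∨ g' = g ≫ N.turnArc P) ∧
      IsReducedWord N.flip (N.foldedLetter P :: (val F g' ReducedWord.nil).1) := by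
  by_cases h : IsReducedWord N.flip (N.foldedLetter P :: (val F g ReducedWord.nil).1)
  · exact ⟨g, Or.inl rfl, h⟩
  refine ⟨_, Or.inr rfl, ?_⟩
  rw [val_comp, hF.val_turnArc, Equiv.Perm.mul_apply]
  generalize val F g ReducedWord.nil = w at h
  obtain ⟨_ | ⟨c, w⟩, hw⟩ := w
  · exact absurd (List.isChain_singleton _) h
  have hc : c = N.flip (N.foldedLetter P) := by
    by_contra hc
    exact h (List.isChain_cons_cons.2 ⟨hc, hw⟩)
  rw [ReducedWord.push_cons_self _ hc]
  rw [hc, flip_foldedLetter] at hw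
  exact hw

/-- Once both conjugators are normalised by `exists_reduced`, the conjugates are given by reduced
words, so middle letters and right halves agree. Undoing the normalisations produces the two
alternatives. -/
theorem IsTransport.eq_of_conj_eq (hF : N.IsTransport F) {t : Fin τ.num} {P Q : S.punctures}
    (g : τ.base t ⟶ τ.base (N.tri P)) (k : τ.base t ⟶ τ.base (N.tri Q))
    (h : g ≫ N.turnArc P ≫ inv g = k ≫ N.turnArc Q ≫ inv k) :
    P = Q ∧ (HEq k g ∨ HEq k (g ≫ N.turnArc P)) := by
  obtain ⟨g', hg, hgr⟩ := hF.exists_reduced g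
  obtain ⟨k', hk, hkr⟩ := hF.exists_reduced k
  have h' : g' ≫ N.turnArc P ≫ inv g' = k' ≫ N.turnArc Q ≫ inv k' := by
    have e1 : g' ≫ N.turnArc P ≫ inv g' = g ≫ N.turnArc P ≫ inv g := by
      rcases hg with rfl | rfl
      · rfl
      · exact turnArc_conj g
    have e2 : k' ≫ N.turnArc Q ≫ inv k' = k ≫ N.turnArc Q ≫ inv k := by
      rcases hk with rfl | rfl
      · rfl
      · exact turnArc_conj k
    rw [e1, e2, h]
  have h1 := congrArg (fun f => (val F f ReducedWord.nil).1) h'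
  rw [hF.val_conj g' (hF.val_eq_wordPerm g'), hF.val_conj k' (hF.val_eq_wordPerm k'),
    ReducedWord.wordPerm_apply_nil _ (ReducedWord.isReducedWord_conj N.flip_involutive (flip_foldedLetter P) hgr),
    ReducedWord.wordPerm_apply_nil _
      (ReducedWord.isReducedWord_conj N.flip_involutive (flip_foldedLetter Q) hkr)] at h1
  obtain ⟨h2, h3⟩ := ReducedWord.conj_inj h1
  obtain rfl := foldedLetter_injective h2
  refine ⟨rfl, ?_⟩
  have h4 : g' = k' := hF.eq_of_val_eq (by rw [hF.val_eq_wordPerm g', h3, ← hF.val_eq_wordPerm k'])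
  subst h4
  rcases hg with rfl | rfl <;> rcases hk with hk | hk
  · exact Or.inl (heq_of_eq hk.symm)
  · right
    rw [hk, Category.assoc, N.turnArc_mul_self, Category.comp_id]
  · exact Or.inr (heq_of_eq hk.symm)
  · left
    exact heq_of_eq ((cancel_mono _).1 hk.symm)

/-- The anchor at a marked point. -/
def markedAnchor (m : S.marked) :
    S.markedObj m ⟶ τ.base (τ.anchor ⟨m, S.marked_notMem m.2⟩).1 :=
  (τ.anchor ⟨m, S.marked_notMem m.2⟩).2

/-- The morphism between barycentres which belongs to a morphism from a marked point to a point
near a puncture. -/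
def core {m : S.marked} {P : S.punctures} (v : S.markedObj m ⟶ S.obj (N.point P)) :
    τ.base (τ.anchor ⟨m, S.marked_notMem m.2⟩).1 ⟶ τ.base (N.tri P) :=
  inv (markedAnchor m) ≫ v ≫ inv (N.toPoint P)

theorem core_injective {m : S.marked} {P : S.punctures} :
    Function.Injective (core (N := N) (m := m) (P := P)) := fun v w h => by
  unfold core at h
  exact (cancel_mono _).1 ((cancel_epi _).1 h)

theorem core_turn {m : S.marked} {P : S.punctures} (v : S.markedObj m ⟶ S.obj (N.point P)) :
    core (v ≫ N.e P) = core v ≫ N.turnArc P := by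
  have h : N.e P ≫ inv (N.toPoint P) = inv (N.toPoint P) ≫ N.turnArc P := by
    rw [IsIso.comp_inv_eq, Category.assoc, IsIso.eq_inv_comp, N.toPoint_e]
  simp only [core, Category.assoc, h]

theorem core_conj {m : S.marked} {P : S.punctures} (v : S.markedObj m ⟶ S.obj (N.point P)) :
    core v ≫ N.turnArc P ≫ inv (core v) =
      inv (markedAnchor (τ := τ) m) ≫ (v ≫ N.e P ≫ inv v) ≫ markedAnchor (τ := τ) m := by
  rw [← Category.assoc, ← core_turn]
  simp [core]

theorem IsTransport.exists_lasso (hF : N.IsTransport F) {m : S.marked}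
    {γ : S.markedObj m ⟶ S.markedObj m} (hne : γ ≠ 𝟙 _) (hγ : γ ≫ γ = 𝟙 _) :
    ∃ (P : S.punctures) (v : S.markedObj m ⟶ S.obj (N.point P)), v ≫ N.e P ≫ inv v = γ := by
  let a := markedAnchor (τ := τ) m
  obtain ⟨P, g, hg⟩ := hF.exists_eq_conj (h := inv a ≫ γ ≫ a)
    (fun h => hne (by
      rw [IsIso.inv_comp_eq, Category.comp_id] at h
      exact (cancel_mono a).1 (h.trans (Category.id_comp a).symm)))
    (by simp only [Category.assoc, IsIso.hom_inv_id_assoc, reassoc_of% hγ, IsIso.inv_hom_id])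
  refine ⟨P, a ≫ g ≫ N.toPoint P, ?_⟩
  have hc : core (a ≫ g ≫ N.toPoint P) = g := by simp [core, a]
  have h := core_conj (a ≫ g ≫ N.toPoint P)
  rw [hc, hg] at h
  exact ((cancel_mono _).1 ((cancel_epi _).1 h)).symm

theorem IsTransport.eq_of_lasso_eq (hF : N.IsTransport F) {m : S.marked} {P Q : S.punctures}
    (v : S.markedObj m ⟶ S.obj (N.point P)) (w : S.markedObj m ⟶ S.obj (N.point Q))
    (h : v ≫ N.e P ≫ inv v = w ≫ N.e Q ≫ inv w) :
    P = Q ∧ (HEq w v ∨ HEq w (v ≫ N.e P)) := by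
  have h1 : core v ≫ N.turnArc P ≫ inv (core v) = core w ≫ N.turnArc Q ≫ inv (core w) := by
    rw [core_conj, core_conj, h]
  obtain ⟨rfl, h2⟩ := hF.eq_of_conj_eq _ _ h1
  refine ⟨rfl, h2.imp (fun h3 => ?_) fun h3 => ?_⟩
  · exact heq_of_eq (core_injective (eq_of_heq h3))
  · rw [← core_turn] at h3
    exact heq_of_eq (core_injective (eq_of_heq h3))

theorem IsTransport.e_ne_id (hF : N.IsTransport F) (P : S.punctures) : N.e P ≠ 𝟙 _ := fun h => by
  have h1 := N.toPoint_e P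
  rw [h, Category.comp_id] at h1
  refine hF.turnArc_ne_id P ((cancel_mono (N.toPoint P)).1 ?_)
  rw [← h1, Category.id_comp]

theorem turn_turn (N : τ.NearbyPoints) (v : N.ArrowToPuncture) : N.turn (N.turn v) = v := by
  obtain ⟨m, P, v⟩ := v
  have h : (v ≫ N.e P) ≫ N.e P = v := by rw [Category.assoc, N.e_mul_self, Category.comp_id]
  simp only [turn, h]
  rfl

theorem lasso_turn (N : τ.NearbyPoints) (v : N.ArrowToPuncture) : N.lasso (N.turn v) = N.lasso v := by
  obtain ⟨m, P, v⟩ := v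
  have h : inv (N.e P) = N.e P := (IsIso.eq_inv_of_hom_inv_id (N.e_mul_self P)).symm
  have h1 : (v ≫ N.e P) ≫ N.e P ≫ inv (v ≫ N.e P) = v ≫ N.e P ≫ inv v := by
    rw [IsIso.inv_comp, h, Category.assoc, reassoc_of% N.e_mul_self P]
  simp only [turn, lasso, Groupoid.inv_eq_inv, h1]
  rfl

theorem IsTransport.turn_ne (hF : N.IsTransport F) (v : N.ArrowToPuncture) : N.turn v ≠ v := by
  obtain ⟨m, P, v⟩ := v
  intro h
  have h1 := eq_of_heq (Sigma.mk.inj (eq_of_heq (Sigma.mk.inj h).2)).2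
  exact hF.e_ne_id P ((cancel_epi v).1 (h1.trans (Category.comp_id v).symm))

theorem IsTransport.lasso_mem (hF : N.IsTransport F) (v : N.ArrowToPuncture) :
    N.lasso v ∈ S.Involutions := by
  obtain ⟨m, P, v⟩ := v
  refine ⟨fun m' h => ?_, ?_⟩
  · obtain ⟨rfl, h⟩ := Sigma.mk.inj h
    have h1 := eq_of_heq (Sigma.mk.inj (eq_of_heq h)).2
    rw [Groupoid.inv_eq_inv] at h1
    refine hF.e_ne_id P ((cancel_epi v).1 ((cancel_mono (inv v)).1 ?_))
    rw [Category.comp_id, Category.assoc, IsIso.hom_inv_id]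
    exact h1
  · have h : inv (N.e P) = N.e P := (IsIso.eq_inv_of_hom_inv_id (N.e_mul_self P)).symm
    have h1 : inv (v ≫ N.e P ≫ inv v) = v ≫ N.e P ≫ inv v := by
      simp [h]
    simp only [lasso, MarkedSurface.MarkedArrow.inverse, Groupoid.inv_eq_inv, h1]
    rfl

theorem IsTransport.exists_lasso_eq (hF : N.IsTransport F) {γ : S.MarkedArrow}
    (hγ : γ ∈ S.Involutions) : ∃ v, N.lasso v = γ := by
  obtain ⟨m, n, γ⟩ := γ
  obtain ⟨hne, hinv⟩ := hγ
  obtain ⟨rfl, h⟩ := Sigma.mk.inj hinv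
  have h1 : γ = Groupoid.inv γ := eq_of_heq (Sigma.mk.inj (eq_of_heq h)).2
  obtain ⟨P, v, rfl⟩ := hF.exists_lasso (γ := γ) (fun h2 => hne m (by rw [h2]; rfl)) (by
    nth_rw 2 [h1]; exact Groupoid.comp_inv γ)
  exact ⟨⟨m, P, v⟩, by simp only [lasso, Groupoid.inv_eq_inv]; rfl⟩

theorem IsTransport.lasso_eq_iff (hF : N.IsTransport F) {v w : N.ArrowToPuncture}
    (h : N.lasso v = N.lasso w) : w = v ∨ w = N.turn v := by
  obtain ⟨m, P, v⟩ := v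
  obtain ⟨m', Q, w⟩ := w
  obtain ⟨rfl, h⟩ := Sigma.mk.inj h
  have h1 := eq_of_heq (Sigma.mk.inj (eq_of_heq h)).2
  rw [Groupoid.inv_eq_inv, Groupoid.inv_eq_inv] at h1
  obtain ⟨rfl, h2 | h2⟩ := hF.eq_of_lasso_eq v w h1
  · left; rw [eq_of_heq h2]
  · right; rw [eq_of_heq h2]; rfl

end IdealTriangulation.NearbyPoints

/-- A surjection whose fibres are the orbits of an involution without fixed points splits off a
factor of order two. -/
theorem exists_equiv_prod_zmod_two {A B : Type*} (f : A → B) (hf : Function.Surjective f)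
    (θ : A → A) (hθ : ∀ a, θ (θ a) = a) (hne : ∀ a, θ a ≠ a) (hfθ : ∀ a, f (θ a) = f a)
    (hfib : ∀ a a', f a = f a' → a' = a ∨ a' = θ a) :
    ∃ Φ : A ≃ B × ZMod 2, ∀ a, (Φ a).1 = f a ∧ Φ (θ a) = ((Φ a).1, (Φ a).2 + 1) := by
  classical
  choose s hs using hf
  -- The section picks a base point in each fibre, labelled `0`; its partner is labelled `1`, so the
  -- involution shifts the label.
  let φ : A → B × ZMod 2 := fun a => (f a, if a = s (f a) then 0 else 1)
  have hφ : ∀ a, φ (θ a) = ((φ a).1, (φ a).2 + 1) := fun a => by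
    refine Prod.ext (hfθ a) ?_
    change (if θ a = s (f (θ a)) then (0 : ZMod 2) else 1) = (if a = s (f a) then 0 else 1) + 1
    rw [hfθ]
    rcases hfib (s (f a)) a (hs (f a)) with h | h
    · rw [if_pos h, if_neg, zero_add]
      rw [← h]; exact hne a
    · have h1 : θ a = s (f a) := by
        have h2 := congrArg θ h
        rwa [hθ] at h2
      have h2 : a ≠ s (f a) := fun h3 => hne a (h1.trans h3.symm)
      rw [if_pos h1, if_neg h2]
      rfl
  refine ⟨Equiv.ofBijective φ ⟨fun a a' h => ?_, ?_⟩, fun a => ⟨rfl, hφ a⟩⟩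
  · rcases hfib a a' (congrArg Prod.fst h) with h1 | h1
    · exact h1.symm
    · have h2 := congrArg Prod.snd h
      rw [h1, hφ] at h2
      simp at h2
  · have hsφ : ∀ b, φ (s b) = (b, 0) := fun b => Prod.ext (hs b) (if_pos (by rw [hs]))
    rintro ⟨b, ε⟩
    fin_cases ε
    · exact ⟨s b, hsφ b⟩
    · refine ⟨θ (s b), ?_⟩
      rw [hφ, hsφ]
      rfl

theorem mainTheorem10 {X : Type*} [TopologicalSpace X] [ChartedSpace (EuclideanHalfSpace 2) X]
    (S : MarkedSurface X) (τ : IdealTriangulation S) (hτ : τ.IsSkewedGentle)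
    (N : τ.NearbyPoints) :
    ∃ Φ : N.ArrowToPuncture ≃ S.Involutions × ZMod 2,
      ∀ v : N.ArrowToPuncture,
        ((Φ v).1 : S.MarkedArrow) = N.lasso v ∧
        Φ (N.turn v) = ((Φ v).1, (Φ v).2 + 1) := by
  obtain ⟨F, hF⟩ := N.exists_isTransport
  obtain ⟨Φ, hΦ⟩ := exists_equiv_prod_zmod_two
    (fun v => (⟨N.lasso v, hF.lasso_mem v⟩ : S.Involutions))
    (fun γ => by
      obtain ⟨v, hv⟩ := hF.exists_lasso_eq γ.2
      exact ⟨v, Subtype.ext hv⟩)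
    N.turn N.turn_turn hF.turn_ne (fun v => Subtype.ext (N.lasso_turn v))
    fun v w h => hF.lasso_eq_iff (congrArg Subtype.val h)
  exact ⟨Φ, fun v => ⟨congrArg Subtype.val (hΦ v).1, (hΦ v).2⟩⟩

end
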